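/- **Setting.** Let $\Omega$ be a set of outcomes and, for each $\omega\in\Omega$, let $\mathcal D(\omega)\subset\mathbb R^2$ be a bounded Lipschitz domain (e.g. with $C^{1,1}$ or convex polygonal boundary) inside a fixed open fictitious domain $\widetilde{\mathcal D}$, with $\mathcal D(\omega)=\{x\in\widetilde{\mathcal D}:\phi(x,\omega)<0\}$ and $\Gamma(\omega)=\partial\mathcal D(\omega)=\{x\in\widetilde{\mathcal D}:\phi(x,\omega)=0\}$ for a level set function $\phi$. Let $\Gamma(\omega)=\Gamma_D(\omega)\cup\Gamma_N(\omega)$ with $\Gamma_D,\Gamma_N$ disjoint and measurable and $\Gamma_D$ of positive length, and let $\mathbf n_\Gamma$ be the outward unit normal. Fix $\omega$ and drop it from the notation. Write $(v,w)_X=\int_X vw$, also $\langle v,w\rangle_X$ if $X$ is a curve, $\|v\|_X=(v,v)_X^{1/2}$ and $\|\cdot\|=\|\cdot\|_{\mathcal D}$. Let $\widetilde{\mathcal T}_h$ be a conforming triangulation of $\widetilde{\mathcal D}$ into closed triangles $K$ with mesh size $h=\max_K\operatorname{diam}K$, shape regular and quasi-uniform with constant $\kappa$: each $K$ contains a disc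 of radius at least $\operatorname{diam}(K)/\kappa$, and $h\le\kappa\operatorname{diam}K$. Let $\mathcal T_h=\{K:K\cap\mathcal D\ne\emptyset\}$, $\mathcal D_{\mathcal T}=\bigcup_{K\in\mathcal T_h}K$, $G_h=\{K:K\cap\Gamma\neq\emptyset\}$, and let $\mathcal F_G$ be the set of common edges $F=K\cap K'$ of two triangles $K,K'\in\mathcal T_h$ at least one of which is in $G_h$. Assume that, for each $K\in G_h$, $\Gamma$ meets $\partial K$ exactly twice and each edge of $K$ at most once, and that some $K'\in\mathcal T_h\setminus G_h$ satisfies $K\cap K'\ne\emptyset$. Let $V^h$ be the space of continuous functions on $\mathcal D_{\mathcal T}$ that are affine on each $K\in\mathcal T_h$. For $\gamma_D,\gamma_1>0$, $\gamma_N\ge0$ and $w,v\in V^h$ set $A_h=a_h+j$ with $$a_h(w,v)=(\nabla w,\nabla v)_{\mathcal D}-\langle\mathbf n_\Gamma\!\cdot\!\nabla w,v\rangle_{\Gamma_D}-\langle\mathbf n_\Gamma\!\cdot\!\nabla v,w\rangle_{\Gamma_D}+\gamma_Dh^{-1}\langle w,v\rangle_{\Gamma_D}+\gamma_Nh\langle\mathbf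 n_\Gamma\!\cdot\!\nabla w,\mathbf n_\Gamma\!\cdot\!\nabla v\rangle_{\Gamma_N},$$ $$j(w,v)=\sum_{F\in\mathcal F_G}\gamma_1h\,\langle[\![\mathbf n_F\!\cdot\!\nabla w]\!],[\![\mathbf n_F\!\cdot\!\nabla v]\!]\rangle_F,$$ $$L_h(v)=(f,v)_{\mathcal D}+\langle g_D,\gamma_Dh^{-1}v-\mathbf n_\Gamma\!\cdot\!\nabla v\rangle_{\Gamma_D}+\langle g_N,v+\gamma_Nh\,\mathbf n_\Gamma\!\cdot\!\nabla v\rangle_{\Gamma_N},$$ where $\mathbf n_F$ is a unit normal to $F$ and $[\![\cdot]\!]$ is the jump across $F$, and $$|||v|||_*^2=\|\nabla v\|^2_{\mathcal D}+h\|\mathbf n_\Gamma\!\cdot\!\nabla v\|^2_{\Gamma_N}+\gamma_Dh^{-1}\|v\|^2_{\Gamma_D}.$$ Let $\alpha>0$, $f,y_d\in L^2(\mathcal D)$, $g_D\in L^2(\Gamma_D)$, $g_N\in L^2(\Gamma_N)$. * Let $(\bar y,\bar p,\bar u)\in H^2(\mathcal D)\times H^2(\mathcal D)\times L^2(\mathcal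 D)$ solve the continuous optimality system: $\bar y=g_D$ and $\bar p=0$ on $\Gamma_D$, $\alpha\bar u+\bar p=0$ and, for all $v\in H^1(\mathcal D)$ with $v|_{\Gamma_D}=0$, $(\nabla\bar y,\nabla v)_{\mathcal D}=(f+\bar u,v)_{\mathcal D}+\langle g_N,v\rangle_{\Gamma_N}$ and $(\nabla v,\nabla\bar p)_{\mathcal D}=(\bar y-y_d,v)_{\mathcal D}$. * Let $(\bar y_h,\bar p_h,\bar u_h)\in V^h\times V^h\times L^2(\mathcal D)$ solve the discrete optimality system: $\alpha\bar u_h+\bar p_h=0$ in $\mathcal D$ and, for all $v_h\in V^h$, $A_h(\bar y_h,v_h)=(\bar u_h,v_h)_{\mathcal D}+L_h(v_h)$ and $A_h(v_h,\bar p_h)=(\bar y_h-y_d,v_h)_{\mathcal D}$. * Let $y^h,p^h\in V^h$ solve the auxiliary problems: for all $v_h\in V^h$, $A_h(y^h,v_h)=(\bar u,v_h)_{\mathcal D}+L_h(v_h)$ and $A_h(v_h,p^h)=(\bar y-y_d,v_h)_{\mathcal D}$. **Theorem.** Then $$\alpha\|\bar u-\bar u_h\|^2+\|\bar y-\bar y_h\|^2\le\frac1\alpha\|\bar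 p-p^h\|^2+\|\bar y-y^h\|^2 .$$ Moreover, if $\gamma_D\ge\gamma_0$, where $\gamma_0>0$ depends only on the geometry ($\widetilde{\mathcal D}$, $\mathcal D(\omega)$, $\Gamma_D(\omega)$, $\Gamma_N(\omega)$), $\kappa$ and $\gamma_1$, then $$\|\bar p-\bar p_h\|\le C\left(\|\bar p-p^h\|+\|\bar y-\bar y_h\|\right),$$ $$|||\bar y-\bar y_h|||_*\le C\left(|||\bar y-y^h|||_*+\|\bar u-\bar u_h\|\right),$$ $$|||\bar p-\bar p_h|||_*\le C\left(|||\bar p-p^h|||_*+\|\bar y-\bar y_h\|\right),$$ where $C>0$ depends only on the geometry, $\kappa$, $\gamma_1$, $\gamma_D$ and $\gamma_N$; in particular it does not depend on $h$, on the mesh and how $\Gamma$ cuts it, on $\alpha$, or on the data. -/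

import Mathlib

open MeasureTheory Set Filter Topology
open scoped ENNReal NNReal RealInnerProductSpace

namespace CutFEM

noncomputable section

/-- The Euclidean plane `ℝ²`. -/
abbrev Plane : Type := EuclideanSpace ℝ (Fin 2)

/-- Arc length in the plane (one-dimensional Hausdorff measure). -/
abbrev arcLength : Measure Plane := Measure.hausdorffMeasure 1

/-! ### `L²` products and norms, weak gradients, Sobolev spaces, traces -/

/-- `(v, w)_X = ∫_X v w`, where `X` is represented by the measure `μ`. -/
def l2Inner (μ : Measure Plane) (v w : Plane → ℝ) : ℝ := ∫ x, v x * w x ∂μ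

/-- `‖v‖_X = (v, v)_X^{1/2}`. -/
def l2Norm (μ : Measure Plane) (v : Plane → ℝ) : ℝ := Real.sqrt (l2Inner μ v v)

/-- `u ∈ L²(D)` has the weak gradient `G ∈ L²(D)²` in the open set `D`. -/
def HasWeakGrad (D : Set Plane) (u : Plane → ℝ) (G : Plane → Plane) : Prop :=
  MemLp u 2 (volume.restrict D) ∧ MemLp G 2 (volume.restrict D) ∧
    ∀ φ : Plane → ℝ, ContDiff ℝ ((⊤ : ℕ∞) : WithTop ℕ∞) φ → HasCompactSupport φ → tsupport φ ⊆ D →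
      ∫ x in D, u x • gradient φ x = - ∫ x in D, φ x • G x

/-- Membership in `H¹(D)`. -/
def IsH1 (D : Set Plane) (u : Plane → ℝ) : Prop := ∃ G, HasWeakGrad D u G

open Classical in
/-- The weak gradient of `u ∈ H¹(D)`, unique up to null sets (and `0` if `u ∉ H¹(D)`). -/
def weakGrad (D : Set Plane) (u : Plane → ℝ) : Plane → Plane :=
  if hu : ∃ G, HasWeakGrad D u G then hu.choose else 0

/-- Membership in `H²(D)`. -/
def IsH2 (D : Set Plane) (u : Plane → ℝ) : Prop :=
  IsH1 D u ∧ ∀ i : Fin 2, IsH1 D (fun x => weakGrad D u x i)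

/-- `g ∈ L²(∂D)` is the trace of `u ∈ H¹(D)`: there are smooth functions on the plane that converge
to `u` in `H¹(D)` and whose restrictions to `∂D` converge to `g` in `L²(∂D)`. -/
def HasTrace (D : Set Plane) (u g : Plane → ℝ) : Prop :=
  IsH1 D u ∧ MemLp g 2 (arcLength.restrict (frontier D)) ∧
    ∃ φ : ℕ → Plane → ℝ, (∀ n, ContDiff ℝ ((⊤ : ℕ∞) : WithTop ℕ∞) (φ n)) ∧
      Tendsto (fun n => eLpNorm (fun x => φ n x - u x) 2 (volume.restrict D)) atTop (𝓝 0) ∧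
      Tendsto (fun n => eLpNorm (fun x => gradient (φ n) x - weakGrad D u x) 2
        (volume.restrict D)) atTop (𝓝 0) ∧
      Tendsto (fun n => eLpNorm (fun x => φ n x - g x) 2
        (arcLength.restrict (frontier D))) atTop (𝓝 0)

open Classical in
/-- The trace on `∂D` of `u ∈ H¹(D)`, for a bounded Lipschitz domain `D`. -/
def trace (D : Set Plane) (u : Plane → ℝ) : Plane → ℝ :=
  if hu : ∃ g, HasTrace D u g then hu.choose else 0

/-- The trace on `∂D` of the gradient of `u ∈ H²(D)`, taken componentwise. -/
def gradTrace (D : Set Plane) (u : Plane → ℝ) (x : Plane) : Plane :=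
  WithLp.toLp 2 (fun i : Fin 2 => trace D (fun y => weakGrad D u y i) x)

/-! ### Domains -/

/-- Bounded Lipschitz domains: nonempty, open, connected, bounded, and, near each boundary point
and after a rigid motion, the strict epigraph of a Lipschitz function of one variable. Bounded
domains with `C^{1,1}` boundary and bounded convex polygonal domains are of this kind. -/
def IsLipschitzDomain (D : Set Plane) : Prop :=
  IsOpen D ∧ IsConnected D ∧ Bornology.IsBounded D ∧
    ∀ x ∈ frontier D, ∃ (e : Plane ≃ᵃⁱ[ℝ] Plane) (g : ℝ → ℝ) (L : ℝ≥0) (r : ℝ),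
      LipschitzWith L g ∧ 0 < r ∧
        ∀ y ∈ Metric.ball x r, (y ∈ D ↔ g (e y 0) < e y 1)

/-- `n` is the outward unit normal of `D` at the boundary point `x`: within each cone around `-n`
(resp. `n`) with vertex `x` the points near `x` are in `D` (resp. outside `D`). -/
def IsOutwardUnitNormal (D : Set Plane) (x n : Plane) : Prop :=
  ‖n‖ = 1 ∧ ∀ ε > 0, ∀ᶠ y in 𝓝[≠] x,
    (⟪y - x, n⟫ ≤ -ε * ‖y - x‖ → y ∈ D) ∧ (ε * ‖y - x‖ ≤ ⟪y - x, n⟫ → y ∉ D)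

open Classical in
/-- The outward unit normal field `n_Γ` on `Γ = ∂D`. On a Lipschitz domain it exists and is unique
almost everywhere with respect to arc length. -/
def outwardNormal (D : Set Plane) : Plane → Plane :=
  if hn : ∃ n : Plane → Plane, Measurable n ∧
      ∀ᵐ x ∂(arcLength.restrict (frontier D)), IsOutwardUnitNormal D x (n x)
    then hn.choose else 0

/-- A bounded domain `D` whose boundary is decomposed into disjoint parts `Γ_D` and `Γ_N`, the first
of positive length. -/
structure MixedDomain where
  /-- the domain `D` -/
  domain : Set Plane
  /-- the Dirichlet part `Γ_D` of the boundary -/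
  dirichlet : Set Plane
  /-- the Neumann part `Γ_N` of the boundary -/
  neumann : Set Plane
  isLipschitz : IsLipschitzDomain domain
  measurable_dirichlet : MeasurableSet dirichlet
  measurable_neumann : MeasurableSet neumann
  disjoint : Disjoint dirichlet neumann
  union_eq : dirichlet ∪ neumann = frontier domain
  dirichlet_pos : 0 < arcLength dirichlet

namespace MixedDomain

variable (G : MixedDomain)

/-- Lebesgue measure on `D`. -/
def vol : Measure Plane := volume.restrict G.domain

/-- Arc length on `Γ_D`. -/
def lenD : Measure Plane := arcLength.restrict G.dirichlet

/-- Arc length on `Γ_N`. -/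
def lenN : Measure Plane := arcLength.restrict G.neumann

/-- The outward unit normal `n_Γ`. -/
def normal : Plane → Plane := outwardNormal G.domain

end MixedDomain

/-- A random geometry: for each outcome `ω` a domain `D(ω)` with decomposed boundary `Γ(ω)`, both
given inside an open fictitious domain by a level set function `φ(·, ω)`, as `D(ω) = {φ < 0}` and
`Γ(ω) = {φ = 0}`. -/
structure RandomGeometry (Ω : Type*) where
  /-- the fictitious domain, which contains all `D(ω)` and their boundaries -/
  holdAll : Set Plane
  isOpen_holdAll : IsOpen holdAll
  /-- the level set function -/
  levelSet : Plane → Ω → ℝ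
  /-- the domain with its boundary parts for the outcome `ω` -/
  real : Ω → MixedDomain
  domain_eq : ∀ ω, (real ω).domain = {x ∈ holdAll | levelSet x ω < 0}
  boundary_eq : ∀ ω, frontier (real ω).domain = {x ∈ holdAll | levelSet x ω = 0}

/-! ### Background meshes -/

/-- The closed simplex spanned by a finite set of vertices. -/
def hull (K : Finset Plane) : Set Plane := convexHull ℝ (K : Set Plane)

/-- A conforming triangulation of (the closure of) `U`: a finite simplicial complex
whose triangles cover `closure U` exactly. -/
structure Triangulation (U : Set Plane) where
  /-- the underlying complex: vertices, edges and triangles, given by their vertex sets -/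
  complex : Geometry.SimplicialComplex ℝ Plane
  finite_faces : complex.faces.Finite
  covers : ⋃ K ∈ {K ∈ complex.faces | K.card = 3}, hull K = closure U

namespace Triangulation

variable {U : Set Plane} (T : Triangulation U)

/-- The triangles `K` of the mesh. -/
def elements : Finset (Finset Plane) := T.finite_faces.toFinset.filter (fun K => K.card = 3)

/-- The mesh size `h = max_K diam K`. -/
def meshSize : ℝ := sSup ((fun K => Metric.diam (hull K)) '' (T.elements : Set (Finset Plane)))

/-- Shape regularity and quasi-uniformity with constant `κ`: each triangle contains a disc whose
radius is at least `diam K / κ`, and `h ≤ κ diam K`. -/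
def IsQuasiUniform (κ : ℝ) : Prop :=
  ∀ K ∈ T.elements,
    (∃ (c : Plane) (ρ : ℝ), 0 < ρ ∧ Metric.closedBall c ρ ⊆ hull K ∧
      Metric.diam (hull K) ≤ κ * ρ) ∧
    T.meshSize ≤ κ * Metric.diam (hull K)

variable (G : MixedDomain)

open Classical in
/-- The active mesh: the triangles that meet `D`. -/
def active : Finset (Finset Plane) := T.elements.filter (fun K => (hull K ∩ G.domain).Nonempty)

open Classical in
/-- The cut triangles `G_h`, which meet `Γ`. -/
def cut : Finset (Finset Plane) :=
  T.elements.filter (fun K => (hull K ∩ frontier G.domain).Nonempty)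

/-- The extended domain (a closed set), covered by the active mesh. -/
def extended : Set Plane := ⋃ K ∈ T.active G, hull K

/-- `Γ` meets the boundary of each cut triangle exactly twice and each of its edges at most once. -/
def BoundaryResolved : Prop :=
  ∀ K ∈ T.cut G, (frontier (hull K) ∩ frontier G.domain).ncard = 2 ∧
    ∀ e ⊆ K, e.card = 2 → (hull e ∩ frontier G.domain).Subsingleton

/-- Each cut triangle touches an active triangle that is not cut. (That the sizes of the two and of
the faces in between are comparable is part of `IsQuasiUniform`.) -/
def HasUncutNeighbours : Prop :=
  ∀ K ∈ T.cut G, ∃ K' ∈ T.active G, K' ∉ T.cut G ∧ (hull K ∩ hull K').Nonempty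

/-- The finite element space `V^h`: continuous functions on the extended domain that are affine on
each active triangle (values outside the extended domain are irrelevant). -/
def IsDiscrete (v : Plane → ℝ) : Prop :=
  ContinuousOn v (T.extended G) ∧
    ∀ K ∈ T.active G, ∃ a : Plane →ᵃ[ℝ] ℝ, EqOn v a (hull K)

open Classical in
/-- Ordered pairs `(K, K')` of active triangles with a common edge, at least one of them cut. Each
face in `𝓕_G` is `K ∩ K'` for exactly two such pairs. -/
def ghostPairs : Finset (Finset Plane × Finset Plane) :=
  (T.active G ×ˢ T.active G).filter
    (fun P => (P.1 ∩ P.2).card = 2 ∧ (P.1 ∈ T.cut G ∨ P.2 ∈ T.cut G))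

end Triangulation

/-- A fixed, but arbitrary, unit normal of the segment with end points `F`. -/
def faceNormal (F : Finset Plane) : Plane :=
  Classical.epsilon (fun n : Plane => ‖n‖ = 1 ∧ ∀ a ∈ F, ∀ b ∈ F, ⟪a - b, n⟫ = 0)

open Classical in
/-- The jump `n_F · ∇v|_K - n_F · ∇v|_{K'}` at a point of the common face `F` of `K` and `K'`. -/
def gradJump (K K' : Finset Plane) (v : Plane → ℝ) (x : Plane) : ℝ :=
  fderivWithin ℝ v (hull K) x (faceNormal (K ∩ K')) -
    fderivWithin ℝ v (hull K') x (faceNormal (K ∩ K'))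

/-! ### The discrete forms -/

/-- The penalty parameters `γ_D`, `γ_N`, `γ_1`. -/
structure Penalty where
  /-- `γ_D` -/
  dir : ℝ
  /-- `γ_N` -/
  neu : ℝ
  /-- `γ_1` -/
  ghost : ℝ

section Forms

variable (G : MixedDomain) {U : Set Plane} (T : Triangulation U) (γ : Penalty)

/-- The normal derivative `n_Γ · ∇v` of a discrete function. -/
def normalDeriv (v : Plane → ℝ) (x : Plane) : ℝ := ⟪G.normal x, gradient v x⟫

/-- The Nitsche form `a_h(w, v)`. -/
def nitscheForm (w v : Plane → ℝ) : ℝ :=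
  (∫ x, ⟪gradient w x, gradient v x⟫ ∂G.vol) -
    l2Inner G.lenD (normalDeriv G w) v - l2Inner G.lenD (normalDeriv G v) w +
    γ.dir * T.meshSize⁻¹ * l2Inner G.lenD w v +
    γ.neu * T.meshSize * l2Inner G.lenN (normalDeriv G w) (normalDeriv G v)

open Classical in
/-- The ghost penalty `j(w, v)`, a sum over the faces in `𝓕_G`. Each face is counted twice in
`ghostPairs`, whence the factor `1/2`; the integrand does not depend on the order of the pair. -/
def ghostForm (w v : Plane → ℝ) : ℝ :=
  (1 / 2 : ℝ) * ∑ P ∈ T.ghostPairs G,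
    γ.ghost * T.meshSize *
      l2Inner (arcLength.restrict (hull (P.1 ∩ P.2))) (gradJump P.1 P.2 w) (gradJump P.1 P.2 v)

/-- `A_h = a_h + j`. -/
def discreteForm (w v : Plane → ℝ) : ℝ := nitscheForm G T γ w v + ghostForm G T γ w v

/-- The linear form `L_h`. -/
def discreteLoad (f gD gN v : Plane → ℝ) : ℝ :=
  l2Inner G.vol f v +
    l2Inner G.lenD gD (fun x => γ.dir * T.meshSize⁻¹ * v x - normalDeriv G v x) +
    l2Inner G.lenN gN (fun x => v x + γ.neu * T.meshSize * normalDeriv G v x)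

/-- The norm `|||y - v|||_*` of the difference of `y ∈ H²(D)` and a discrete function `v`, where
`|||w|||_*² = ‖∇w‖²_D + h ‖n_Γ · ∇w‖²_{Γ_N} + γ_D h⁻¹ ‖w‖²_{Γ_D}`. -/
def starError (y v : Plane → ℝ) : ℝ :=
  Real.sqrt
    ((∫ x, ‖weakGrad G.domain y x - gradient v x‖ ^ 2 ∂G.vol) +
      T.meshSize * l2Norm G.lenN
        (fun x => ⟪G.normal x, gradTrace G.domain y x - gradient v x⟫) ^ 2 +
      γ.dir * T.meshSize⁻¹ * l2Norm G.lenD (fun x => trace G.domain y x - v x) ^ 2)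

/-! ### The optimality systems -/

/-- `(y, p, u) ∈ H²(D) × H²(D) × L²(D)` solves the optimality system of the continuous control
problem with data `f, g_D, g_N`, target `y_d` and regularization parameter `α`. -/
structure IsOptimal (α : ℝ) (f gD gN yd y p u : Plane → ℝ) : Prop where
  state_mem : IsH2 G.domain y
  adjoint_mem : IsH2 G.domain p
  control_mem : MemLp u 2 G.vol
  state_dirichlet : trace G.domain y =ᵐ[G.lenD] gD
  adjoint_dirichlet : trace G.domain p =ᵐ[G.lenD] 0
  state_eq : ∀ v, IsH1 G.domain v → trace G.domain v =ᵐ[G.lenD] 0 →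
    ∫ x, ⟪weakGrad G.domain y x, weakGrad G.domain v x⟫ ∂G.vol =
      l2Inner G.vol (fun x => f x + u x) v + l2Inner G.lenN gN (trace G.domain v)
  adjoint_eq : ∀ v, IsH1 G.domain v → trace G.domain v =ᵐ[G.lenD] 0 →
    ∫ x, ⟪weakGrad G.domain v x, weakGrad G.domain p x⟫ ∂G.vol =
      l2Inner G.vol (fun x => y x - yd x) v
  control_eq : ∀ᵐ x ∂G.vol, α * u x + p x = 0

/-- `(y_h, p_h, u_h) ∈ V^h × V^h × L²(D)` solves the discrete optimality system. -/
structure IsDiscreteOptimal (α : ℝ) (f gD gN yd yh ph uh : Plane → ℝ) : Prop where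
  state_mem : T.IsDiscrete G yh
  adjoint_mem : T.IsDiscrete G ph
  control_mem : MemLp uh 2 G.vol
  state_eq : ∀ v, T.IsDiscrete G v →
    discreteForm G T γ yh v = l2Inner G.vol uh v + discreteLoad G T γ f gD gN v
  adjoint_eq : ∀ v, T.IsDiscrete G v →
    discreteForm G T γ v ph = l2Inner G.vol (fun x => yh x - yd x) v
  control_eq : ∀ᵐ x ∂G.vol, α * uh x + ph x = 0

/-- `y^h, p^h ∈ V^h` (here `ya, pa`) solve the uncoupled auxiliary discrete problems, whose right
hand sides contain the continuous optimal control `u` and state `y`. -/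
structure IsAuxiliary (f gD gN yd y u ya pa : Plane → ℝ) : Prop where
  state_mem : T.IsDiscrete G ya
  adjoint_mem : T.IsDiscrete G pa
  state_eq : ∀ v, T.IsDiscrete G v →
    discreteForm G T γ ya v = l2Inner G.vol u v + discreteLoad G T γ f gD gN v
  adjoint_eq : ∀ v, T.IsDiscrete G v →
    discreteForm G T γ v pa = l2Inner G.vol (fun x => y x - yd x) v

end Forms

end

end CutFEM

open CutFEM

/-! Subtracting the discrete optimality system from the auxiliary problems removes `L_h` and `y_d`:
`A_h(y^h - y_h, v) = (u - u_h, v)` and `A_h(v, p^h - p_h) = (y - y_h, v)`. Testing the first with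
`p^h - p_h` and the second with `y^h - y_h` gives `(u - u_h, p^h - p_h) = (y - y_h, y^h - y_h)`.
Since `α(u - u_h) = -(p - p^h) - (p^h - p_h)`, it follows that `α‖u - u_h‖² + ‖y - y_h‖² = -(p -
p^h, u - u_h) + (y - y_h, y - y^h)`, and Young's inequality finishes (`control_error_le`).
Coercivity plays no role here.

The other three estimates are the triangle inequality through `y^h` or `p^h`, combined with
stability: a discrete `v` with `A_h(v, v) = (r, v)` is bounded by `‖r‖` in `L²` and in the star
norm, uniformly in the mesh (`exists_stability`). Stability rests on two inequalities.

(1) `h ‖n·∇v‖²_Γ ≤ C (‖∇v‖² + j(v, v))` (`exists_boundary_le`), which absorbs the Nitsche cross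
terms once `γ_D` is large. Gradients are constant on triangles, and `Γ` has length `O(h)` in each;
but a cut triangle may have almost no area in `D`. Its gradient is therefore compared with that of
an uncut triangle by a walk around a common point, each step costing one gradient jump in the ghost
penalty. Quasi-uniformity bounds the number of steps.

(2) `‖v‖² ≤ C (‖∇v‖² + ‖v‖²_{Γ_D})` (`exists_friedrichs`). This is proved for every function whose
variation along almost every line is bounded by a line integral (`LineControl`), so that the
constant cannot depend on the mesh. Control starts at a piece of `Γ_D` of positive length, spreads
along segments through boundary charts and boxes, reaches all of `D` by connectedness, and becomes
uniform by compactness of the closure (`IsLipschitzDomain.isControlled`). -/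

namespace CutFEM

section

/-! ### Rigid coordinates in the plane -/

/-- The point with coordinates `p` in the rigid coordinate system `e`. -/
noncomputable def placed (e : Plane ≃ᵃⁱ[ℝ] Plane) (p : ℝ × ℝ) : Plane := e.symm !₂[p.1, p.2]

theorem apply_placed_zero (e : Plane ≃ᵃⁱ[ℝ] Plane) (p : ℝ × ℝ) : e (placed e p) 0 = p.1 := by
  simp [placed]

theorem apply_placed_one (e : Plane ≃ᵃⁱ[ℝ] Plane) (p : ℝ × ℝ) : e (placed e p) 1 = p.2 := by
  simp [placed]

theorem placed_apply (e : Plane ≃ᵃⁱ[ℝ] Plane) (x : Plane) : placed e (e x 0, e x 1) = x := by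
  have : (!₂[e x 0, e x 1] : Plane) = e x := by
    ext i; fin_cases i <;> rfl
  simp [placed, this]

theorem continuous_placed (e : Plane ≃ᵃⁱ[ℝ] Plane) : Continuous (placed e) := by
  unfold placed
  refine e.symm.continuous.comp ?_
  refine (PiLp.continuous_toLp 2 _).comp ?_
  refine continuous_pi fun i => ?_
  fin_cases i
  · exact continuous_fst
  · exact continuous_snd

theorem continuous_coord (e : Plane ≃ᵃⁱ[ℝ] Plane) (i : Fin 2) : Continuous fun x => e x i :=
  (continuous_apply i).comp ((PiLp.continuous_ofLp 2 _).comp e.continuous)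

/-- `placed e` as a homeomorphism. -/
noncomputable def placedHomeo (e : Plane ≃ᵃⁱ[ℝ] Plane) : ℝ × ℝ ≃ₜ Plane where
  toFun := placed e
  invFun x := (e x 0, e x 1)
  left_inv p := by simp [apply_placed_zero, apply_placed_one]
  right_inv x := placed_apply e x
  continuous_toFun := continuous_placed e
  continuous_invFun := (continuous_coord e 0).prodMk (continuous_coord e 1)

theorem measurableEmbedding_placed (e : Plane ≃ᵃⁱ[ℝ] Plane) : MeasurableEmbedding (placed e) :=
  (placedHomeo e).measurableEmbedding

theorem measurePreserving_affineIsometryEquiv (e : Plane ≃ᵃⁱ[ℝ] Plane) :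
    MeasurePreserving e (volume : Measure Plane) volume := by
  have h : (e : Plane → Plane) = (fun x => x + e 0) ∘ e.linearIsometryEquiv := by
    ext1 x
    have := e.map_vadd 0 x
    simpa using this
  rw [h]
  exact (measurePreserving_add_right volume (e 0)).comp e.linearIsometryEquiv.measurePreserving

theorem measurePreserving_placed (e : Plane ≃ᵃⁱ[ℝ] Plane) :
    MeasurePreserving (placed e) (volume : Measure (ℝ × ℝ)) volume := by
  have h1 := (volume_preserving_finTwoArrow ℝ).symm
  have h2 := (EuclideanSpace.volume_preserving_symm_measurableEquiv_toLp (Fin 2)).symm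
  have h3 := (measurePreserving_affineIsometryEquiv e.symm).comp (h2.comp h1)
  convert h3 using 1
  ext1 p
  simp [placed, MeasurableEquiv.finTwoArrow]

theorem setLIntegral_image_placed (e : Plane ≃ᵃⁱ[ℝ] Plane) (P : Set (ℝ × ℝ)) (f : Plane → ℝ≥0∞) :
    ∫⁻ x in placed e '' P, f x = ∫⁻ p in P, f (placed e p) :=
  ((measurePreserving_placed e).setLIntegral_comp_emb (measurableEmbedding_placed e) f P).symm

/-- Exchange of the two coordinates. -/
noncomputable def swapChart (e : Plane ≃ᵃⁱ[ℝ] Plane) : Plane ≃ᵃⁱ[ℝ] Plane :=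
  e.trans (LinearIsometryEquiv.piLpCongrLeft 2 ℝ ℝ (Equiv.swap (0 : Fin 2) 1)).toAffineIsometryEquiv

theorem placed_swapChart (e : Plane ≃ᵃⁱ[ℝ] Plane) (s t : ℝ) :
    placed (swapChart e) (s, t) = placed e (t, s) := by
  have h : swapChart e (placed e (t, s)) = !₂[s, t] := by
    simp [swapChart, placed]
    ext i; fin_cases i <;> simp [LinearIsometryEquiv.piLpCongrLeft_apply, Equiv.piCongrLeft']
  rw [placed, ← h]; simp

theorem image_placed_swapChart (e : Plane ≃ᵃⁱ[ℝ] Plane) (A B : Set ℝ) :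
    placed (swapChart e) '' (A ×ˢ B) = placed e '' (B ×ˢ A) := by
  ext x
  constructor
  · rintro ⟨⟨s, t⟩, ⟨hs, ht⟩, rfl⟩
    exact ⟨(t, s), ⟨ht, hs⟩, (placed_swapChart e s t).symm⟩
  · rintro ⟨⟨s, t⟩, ⟨hs, ht⟩, rfl⟩
    exact ⟨(t, s), ⟨ht, hs⟩, placed_swapChart e t s⟩

/-! ### Functions controlled along lines -/

/-- The variation of `v` along almost every segment inside `D`, in any rigid coordinate system, is
at most the integral of `q` over the segment. -/
structure LineControl (D : Set Plane) (v : Plane → ℝ) (q : Plane → ℝ≥0∞) : Prop where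
  measurable_fun : Measurable v
  measurable_bound : Measurable q
  le_lintegral : ∀ e : Plane ≃ᵃⁱ[ℝ] Plane, ∀ᵐ s : ℝ, ∀ t t' : ℝ, t < t' →
    (∀ τ ∈ Ioo t t', placed e (s, τ) ∈ D) →
      ‖v (placed e (s, t)) - v (placed e (s, t'))‖ₑ ≤ ∫⁻ τ in Ioo t t', q (placed e (s, τ))

/-- Cauchy–Schwarz against the constant one. -/
theorem sq_lintegral_le {α : Type*} [MeasurableSpace α] (μ : Measure α) {f : α → ℝ≥0∞}
    (hf : AEMeasurable f μ) : (∫⁻ x, f x ∂μ) ^ 2 ≤ μ univ * ∫⁻ x, f x ^ 2 ∂μ := by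
  have h := ENNReal.lintegral_mul_le_Lp_mul_Lq μ Real.HolderConjugate.two_two
    hf (aemeasurable_const (b := (1 : ℝ≥0∞)))
  simp only [Pi.mul_apply, mul_one, ENNReal.one_rpow, lintegral_const, one_mul] at h
  calc (∫⁻ x, f x ∂μ) ^ 2
      ≤ ((∫⁻ x, f x ^ (2 : ℝ) ∂μ) ^ (1 / 2 : ℝ) * μ univ ^ (1 / 2 : ℝ)) ^ 2 := by gcongr
    _ = μ univ * ∫⁻ x, f x ^ 2 ∂μ := by
        rw [mul_pow, ← ENNReal.rpow_natCast, ← ENNReal.rpow_natCast, ← ENNReal.rpow_mul,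
          ← ENNReal.rpow_mul]
        norm_num [mul_comm]

theorem enorm_sq_le_two_mul (a b : ℝ) : ‖a‖ₑ ^ 2 ≤ 2 * ‖a - b‖ₑ ^ 2 + 2 * ‖b‖ₑ ^ 2 := by
  have h : ‖a‖ ^ 2 ≤ 2 * ‖a - b‖ ^ 2 + 2 * ‖b‖ ^ 2 := by
    simp only [Real.norm_eq_abs, sq_abs]
    -- The right side minus the left side is exactly `(a - 2b)²`.
    nlinarith [sq_nonneg (a - 2 * b)]
  have h2 := ENNReal.ofReal_le_ofReal h
  rw [ENNReal.ofReal_add (by positivity) (by positivity), ENNReal.ofReal_mul (by norm_num),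
    ENNReal.ofReal_mul (by norm_num), ENNReal.ofReal_pow (norm_nonneg _),
    ENNReal.ofReal_pow (norm_nonneg _), ENNReal.ofReal_pow (norm_nonneg _)] at h2
  simpa only [ofReal_norm, ENNReal.ofReal_ofNat] using h2

variable {D : Set Plane} {v : Plane → ℝ} {q : Plane → ℝ≥0∞}

/-- Cauchy–Schwarz on the segment, after which the integral is enlarged to the part of the whole
line in `D`: the energy term then depends on the line only, not on the end points, and can be
integrated over all lines. -/
theorem LineControl.enorm_sq_le (h : LineControl D v q) (e : Plane ≃ᵃⁱ[ℝ] Plane) (lo hi : ℝ) :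
    ∀ᵐ s : ℝ, ∀ t t' : ℝ, t ∈ Icc lo hi → t' ∈ Icc lo hi →
      (∀ τ ∈ Ioo (min t t') (max t t'), placed e (s, τ) ∈ D) →
      ‖v (placed e (s, t))‖ₑ ^ 2 ≤ 2 * (ENNReal.ofReal (hi - lo) *
        ∫⁻ τ, (D.indicator (fun x => q x ^ 2)) (placed e (s, τ))) +
          2 * ‖v (placed e (s, t'))‖ₑ ^ 2 := by
  filter_upwards [h.le_lintegral e] with s hs t t' ht ht' hseg
  refine (enorm_sq_le_two_mul _ (v (placed e (s, t')))).trans ?_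
  gcongr
  have hmeas : Measurable fun τ => q (placed e (s, τ)) :=
    h.measurable_bound.comp ((continuous_placed e).measurable.comp measurable_prodMk_left)
  have key : ∀ a b, a < b → a ∈ Icc lo hi → b ∈ Icc lo hi →
      (∀ τ ∈ Ioo a b, placed e (s, τ) ∈ D) →
      ‖v (placed e (s, a)) - v (placed e (s, b))‖ₑ ^ 2 ≤ ENNReal.ofReal (hi - lo) *
        ∫⁻ τ, (D.indicator (fun x => q x ^ 2)) (placed e (s, τ)) := by
    intro a b hab ha hb hD'
    calc ‖v (placed e (s, a)) - v (placed e (s, b))‖ₑ ^ 2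
        ≤ (∫⁻ τ in Ioo a b, q (placed e (s, τ))) ^ 2 := by gcongr; exact hs a b hab hD'
      _ ≤ (volume.restrict (Ioo a b)) univ * ∫⁻ τ in Ioo a b, q (placed e (s, τ)) ^ 2 :=
          sq_lintegral_le _ hmeas.aemeasurable
      _ ≤ _ := by
          refine mul_le_mul' ?_ ?_
          · rw [Measure.restrict_apply_univ, Real.volume_Ioo]
            exact ENNReal.ofReal_le_ofReal (by linarith [ha.1, hb.2])
          · rw [← lintegral_indicator measurableSet_Ioo]
            refine lintegral_mono fun τ => ?_
            by_cases hτ : τ ∈ Ioo a b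
            · rw [indicator_of_mem hτ, indicator_of_mem (hD' τ hτ)]
            · rw [indicator_of_notMem hτ]; exact zero_le
  rcases lt_trichotomy t t' with hlt | heq | hgt
  · exact key t t' hlt ht ht' (by simpa [hlt.le] using hseg)
  · subst heq; simp
  · rw [enorm_sub_rev]
    exact key t' t hgt ht' ht (by simpa [hgt.le] using hseg)

/-- If `v` is controlled on a measurable family of reference points, one family on each line in
the second coordinate direction, then it is controlled on every set that can be reached
from the reference points along these lines without leaving `D`. -/
theorem LineControl.sweep (h : LineControl D v q) (hD : MeasurableSet D)
    (e : Plane ≃ᵃⁱ[ℝ] Plane) (lo hi : ℝ) {A : Set ℝ} (hA : MeasurableSet A)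
    (ν : Measure ℝ) [IsFiniteMeasure ν] {θ : ℝ → ℝ → ℝ} (hθ : Measurable (Function.uncurry θ))
    {P : Set (ℝ × ℝ)} (hP : MeasurableSet P) (hPA : ∀ p ∈ P, p.1 ∈ A ∧ p.2 ∈ Icc lo hi)
    (hseg : ∀ p ∈ P, ∀ᵐ y ∂ν, θ p.1 y ∈ Icc lo hi ∧
      ∀ τ ∈ Ioo (min p.2 (θ p.1 y)) (max p.2 (θ p.1 y)), placed e (p.1, τ) ∈ D) :
    ν univ * ∫⁻ x in placed e '' P, ‖v x‖ₑ ^ 2 ≤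
      2 * ENNReal.ofReal (hi - lo) ^ 2 * ν univ * (∫⁻ x in D, q x ^ 2) +
      2 * ENNReal.ofReal (hi - lo) *
        ∫⁻ s in A, ∫⁻ y, ‖v (placed e (s, θ s y))‖ₑ ^ 2 ∂ν := by
  set ℓ := ENNReal.ofReal (hi - lo) with hℓ
  set f : ℝ × ℝ → ℝ≥0∞ := fun p => (D.indicator (fun x => q x ^ 2)) (placed e p) with hf
  have hfm : Measurable f :=
    ((h.measurable_bound.pow_const 2).indicator hD).comp (continuous_placed e).measurable
  set Q : ℝ → ℝ≥0∞ := fun s => ∫⁻ τ, f (s, τ) with hQ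
  have hQm : Measurable Q := hfm.lintegral_prod_right'
  set R : ℝ → ℝ≥0∞ := fun s => ∫⁻ y, ‖v (placed e (s, θ s y))‖ₑ ^ 2 ∂ν with hR
  have hvm : Measurable fun p : ℝ × ℝ => ‖v (placed e p)‖ₑ ^ 2 :=
    ((h.measurable_fun.comp (continuous_placed e).measurable).enorm).pow_const 2
  have hRm : Measurable R := by
    have : Measurable fun p : ℝ × ℝ => ‖v (placed e (p.1, θ p.1 p.2))‖ₑ ^ 2 :=
      hvm.comp (measurable_fst.prodMk hθ)
    exact this.lintegral_prod_right'
  -- Fubini in rigid coordinates: the line energies add up to the energy in `D`.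
  have hQint : ∫⁻ s, Q s = ∫⁻ x in D, q x ^ 2 := by
    rw [hQ, ← lintegral_prod _ hfm.aemeasurable, ← Measure.volume_eq_prod, ← lintegral_indicator hD]
    exact (measurePreserving_placed e).lintegral_comp_emb (measurableEmbedding_placed e)
      (D.indicator fun x => q x ^ 2)
  -- The bound with a single reference point is averaged over `ν`.
  have hpt : ∀ᵐ s : ℝ, ∀ t, (s, t) ∈ P →
      ν univ * ‖v (placed e (s, t))‖ₑ ^ 2 ≤ 2 * ℓ * ν univ * Q s + 2 * R s := by
    filter_upwards [h.enorm_sq_le e lo hi] with s hs t hst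
    have h1 : ∀ᵐ y ∂ν, ‖v (placed e (s, t))‖ₑ ^ 2 ≤
        2 * (ℓ * Q s) + 2 * ‖v (placed e (s, θ s y))‖ₑ ^ 2 := by
      filter_upwards [hseg _ hst] with y hy
      exact hs t _ (hPA _ hst).2 hy.1 hy.2
    have h2 := lintegral_mono_ae h1
    rw [lintegral_const, lintegral_add_left measurable_const, lintegral_const,
      lintegral_const_mul' _ _ (by norm_num)] at h2
    calc ν univ * ‖v (placed e (s, t))‖ₑ ^ 2 = ‖v (placed e (s, t))‖ₑ ^ 2 * ν univ := mul_comm _ _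
      _ ≤ _ := h2
      _ = _ := by ring
  rw [setLIntegral_image_placed, ← lintegral_const_mul _ hvm, ← lintegral_indicator hP,
    Measure.volume_eq_prod]
  -- Only this half of Tonelli is needed.
  refine (lintegral_prod_le _).trans ?_
  -- Integration in `t` over `[lo, hi]` supplies another factor `ℓ`.
  have hslice : ∀ᵐ s : ℝ, ∫⁻ t, P.indicator
      (fun p => ν univ * ‖v (placed e p)‖ₑ ^ 2) (s, t) ≤
        2 * ℓ ^ 2 * ν univ * Q s + A.indicator (fun s => 2 * ℓ * R s) s := by
    filter_upwards [hpt] with s hs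
    by_cases hsA : s ∈ A
    · calc ∫⁻ t, P.indicator (fun p => ν univ * ‖v (placed e p)‖ₑ ^ 2) (s, t)
          ≤ ∫⁻ t, (Icc lo hi).indicator (fun _ => 2 * ℓ * ν univ * Q s + 2 * R s) t := by
            refine lintegral_mono fun t => ?_
            by_cases hst : (s, t) ∈ P
            · rw [indicator_of_mem hst, indicator_of_mem (hPA _ hst).2]
              exact hs t hst
            · rw [indicator_of_notMem hst]; exact zero_le
        _ = (2 * ℓ * ν univ * Q s + 2 * R s) * ℓ := by
            rw [lintegral_indicator measurableSet_Icc, lintegral_const,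
              Measure.restrict_apply_univ, Real.volume_Icc]
        _ = _ := by rw [indicator_of_mem hsA]; ring
        _ ≤ _ := le_rfl
    · have : ∀ t, P.indicator (fun p => ν univ * ‖v (placed e p)‖ₑ ^ 2) (s, t) = 0 := fun t =>
        indicator_of_notMem (fun hst => hsA (hPA _ hst).1) _
      simp [this]
  refine (lintegral_mono_ae hslice).trans ?_
  rw [lintegral_add_left (hQm.const_mul _), lintegral_const_mul _ hQm, lintegral_indicator hA,
    lintegral_const_mul _ hRm, hQint]

/-- On `S` the `L²` norm of each function with controlled variation is bounded by its energy in `D`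
and its `L²` norm on the curve `Γ`. -/
def IsControlled (D Γ S : Set Plane) : Prop :=
  ∃ C : ℝ≥0, ∀ v q, LineControl D v q →
    ∫⁻ x in S, ‖v x‖ₑ ^ 2 ≤
      C * ((∫⁻ x in D, q x ^ 2) + ∫⁻ x in Γ, ‖v x‖ₑ ^ 2 ∂arcLength)

variable {Γ S S' : Set Plane}

theorem IsControlled.mono (h : IsControlled D Γ S) (hS : S' ⊆ S) : IsControlled D Γ S' := by
  obtain ⟨C, hC⟩ := h
  exact ⟨C, fun v q hvq => (lintegral_mono_set hS).trans (hC v q hvq)⟩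

theorem IsControlled.union (h : IsControlled D Γ S) (h' : IsControlled D Γ S') :
    IsControlled D Γ (S ∪ S') := by
  obtain ⟨C, hC⟩ := h
  obtain ⟨C', hC'⟩ := h'
  refine ⟨C + C', fun v q hvq => (lintegral_union_le _ _ _).trans ?_⟩
  rw [ENNReal.coe_add, add_mul]
  exact add_le_add (hC v q hvq) (hC' v q hvq)

theorem isControlled_empty : IsControlled D Γ ∅ := ⟨0, by simp⟩

/-- Division of `LineControl.sweep` by the mass of `ν`. Two choices of `ν` occur: Lebesgue measure
on a set of heights, with `θ s y = y`, when the reference set has positive area; and a Dirac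
measure, with `θ s y = g s`, when it is a curve with one point on each line. -/
theorem isControlled_of_sweep (hD : MeasurableSet D) (e : Plane ≃ᵃⁱ[ℝ] Plane) (lo hi : ℝ)
    {A : Set ℝ} (hA : MeasurableSet A)
    (ν : Measure ℝ) [IsFiniteMeasure ν] (hν : ν ≠ 0) {θ : ℝ → ℝ → ℝ}
    (hθ : Measurable (Function.uncurry θ)) {P : Set (ℝ × ℝ)} (hP : MeasurableSet P)
    (hPA : ∀ p ∈ P, p.1 ∈ A ∧ p.2 ∈ Icc lo hi)
    (hseg : ∀ p ∈ P, ∀ᵐ y ∂ν, θ p.1 y ∈ Icc lo hi ∧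
      ∀ τ ∈ Ioo (min p.2 (θ p.1 y)) (max p.2 (θ p.1 y)), placed e (p.1, τ) ∈ D)
    (hctl : ∃ C : ℝ≥0, ∀ v q, LineControl D v q →
      ∫⁻ s in A, ∫⁻ y, ‖v (placed e (s, θ s y))‖ₑ ^ 2 ∂ν ≤
        C * ((∫⁻ x in D, q x ^ 2) + ∫⁻ x in Γ, ‖v x‖ₑ ^ 2 ∂arcLength)) :
    IsControlled D Γ (placed e '' P) := by
  obtain ⟨C, hC⟩ := hctl
  set m : ℝ≥0 := (ν univ).toNNReal with hm
  have hmν : (m : ℝ≥0∞) = ν univ := ENNReal.coe_toNNReal (measure_ne_top ν _)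
  have hm0 : m ≠ 0 := by
    intro h0
    rw [h0] at hmν
    exact hν (Measure.measure_univ_eq_zero.1 (by simpa using hmν.symm))
  set ℓ : ℝ≥0 := (hi - lo).toNNReal with hℓ
  refine ⟨m⁻¹ * (2 * ℓ ^ 2 * m + 2 * ℓ * C), fun v q hvq => ?_⟩
  have h1 := hvq.sweep hD e lo hi hA ν hθ hP hPA hseg
  have h2 := hC v q hvq
  set E := (∫⁻ x in D, q x ^ 2) + ∫⁻ x in Γ, ‖v x‖ₑ ^ 2 ∂arcLength
  have h3 : (m : ℝ≥0∞) * ∫⁻ x in placed e '' P, ‖v x‖ₑ ^ 2 ≤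
      ((2 * ℓ ^ 2 * m + 2 * ℓ * C : ℝ≥0) : ℝ≥0∞) * E := by
    rw [hmν]
    refine h1.trans ?_
    push_cast
    rw [hmν, add_mul, mul_assoc (2 * (ℓ : ℝ≥0∞)) _ E]
    gcongr
    · rfl
    · exact self_le_add_right _ _
    · rfl
  calc ∫⁻ x in placed e '' P, ‖v x‖ₑ ^ 2
      = (m⁻¹ : ℝ≥0) * ((m : ℝ≥0∞) * ∫⁻ x in placed e '' P, ‖v x‖ₑ ^ 2) := by
        rw [← mul_assoc, ← ENNReal.coe_mul, inv_mul_cancel₀ hm0]; simp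
    _ ≤ (m⁻¹ : ℝ≥0) * (((2 * ℓ ^ 2 * m + 2 * ℓ * C : ℝ≥0) : ℝ≥0∞) * E) := by gcongr
    _ = _ := by rw [← mul_assoc, ← ENNReal.coe_mul]

end

/-! ### Spreading control inside product sets and patches -/

section

variable {D Γ W : Set Plane}

/-- The sweep with Lebesgue measure on `B`: by Fubini, the average over the reference points is the
integral over `A × B`. -/
theorem IsControlled.of_prod (hD : MeasurableSet D) (e : Plane ≃ᵃⁱ[ℝ] Plane) (lo hi : ℝ)
    {A B : Set ℝ} (hA : MeasurableSet A) (hB : MeasurableSet B) (hB0 : volume B ≠ 0)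
    (hBI : B ⊆ Icc lo hi) {P : Set (ℝ × ℝ)} (hP : MeasurableSet P)
    (hPA : ∀ p ∈ P, p.1 ∈ A ∧ p.2 ∈ Icc lo hi)
    (hseg : ∀ p ∈ P, ∀ y ∈ B, ∀ τ ∈ Ioo (min p.2 y) (max p.2 y), placed e (p.1, τ) ∈ D)
    (h : IsControlled D Γ (placed e '' (A ×ˢ B))) : IsControlled D Γ (placed e '' P) := by
  have hfin : volume B ≠ ∞ :=
    ne_top_of_le_ne_top (by rw [Real.volume_Icc]; exact ENNReal.ofReal_ne_top) (measure_mono hBI)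
  have : IsFiniteMeasure (volume.restrict B) :=
    ⟨by rw [Measure.restrict_apply_univ]; exact hfin.lt_top⟩
  refine isControlled_of_sweep hD e lo hi hA (volume.restrict B) ?_ (θ := fun _ y => y)
    measurable_snd hP hPA ?_ ?_
  · rwa [Ne, Measure.restrict_eq_zero]
  · intro p hp
    filter_upwards [ae_restrict_mem hB] with y hy
    exact ⟨hBI hy, hseg p hp y hy⟩
  · obtain ⟨C, hC⟩ := h
    refine ⟨C, fun v q hvq => ?_⟩
    refine le_trans (le_of_eq ?_) (hC v q hvq)
    rw [setLIntegral_image_placed, Measure.volume_eq_prod, ← Measure.prod_restrict]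
    exact (lintegral_prod (μ := volume.restrict A) (ν := volume.restrict B)
      (fun p => ‖v (placed e p)‖ₑ ^ 2)
      (((hvq.measurable_fun.comp (continuous_placed e).measurable).enorm).pow_const 2).aemeasurable
      ).symm

/-- The part of a strip below height `c` and above a graph, in rigid coordinates. -/
def patchRegion (a₁ a₂ c : ℝ) (g : ℝ → ℝ) : Set (ℝ × ℝ) :=
  {p | p.1 ∈ Ioo a₁ a₂ ∧ g p.1 < p.2 ∧ p.2 < c}

/-- In the coordinates `e` the domain `D` contains the part of the strip `a₁ < s < a₂` between
the graph of `g` and the height `c`, and the graph stays between `lo` and `b < c`. -/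
structure IsPatch (D : Set Plane) (e : Plane ≃ᵃⁱ[ℝ] Plane) (a₁ a₂ lo b c : ℝ) (g : ℝ → ℝ) :
    Prop where
  continuous_graph : Continuous g
  lt_width : a₁ < a₂
  lt_top : b < c
  graph_mem : ∀ s ∈ Ioo a₁ a₂, lo < g s ∧ g s < b
  subset : placed e '' patchRegion a₁ a₂ c g ⊆ D

variable {e : Plane ≃ᵃⁱ[ℝ] Plane} {a₁ a₂ lo b c : ℝ} {g : ℝ → ℝ}

theorem IsPatch.isOpen_region (h : IsPatch D e a₁ a₂ lo b c g) :
    IsOpen (patchRegion a₁ a₂ c g) := by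
  have hg := h.continuous_graph
  exact (isOpen_Ioo.preimage continuous_fst).inter
    ((isOpen_lt (hg.comp continuous_fst) continuous_snd).inter
      (isOpen_lt continuous_snd continuous_const))

theorem IsPatch.mem (h : IsPatch D e a₁ a₂ lo b c g) {s t : ℝ} (hs : s ∈ Ioo a₁ a₂) (ht : g s < t)
    (htc : t < c) : placed e (s, t) ∈ D :=
  h.subset ⟨(s, t), ⟨hs, ht, htc⟩, rfl⟩

/-- Two perpendicular sweeps. The slab `b < t < c` lies entirely above the graph, so control moves
sideways from `S × (b, c)` to the full width of the slab; from there it moves along vertical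
segments down to the graph. -/
theorem IsPatch.isControlled_of_top (h : IsPatch D e a₁ a₂ lo b c g) (hD : MeasurableSet D)
    {S : Set ℝ} (hS : MeasurableSet S) (hS0 : volume S ≠ 0) (hSA : S ⊆ Ioo a₁ a₂)
    (hc : IsControlled D Γ (placed e '' (S ×ˢ Ioo b c))) :
    IsControlled D Γ (placed e '' patchRegion a₁ a₂ c g) := by
  have hgb := h.graph_mem
  have hbc := h.lt_top
  have h1 : IsControlled D Γ (placed e '' (Ioo a₁ a₂ ×ˢ Ioo b c)) := by
    -- The sideways sweep is a vertical one with the coordinates exchanged.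
    rw [← image_placed_swapChart] at hc ⊢
    refine hc.of_prod hD (swapChart e) a₁ a₂ measurableSet_Ioo hS hS0
      (hSA.trans Ioo_subset_Icc_self) (measurableSet_Ioo.prod measurableSet_Ioo)
      (fun p hp => ⟨hp.1, Ioo_subset_Icc_self hp.2⟩) ?_
    intro p hp y hy τ hτ
    rw [placed_swapChart]
    have hτA : τ ∈ Ioo a₁ a₂ :=
      ⟨(lt_min hp.2.1 (hSA hy).1).trans hτ.1, hτ.2.trans (max_lt hp.2.2 (hSA hy).2)⟩
    exact h.mem hτA ((hgb τ hτA).2.trans hp.1.1) hp.1.2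
  refine h1.of_prod hD e lo c measurableSet_Ioo measurableSet_Ioo ?_ ?_
    h.isOpen_region.measurableSet ?_ ?_
  · simpa using hbc
  · intro y hy
    obtain ⟨s, hs⟩ := nonempty_Ioo.2 h.lt_width
    exact ⟨((hgb s hs).1.trans ((hgb s hs).2.trans hy.1)).le, hy.2.le⟩
  · exact fun p hp => ⟨hp.1, ((hgb _ hp.1).1.trans hp.2.1).le, hp.2.2.le⟩
  · intro p hp y hy τ hτ
    exact h.mem hp.1 ((lt_min hp.2.1 ((hgb _ hp.1).2.trans hy.1)).trans hτ.1)
      (hτ.2.trans (max_lt hp.2.2 hy.2))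

/-- Control spreads from a nonempty open subset of a patch to the whole patch. -/
theorem IsPatch.isControlled_of_isOpen (h : IsPatch D e a₁ a₂ lo b c g) (hD : MeasurableSet D)
    (hWo : IsOpen W) (hW : (W ∩ placed e '' patchRegion a₁ a₂ c g).Nonempty)
    (hc : IsControlled D Γ W) :
    IsControlled D Γ (placed e '' patchRegion a₁ a₂ c g) := by
  have hgb := h.graph_mem
  have hbc := h.lt_top
  obtain ⟨_, hxW, p, hp, rfl⟩ := hW
  have hopen : IsOpen (placed e ⁻¹' W ∩ patchRegion a₁ a₂ c g) :=
    (hWo.preimage (continuous_placed e)).inter h.isOpen_region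
  obtain ⟨ε, hε, hball⟩ := Metric.isOpen_iff.1 hopen p ⟨hxW, hp⟩
  have hbox : Ioo (p.1 - ε) (p.1 + ε) ×ˢ Ioo (p.2 - ε) (p.2 + ε) ⊆
      placed e ⁻¹' W ∩ patchRegion a₁ a₂ c g := by
    rw [← Real.ball_eq_Ioo, ← Real.ball_eq_Ioo, ball_prod_same]
    exact hball
  have hcB : IsControlled D Γ
      (placed e '' (Ioo (p.1 - ε) (p.1 + ε) ×ˢ Ioo (p.2 - ε) (p.2 + ε))) :=
    hc.mono (image_subset_iff.2 fun z hz => (hbox hz).1)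
  have hsub : Ioo (p.1 - ε) (p.1 + ε) ⊆ Ioo a₁ a₂ := fun s hs =>
    (hbox (mk_mem_prod hs (show p.2 ∈ _ by constructor <;> linarith))).2.1
  have hreg : ∀ s ∈ Ioo (p.1 - ε) (p.1 + ε), ∀ t ∈ Ioo (p.2 - ε) (p.2 + ε), g s < t ∧ t < c :=
    fun s hs t ht => (hbox (mk_mem_prod hs ht)).2.2
  refine h.isControlled_of_top hD measurableSet_Ioo (S := Ioo (p.1 - ε) (p.1 + ε)) ?_ hsub ?_
  · simp [hε]
  have hp1 : p.1 ∈ Ioo (p.1 - ε) (p.1 + ε) := by constructor <;> linarith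
  -- The small box may lie below the slab `b < t < c`; a vertical sweep first lifts control into the
  -- slab.
  refine hcB.of_prod hD e lo c measurableSet_Ioo measurableSet_Ioo ?_ ?_
    (measurableSet_Ioo.prod measurableSet_Ioo) ?_ ?_
  · simp [hε]
  · intro y hy
    have := hreg _ hp1 y hy
    exact ⟨((hgb _ (hsub hp1)).1.trans this.1).le, this.2.le⟩
  · exact fun z hz => ⟨hz.1, ((hgb _ (hsub hp1)).1.trans ((hgb _ (hsub hp1)).2.trans hz.2.1)).le,
      hz.2.2.le⟩
  · intro z hz y hy τ hτ
    have := hreg _ hz.1 y hy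
    exact h.mem (hsub hz.1)
      ((lt_min ((hgb _ (hsub hz.1)).2.trans hz.2.1) this.1).trans hτ.1)
      (hτ.2.trans (max_lt hz.2.2 this.2))

/-- The graph of `g` in rigid coordinates. -/
noncomputable def graphPt (e : Plane ≃ᵃⁱ[ℝ] Plane) (g : ℝ → ℝ) (s : ℝ) : Plane :=
  placed e (s, g s)

theorem lipschitzWith_graphPt {L : ℝ≥0} (e : Plane ≃ᵃⁱ[ℝ] Plane) (hg : LipschitzWith L g) :
    LipschitzWith (1 + L) (graphPt e g) := by
  refine LipschitzWith.of_dist_le_mul fun s s' => ?_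
  have h1 := hg.dist_le_mul s s'
  rw [graphPt, graphPt, placed, placed, e.symm.dist_map, EuclideanSpace.dist_eq]
  simp only [Fin.sum_univ_two, Matrix.cons_val_zero, Matrix.cons_val_one]
  push_cast
  refine Real.sqrt_le_iff.2 ⟨by positivity, ?_⟩
  have h2 : 0 ≤ dist s s' := dist_nonneg
  have h3 : 0 ≤ dist (g s) (g s') := dist_nonneg
  have h4 : 0 ≤ (L : ℝ) := L.2
  nlinarith [mul_nonneg h4 h2]

theorem lipschitzWith_coord (e : Plane ≃ᵃⁱ[ℝ] Plane) (i : Fin 2) :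
    LipschitzWith 1 fun x => e x i := by
  refine LipschitzWith.of_dist_le_mul fun x y => ?_
  rw [NNReal.coe_one, one_mul, ← e.dist_map x y, dist_eq_norm, dist_eq_norm, ← PiLp.sub_apply]
  exact PiLp.norm_apply_le _ _

/-- The `L²` norm in the coordinate over a part of a graph is at most that along the graph. -/
theorem setLIntegral_graphPt_le {S : Set ℝ} (hg : Continuous g)
    (hS : graphPt e g '' S ⊆ Γ) (f : Plane → ℝ≥0∞) (hf : Measurable f) :
    ∫⁻ s in S, f (graphPt e g s) ≤ ∫⁻ x in Γ, f x ∂arcLength := by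
  have hgm : Measurable (graphPt e g) :=
    ((continuous_placed e).comp (continuous_id.prodMk hg)).measurable
  rw [← lintegral_map hf hgm]
  -- It suffices to compare measures: the projection to the first coordinate is 1-Lipschitz, hence
  -- does not increase one-dimensional Hausdorff measure.
  refine lintegral_mono' ?_ le_rfl
  refine Measure.le_iff.2 fun B hB => ?_
  rw [Measure.map_apply hgm hB, Measure.restrict_apply (hgm hB), Measure.restrict_apply hB]
  have h1 : (graphPt e g ⁻¹' B ∩ S) ⊆ (fun x => e x 0) '' (B ∩ Γ) := by
    rintro s ⟨hsB, hsS⟩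
    exact ⟨graphPt e g s, ⟨hsB, hS ⟨s, hsS, rfl⟩⟩, apply_placed_zero e _⟩
  calc volume (graphPt e g ⁻¹' B ∩ S) ≤ volume ((fun x => e x 0) '' (B ∩ Γ)) := measure_mono h1
    _ = μH[1] ((fun x => e x 0) '' (B ∩ Γ)) := by rw [hausdorffMeasure_real]
    _ ≤ _ := by
      simpa using (lipschitzWith_coord e 0).hausdorffMeasure_image_le zero_le_one (B ∩ Γ)

/-- A patch is controlled if its lower boundary contains a part of `Γ` of positive length. -/
theorem IsPatch.isControlled_of_graph (h : IsPatch D e a₁ a₂ lo b c g) (hD : MeasurableSet D)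
    {S : Set ℝ} (hS : MeasurableSet S) (hS0 : volume S ≠ 0) (hSA : S ⊆ Ioo a₁ a₂)
    (hSΓ : graphPt e g '' S ⊆ Γ) :
    IsControlled D Γ (placed e '' patchRegion a₁ a₂ c g) := by
  have hgb := h.graph_mem
  refine h.isControlled_of_top hD hS hS0 hSA ?_
  -- One reference point on each line, namely the point on the graph.
  refine isControlled_of_sweep hD e lo c hS (Measure.dirac (0 : ℝ)) ?_ (θ := fun s _ => g s)
    (h.continuous_graph.measurable.comp measurable_fst) (hS.prod measurableSet_Ioo) ?_ ?_ ?_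
  · exact NeZero.ne _
  · exact fun p hp => ⟨hp.1, ((hgb _ (hSA hp.1)).1.trans ((hgb _ (hSA hp.1)).2.trans hp.2.1)).le,
      hp.2.2.le⟩
  · intro p hp
    have := hgb _ (hSA hp.1)
    refine Eventually.of_forall fun y => ⟨⟨this.1.le, (this.2.trans h.lt_top).le⟩, fun τ hτ => ?_⟩
    have hlt : g p.1 < p.2 := this.2.trans hp.2.1
    rw [min_eq_right hlt.le, max_eq_left hlt.le] at hτ
    exact h.mem (hSA hp.1) hτ.1 (hτ.2.trans hp.2.2)
  · refine ⟨1, fun v q hvq => ?_⟩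
    simp only [lintegral_const, measure_univ, mul_one, ENNReal.coe_one, one_mul]
    exact (setLIntegral_graphPt_le h.continuous_graph hSΓ (fun x => ‖v x‖ₑ ^ 2)
      (hvq.measurable_fun.enorm.pow_const 2)).trans le_add_self

end

/-! ### Covering a Lipschitz domain by patches; Poincaré–Friedrichs; length of the boundary -/

section

variable {D Γ W : Set Plane} {e : Plane ≃ᵃⁱ[ℝ] Plane} {a₁ a₂ lo b c : ℝ} {g : ℝ → ℝ}

theorem dist_placed_le (e : Plane ≃ᵃⁱ[ℝ] Plane) (p p' : ℝ × ℝ) :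
    dist (placed e p) (placed e p') ≤ |p.1 - p'.1| + |p.2 - p'.2| := by
  rw [placed, placed, e.symm.dist_map, EuclideanSpace.dist_eq]
  simp only [Fin.sum_univ_two, Matrix.cons_val_zero, Matrix.cons_val_one, Real.dist_eq]
  refine Real.sqrt_le_iff.2 ⟨by positivity, ?_⟩
  nlinarith [mul_nonneg (abs_nonneg (p.1 - p'.1)) (abs_nonneg (p.2 - p'.2))]

theorem IsPatch.isOpen_image (h : IsPatch D e a₁ a₂ lo b c g) :
    IsOpen (placed e '' patchRegion a₁ a₂ c g) :=
  (placedHomeo e).isOpenMap _ h.isOpen_region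

theorem IsPatch.nonempty_image (h : IsPatch D e a₁ a₂ lo b c g) :
    (placed e '' patchRegion a₁ a₂ c g).Nonempty := by
  obtain ⟨s, hs⟩ := nonempty_Ioo.2 h.lt_width
  obtain ⟨t, ht⟩ := nonempty_Ioo.2 h.lt_top
  exact ⟨_, (s, t), ⟨hs, (h.graph_mem s hs).2.trans ht.1, ht.2⟩, rfl⟩

/-- Points above the graph belong to the open set `D`, which contains none of its boundary points;
points below it have a neighbourhood that misses `D`. -/
theorem eq_graph_of_mem_frontier (hD : IsOpen D) {x y : Plane} {r : ℝ} (hg : Continuous g)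
    (h : ∀ y ∈ Metric.ball x r, (y ∈ D ↔ g (e y 0) < e y 1)) (hy : y ∈ Metric.ball x r)
    (hyf : y ∈ frontier D) : e y 1 = g (e y 0) := by
  have hyD : y ∉ D := fun hyD => by
    rw [hD.frontier_eq] at hyf; exact hyf.2 hyD
  refine le_antisymm (not_lt.1 fun hlt => hyD ((h y hy).2 hlt)) (not_lt.1 fun hlt => ?_)
  have ho : IsOpen (Metric.ball x r ∩ {z | e z 1 < g (e z 0)}) :=
    Metric.isOpen_ball.inter (isOpen_lt (continuous_coord e 1) (hg.comp (continuous_coord e 0)))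
  obtain ⟨z, hz, hzD⟩ := mem_closure_iff.1 hyf.1 _ ho ⟨hy, hlt⟩
  exact lt_asymm hz.2 ((h z hz.1).1 hzD)

/-- Near a boundary point a Lipschitz domain is a patch, bounded below by the boundary. -/
theorem IsLipschitzDomain.exists_isPatch_frontier (hD : IsLipschitzDomain D) {x : Plane}
    (hx : x ∈ frontier D) :
    ∃ (N : Set Plane) (e : Plane ≃ᵃⁱ[ℝ] Plane) (a₁ a₂ lo b c : ℝ) (g : ℝ → ℝ) (L : ℝ≥0),
      IsOpen N ∧ x ∈ N ∧ LipschitzWith L g ∧ IsPatch D e a₁ a₂ lo b c g ∧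
      N ∩ D ⊆ placed e '' patchRegion a₁ a₂ c g ∧
      N ∩ frontier D ⊆ graphPt e g '' Ioo a₁ a₂ := by
  obtain ⟨e, g, L, r, hg, hr, hball⟩ := hD.2.2.2 x hx
  have hgx : e x 1 = g (e x 0) :=
    eq_graph_of_mem_frontier hD.1 hg.continuous hball (Metric.mem_ball_self hr) hx
  set s₀ := e x 0 with hs₀
  set t₀ := e x 1 with ht₀
  have hL : (0 : ℝ) ≤ L := L.2
  -- With this half-width the graph varies by less than `r / 4`, and, as `a ≤ r / 4`, the box of
  -- half-height `r / 2` stays inside the ball.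
  set a : ℝ := r / (4 * (L + 1)) with ha
  have ha0 : 0 < a := by positivity
  have haL : (L + 1) * a = r / 4 := by rw [ha]; field_simp
  have ha4 : a ≤ r / 4 := by nlinarith
  have hgs : ∀ s ∈ Ioo (s₀ - a) (s₀ + a), |g s - t₀| < r / 4 := by
    intro s hs
    have h1 : |g s - g s₀| ≤ L * |s - s₀| := by
      simpa [Real.dist_eq] using hg.dist_le_mul s s₀
    have h2 : |s - s₀| < a := abs_lt.2 ⟨by linarith [hs.1], by linarith [hs.2]⟩
    rw [hgx]
    nlinarith
  have hmem : ∀ s ∈ Ioo (s₀ - a) (s₀ + a), ∀ t, |t - t₀| < r / 2 →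
      placed e (s, t) ∈ Metric.ball x r := by
    intro s hs t ht
    have h1 := dist_placed_le e (s, t) (s₀, t₀)
    rw [hs₀, ht₀, placed_apply] at h1
    have h2 : |s - s₀| < a := abs_lt.2 ⟨by linarith [hs.1], by linarith [hs.2]⟩
    rw [Metric.mem_ball]
    exact h1.trans_lt (by simp only; linarith)
  have hN : ∀ y, e y 0 ∈ Ioo (s₀ - a) (s₀ + a) → |e y 1 - t₀| < r / 2 → y ∈ Metric.ball x r := by
    intro y h1 h2
    have := hmem _ h1 _ h2
    rwa [placed_apply] at this
  refine ⟨{y | e y 0 ∈ Ioo (s₀ - a) (s₀ + a) ∧ |e y 1 - t₀| < r / 2}, e, s₀ - a, s₀ + a, t₀ - r / 2,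
    t₀ + r / 4, t₀ + r / 2, g, L, ?_, ?_, hg, ⟨hg.continuous, by linarith, by linarith, ?_, ?_⟩,
    ?_, ?_⟩
  · exact (isOpen_Ioo.preimage (continuous_coord e 0)).inter
      (isOpen_lt ((continuous_coord e 1).sub continuous_const).abs continuous_const)
  · exact ⟨⟨by linarith, by linarith⟩, by rw [← ht₀, sub_self, abs_zero]; linarith⟩
  · intro s hs
    have := abs_lt.1 (hgs s hs)
    constructor <;> linarith [this.1, this.2]
  · rintro _ ⟨p, hp, rfl⟩
    have h1 := abs_lt.1 (hgs _ hp.1)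
    have h2 : |p.2 - t₀| < r / 2 := abs_lt.2 ⟨by linarith [hp.2.1], by linarith [hp.2.2]⟩
    rw [hball _ (hmem _ hp.1 _ h2), apply_placed_zero, apply_placed_one]
    exact hp.2.1
  · rintro y ⟨⟨h1, h2⟩, hyD⟩
    refine ⟨(e y 0, e y 1), ⟨h1, (hball y (hN y h1 h2)).1 hyD, ?_⟩, placed_apply e y⟩
    simp only
    linarith [(abs_lt.1 h2).2]
  · rintro y ⟨⟨h1, h2⟩, hyf⟩
    refine ⟨e y 0, h1, ?_⟩
    rw [graphPt, ← eq_graph_of_mem_frontier hD.1 hg.continuous hball (hN y h1 h2) hyf,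
      placed_apply]

/-- A box is a patch over a constant graph, so interior points need no separate spreading argument.
-/
theorem IsOpen.exists_isPatch (hD : IsOpen D) {x : Plane} (hx : x ∈ D) :
    ∃ (N : Set Plane) (e : Plane ≃ᵃⁱ[ℝ] Plane) (a₁ a₂ lo b c : ℝ) (g : ℝ → ℝ),
      IsOpen N ∧ x ∈ N ∧ IsPatch D e a₁ a₂ lo b c g ∧
      N ∩ D ⊆ placed e '' patchRegion a₁ a₂ c g := by
  obtain ⟨r, hr, hball⟩ := Metric.isOpen_iff.1 hD x hx
  set e : Plane ≃ᵃⁱ[ℝ] Plane := AffineIsometryEquiv.refl ℝ Plane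
  set s₀ := e x 0 with hs₀
  set t₀ := e x 1 with ht₀
  have hsub : placed e '' patchRegion (s₀ - r / 2) (s₀ + r / 2) (t₀ + r / 2)
      (fun _ => t₀ - r / 2) ⊆ D := by
    rintro _ ⟨p, hp, rfl⟩
    refine hball ?_
    have h1 := dist_placed_le e p (s₀, t₀)
    rw [hs₀, ht₀, placed_apply] at h1
    have h2 : |p.1 - s₀| < r / 2 := abs_lt.2 ⟨by linarith [hp.1.1], by linarith [hp.1.2]⟩
    have h3 : |p.2 - t₀| < r / 2 := abs_lt.2 ⟨by linarith [hp.2.1], by linarith [hp.2.2]⟩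
    rw [Metric.mem_ball]
    exact h1.trans_lt (by simp only; linarith)
  have hpatch : IsPatch D e (s₀ - r / 2) (s₀ + r / 2) (t₀ - r) t₀ (t₀ + r / 2)
      (fun _ => t₀ - r / 2) :=
    ⟨continuous_const, by linarith, by linarith,
      fun s _ => ⟨by linarith, by linarith⟩, hsub⟩
  refine ⟨_, e, _, _, _, _, _, _, hpatch.isOpen_image, ?_, hpatch, inter_subset_left⟩
  exact ⟨(s₀, t₀), ⟨⟨by simp only; linarith, by simp only; linarith⟩, by simp only; linarith,
    by simp only; linarith⟩, placed_apply e x⟩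

theorem IsLipschitzDomain.exists_isPatch (hD : IsLipschitzDomain D) {x : Plane}
    (hx : x ∈ closure D) :
    ∃ (N : Set Plane) (e : Plane ≃ᵃⁱ[ℝ] Plane) (a₁ a₂ lo b c : ℝ) (g : ℝ → ℝ),
      IsOpen N ∧ x ∈ N ∧ IsPatch D e a₁ a₂ lo b c g ∧
      N ∩ D ⊆ placed e '' patchRegion a₁ a₂ c g := by
  by_cases hxD : x ∈ D
  · exact IsOpen.exists_isPatch hD.1 hxD
  · have hxf : x ∈ frontier D := by rw [hD.1.frontier_eq]; exact ⟨hx, hxD⟩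
    obtain ⟨N, e, a₁, a₂, lo, b, c, g, L, h1, h2, -, h3, h4, -⟩ := hD.exists_isPatch_frontier hxf
    exact ⟨N, e, a₁, a₂, lo, b, c, g, h1, h2, h3, h4⟩

/-- The seed of the spreading argument: some point of `Γ` has only neighbourhoods of positive length
in `Γ`, and the patch at that point is bounded below by such a piece. -/
theorem IsLipschitzDomain.exists_isControlled (hD : IsLipschitzDomain D) (hΓ : MeasurableSet Γ)
    (hΓD : Γ ⊆ frontier D) (hΓ0 : arcLength Γ ≠ 0) :
    ∃ W ⊆ D, IsOpen W ∧ W.Nonempty ∧ IsControlled D Γ W := by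
  obtain ⟨x, hx, hpos⟩ := exists_mem_forall_mem_nhdsWithin_pos_measure hΓ0
  obtain ⟨N, e, a₁, a₂, lo, b, c, g, L, hNo, hxN, hg, hP, -, hNf⟩ :=
    hD.exists_isPatch_frontier (hΓD hx)
  have hNΓ : 0 < arcLength (N ∩ Γ) := by
    refine hpos _ ?_
    rw [inter_comm]
    exact inter_mem_nhdsWithin _ (hNo.mem_nhds hxN)
  set S : Set ℝ := Ioo a₁ a₂ ∩ graphPt e g ⁻¹' Γ with hS
  have hSm : MeasurableSet S :=
    measurableSet_Ioo.inter ((lipschitzWith_graphPt e hg).continuous.measurable hΓ)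
  have hcover : N ∩ Γ ⊆ graphPt e g '' S := by
    rintro y ⟨hyN, hyΓ⟩
    obtain ⟨s, hs, rfl⟩ := hNf ⟨hyN, hΓD hyΓ⟩
    exact ⟨s, ⟨hs, hyΓ⟩, rfl⟩
  -- A Lipschitz map sends null sets to sets of zero length.
  have hS0 : volume S ≠ 0 := by
    intro h0
    have h1 := (lipschitzWith_graphPt e hg).hausdorffMeasure_image_le zero_le_one S
    rw [hausdorffMeasure_real, h0, mul_zero] at h1
    exact (hNΓ.trans_le ((measure_mono hcover).trans h1)).ne' rfl
  exact ⟨_, hP.subset, hP.isOpen_image, hP.nonempty_image,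
    hP.isControlled_of_graph hD.1.measurableSet hSm hS0 inter_subset_left
      (image_subset_iff.2 inter_subset_right)⟩

/-- Poincaré–Friedrichs inequality on a Lipschitz domain. -/
theorem IsLipschitzDomain.isControlled (hD : IsLipschitzDomain D) (hΓ : MeasurableSet Γ)
    (hΓD : Γ ⊆ frontier D) (hΓ0 : arcLength Γ ≠ 0) : IsControlled D Γ D := by
  have hDm := hD.1.measurableSet
  -- This union need not be controlled itself, since the constants of its members may be unbounded;
  -- compactness repairs that at the end.
  set U : Set Plane := ⋃₀ {W | W ⊆ D ∧ IsOpen W ∧ IsControlled D Γ W} with hU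
  have hUo : IsOpen U := isOpen_sUnion fun W hW => hW.2.1
  have hUD : U ⊆ D := sUnion_subset fun W hW => hW.1
  have hstep : ∀ x ∈ closure D, x ∈ closure U → ∃ N, IsOpen N ∧ x ∈ N ∧
      ∃ P ⊆ D, IsOpen P ∧ IsControlled D Γ P ∧ N ∩ D ⊆ P := by
    intro x hx hxU
    obtain ⟨N, e, a₁, a₂, lo, b, c, g, hNo, hxN, hP, hND⟩ := hD.exists_isPatch hx
    refine ⟨N, hNo, hxN, _, hP.subset, hP.isOpen_image, ?_, hND⟩
    obtain ⟨y, hyN, W, hW, hyW⟩ := mem_closure_iff.1 hxU N hNo hxN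
    exact hP.isControlled_of_isOpen hDm hW.2.1 ⟨y, hyW, hND ⟨hyN, hW.1 hyW⟩⟩ hW.2.2
  -- `U` is open, nonempty and relatively closed in the connected set `D`.
  have hDU : D ⊆ U := by
    refine hD.2.1.isPreconnected.subset_of_closure_inter_subset hUo ?_ ?_
    · obtain ⟨W, hWD, hWo, ⟨x, hx⟩, hWc⟩ := hD.exists_isControlled hΓ hΓD hΓ0
      exact ⟨x, hWD hx, W, ⟨hWD, hWo, hWc⟩, hx⟩
    · rintro x ⟨hxU, hxD⟩
      obtain ⟨N, -, hxN, P, hPD, hPo, hPc, hNP⟩ := hstep x (subset_closure hxD) hxU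
      exact ⟨P, ⟨hPD, hPo, hPc⟩, hNP ⟨hxN, hxD⟩⟩
  -- Finitely many patches cover the closure, boundary points included, and their constants add.
  have hcomp : IsCompact (closure D) := hD.2.2.1.isCompact_closure
  have := hcomp.induction_on (p := fun S => IsControlled D Γ (S ∩ D))
    (by simpa using isControlled_empty)
    (fun S S' hSS' h => h.mono (inter_subset_inter_left _ hSS'))
    (fun S S' h h' => by rw [union_inter_distrib_right]; exact h.union h')
    (fun x hx => by
      obtain ⟨N, hNo, hxN, P, -, -, hPc, hNP⟩ := hstep x hx (closure_mono hDU hx)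
      exact ⟨N, mem_nhdsWithin_of_mem_nhds (hNo.mem_nhds hxN), hPc.mono hNP⟩)
  exact this.mono fun x hx => ⟨subset_closure hx, hx⟩

/-- The boundary of a Lipschitz domain is upper Ahlfors regular. -/
theorem IsLipschitzDomain.exists_arcLength_inter_le (hD : IsLipschitzDomain D) :
    ∃ C : ℝ≥0, ∀ A, arcLength (frontier D ∩ A) ≤ C * Metric.ediam A := by
  have hcomp : IsCompact (frontier D) :=
    hD.2.2.1.isCompact_closure.of_isClosed_subset isClosed_frontier frontier_subset_closure
  have := hcomp.induction_on
    (p := fun S => ∃ C : ℝ≥0, ∀ A, arcLength ((S ∩ frontier D) ∩ A) ≤ C * Metric.ediam A)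
    ⟨0, by simp⟩
    (fun S S' hSS' ⟨C, hC⟩ => ⟨C, fun A => (measure_mono (by gcongr)).trans (hC A)⟩)
    (fun S S' ⟨C, hC⟩ ⟨C', hC'⟩ => ⟨C + C', fun A => by
      rw [union_inter_distrib_right, union_inter_distrib_right, ENNReal.coe_add, add_mul]
      exact (measure_union_le _ _).trans (add_le_add (hC A) (hC' A))⟩)
    (fun x hx => by
      obtain ⟨N, e, a₁, a₂, lo, b, c, g, L, hNo, hxN, hg, -, -, hNf⟩ :=
        hD.exists_isPatch_frontier hx
      refine ⟨N, mem_nhdsWithin_of_mem_nhds (hNo.mem_nhds hxN), 1 + L, fun A => ?_⟩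
      have hsub : (N ∩ frontier D) ∩ A ⊆ graphPt e g '' ((fun y => e y 0) '' A) := by
        rintro y ⟨hy, hyA⟩
        obtain ⟨s, -, rfl⟩ := hNf hy
        exact ⟨s, ⟨_, hyA, apply_placed_zero e _⟩, rfl⟩
      -- The length of a piece of a Lipschitz graph is bounded by that of its projection, which is
      -- at most the diameter.
      calc arcLength ((N ∩ frontier D) ∩ A)
          ≤ arcLength (graphPt e g '' ((fun y => e y 0) '' A)) := measure_mono hsub
        _ ≤ ((1 + L : ℝ≥0) : ℝ≥0∞) ^ (1 : ℝ) * μH[1] ((fun y => e y 0) '' A) :=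
            (lipschitzWith_graphPt e hg).hausdorffMeasure_image_le zero_le_one _
        _ ≤ (1 + L : ℝ≥0) * Metric.ediam A := by
            rw [hausdorffMeasure_real, ENNReal.rpow_one]
            gcongr
            refine (Real.volume_le_diam _).trans ?_
            simpa using (lipschitzWith_coord e 0).ediam_image_le A)
  obtain ⟨C, hC⟩ := this
  exact ⟨C, fun A => by simpa using hC A⟩

theorem IsLipschitzDomain.arcLength_frontier_lt_top (hD : IsLipschitzDomain D) :
    arcLength (frontier D) < ∞ := by
  obtain ⟨C, hC⟩ := hD.exists_arcLength_inter_le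
  have h := hC (frontier D)
  rw [inter_self] at h
  refine h.trans_lt (ENNReal.mul_lt_top ENNReal.coe_lt_top ?_)
  exact (Bornology.IsBounded.subset hD.2.2.1.closure frontier_subset_closure).ediam_ne_top.lt_top

end

section

/-! ### Plane geometry -/

theorem inner_plane (x y : Plane) : ⟪x, y⟫ = x 0 * y 0 + x 1 * y 1 := by
  simp [PiLp.inner_apply, Fin.sum_univ_two, mul_comm]

theorem norm_sq_plane (x : Plane) : ‖x‖ ^ 2 = x 0 ^ 2 + x 1 ^ 2 := by
  rw [← real_inner_self_eq_norm_sq, inner_plane]; ring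

theorem exists_unit_orthogonal (d : Plane) : ∃ n : Plane, ‖n‖ = 1 ∧ ⟪d, n⟫ = 0 := by
  by_cases hd : d = 0
  · exact ⟨EuclideanSpace.single 0 1, by simp, by simp [hd]⟩
  · have hm : ‖(!₂[-d 1, d 0] : Plane)‖ = ‖d‖ := by
      rw [← sq_eq_sq₀ (norm_nonneg _) (norm_nonneg _), norm_sq_plane, norm_sq_plane]
      simp; ring
    refine ⟨‖d‖⁻¹ • !₂[-d 1, d 0], ?_, ?_⟩
    · rw [norm_smul, hm, norm_inv, norm_norm, inv_mul_cancel₀ (norm_ne_zero_iff.2 hd)]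
    · rw [inner_smul_right, inner_plane]
      simp; right; ring

/-- In the plane, a vector orthogonal to `d ≠ 0` is a multiple of each unit vector orthogonal
to `d`. -/
theorem norm_eq_abs_inner_of_orthogonal {w n d : Plane} (hd : d ≠ 0) (hn : ‖n‖ = 1)
    (hdn : ⟪d, n⟫ = 0) (hdw : ⟪d, w⟫ = 0) : ‖w‖ = |⟪w, n⟫| := by
  rw [← abs_norm, ← sq_eq_sq_iff_abs_eq_abs]
  have hn2 := norm_sq_plane n
  rw [hn, one_pow] at hn2
  rw [inner_plane] at hdn hdw
  -- Both `w` and `n` are orthogonal to `d ≠ 0`, so their cross product vanishes; the claim is then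
  -- Lagrange's identity.
  have hcross : w 0 * n 1 - w 1 * n 0 = 0 := by
    have h0 : (w 0 * n 1 - w 1 * n 0) * d 0 = 0 := by linear_combination n 1 * hdw - w 1 * hdn
    have h1 : (w 0 * n 1 - w 1 * n 0) * d 1 = 0 := by linear_combination w 0 * hdn - n 0 * hdw
    by_contra hne
    refine hd ?_
    ext i
    fin_cases i
    · exact (mul_eq_zero.1 h0).resolve_left hne
    · exact (mul_eq_zero.1 h1).resolve_left hne
  rw [norm_sq_plane, inner_plane]
  linear_combination (w 0 ^ 2 + w 1 ^ 2) * hn2 + (w 0 * n 1 - w 1 * n 0) * hcross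

/-! ### Simplices -/

theorem convex_hull (K : Finset Plane) : Convex ℝ (hull K) := convex_convexHull ℝ _

theorem isCompact_hull (K : Finset Plane) : IsCompact (hull K) := by
  have := K.finite_toSet.isCompact_convexHull (𝕜 := ℝ)
  exact this

theorem isClosed_hull (K : Finset Plane) : IsClosed (hull K) := (isCompact_hull K).isClosed

theorem subset_hull (K : Finset Plane) : (K : Set Plane) ⊆ hull K := subset_convexHull ℝ _

theorem hull_mono {F K : Finset Plane} (h : F ⊆ K) : hull F ⊆ hull K :=
  convexHull_mono (Finset.coe_subset.2 h)

theorem subsingleton_hull {F : Finset Plane} (hF : F.card ≤ 1) : (hull F).Subsingleton := by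
  rcases Nat.le_one_iff_eq_zero_or_eq_one.1 hF with h | h
  · rw [Finset.card_eq_zero] at h
    simp [hull, h]
  · obtain ⟨a, rfl⟩ := Finset.card_eq_one.1 h
    simp [hull]

theorem hull_pair (a b : Plane) : hull {a, b} = segment ℝ a b := by
  rw [hull, Finset.coe_pair, convexHull_pair]

theorem volume_hull_eq_zero {F : Finset Plane} (hF : F.card ≤ 2) : volume (hull F) = 0 := by
  rcases Nat.lt_or_eq_of_le hF with h | h
  · exact (subsingleton_hull (Nat.lt_succ_iff.1 h)).measure_zero _
  · obtain ⟨a, b, -, rfl⟩ := Finset.card_eq_two.1 h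
    refine measure_mono_null (convexHull_subset_affineSpan _) ?_
    refine Measure.addHaar_affineSubspace volume _ fun htop => ?_
    have h1 := (collinear_pair ℝ a b).finrank_le_one
    rw [← direction_affineSpan, ← Finset.coe_pair, htop, AffineSubspace.direction_top,
      finrank_top, finrank_euclideanSpace_fin] at h1
    norm_num at h1

/-- In the interior all barycentric coordinates are positive; one that vanishes puts the point on
the opposite edge. -/
theorem exists_edge_of_notMem_interior {K : Finset Plane}
    (hK : AffineIndependent ℝ ((↑) : K → Plane)) (hcard : K.card = 3) {x : Plane}
    (hx : x ∈ hull K) (hxi : x ∉ interior (hull K)) :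
    ∃ F ⊆ K, F.card = 2 ∧ x ∈ hull F := by
  classical
  have hspan : affineSpan ℝ (range ((↑) : K → Plane)) = ⊤ := by
    rw [hK.affineSpan_eq_top_iff_card_eq_finrank_add_one]
    simp [hcard]
  set b : AffineBasis K ℝ Plane := ⟨(↑), hK, hspan⟩ with hb
  have hrange : range b = (K : Set Plane) := by
    change range ((↑) : K → Plane) = _
    simp
  have h1 : ∀ i, 0 ≤ b.coord i x := by
    have : x ∈ convexHull ℝ (range b) := by rw [hrange]; exact hx
    rwa [b.convexHull_eq_nonneg_coord] at this
  have h2 : ∃ i, b.coord i x = 0 := by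
    by_contra! hne
    refine hxi ?_
    have : x ∈ interior (convexHull ℝ (range b)) := by
      rw [b.interior_convexHull]
      exact fun i => lt_of_le_of_ne (h1 i) (hne i).symm
    rwa [hrange] at this
  obtain ⟨i, hi⟩ := h2
  refine ⟨K.erase i, Finset.erase_subset _ _, by simp [hcard], ?_⟩
  have hsum := b.sum_coord_apply_eq_one x
  have hcomb := b.linear_combination_coord_eq_self x
  rw [← Finset.add_sum_erase _ _ (Finset.mem_univ i), hi] at hsum hcomb
  rw [zero_add] at hsum
  rw [zero_smul, zero_add] at hcomb
  rw [← hcomb]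
  refine (convex_hull _).sum_mem (fun j _ => h1 j) hsum fun j hj => subset_hull _ ?_
  simp only [Finset.coe_erase, Set.mem_sdiff, Finset.mem_coe, mem_singleton_iff]
  exact ⟨j.2, fun h => (Finset.mem_erase.1 hj).1 (Subtype.ext h)⟩

theorem exists_norm_eq_one_plane : ∃ n : Plane, ‖n‖ = 1 :=
  ⟨EuclideanSpace.single 0 1, by simp⟩

/-- The edges of a triangle that contains a disc are at least as long as its radius. -/
theorem le_dist_of_closedBall_subset {K : Finset Plane} (hcard : K.card = 3) {c : Plane} {ρ : ℝ}
    (hρ : 0 ≤ ρ) (hball : Metric.closedBall c ρ ⊆ hull K) {a b : Plane} (ha : a ∈ K) (hb : b ∈ K)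
    (hab : a ≠ b) : ρ ≤ dist a b := by
  classical
  obtain ⟨z, hz⟩ : ∃ z, (K.erase a).erase b = {z} := by
    rw [← Finset.card_eq_one, Finset.card_erase_of_mem (Finset.mem_erase.2 ⟨hab.symm, hb⟩),
      Finset.card_erase_of_mem ha, hcard]
  -- The third vertex `z` and `a` have the same projection to `n`, so the triangle extends at most
  -- `dist a b` to either side of it, while the disc has width `2ρ`.
  obtain ⟨n, hn, hzn⟩ := exists_unit_orthogonal (z - a)
  have hsub : hull K ⊆ {x | ⟪n, x⟫ ∈ Icc (⟪n, a⟫ - dist a b) (⟪n, a⟫ + dist a b)} := by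
    refine convexHull_min (fun x hx => ?_)
      ((convex_Icc _ _).linear_preimage (innerₛₗ ℝ n))
    have hx' : |⟪n, x - a⟫| ≤ dist a b := by
      by_cases hxa : x = a
      · simp [hxa]
      by_cases hxb : x = b
      · rw [hxb, dist_comm, dist_eq_norm]
        simpa [hn] using abs_real_inner_le_norm n (b - a)
      · have : x ∈ (K.erase a).erase b := by simp [hxa, hxb]; exact hx
        rw [hz, Finset.mem_singleton] at this
        rw [this, real_inner_comm, hzn]
        simp
    rw [inner_sub_right, abs_le] at hx'
    exact ⟨by linarith [hx'.1], by linarith [hx'.2]⟩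
  have h1 := hsub (hball (show c + ρ • n ∈ _ by simp [norm_smul, hn, abs_of_nonneg hρ]))
  have h2 := hsub (hball (show c - ρ • n ∈ _ by
    simp [Metric.mem_closedBall, norm_smul, hn, abs_of_nonneg hρ]))
  have hnn : ⟪n, n⟫ = (1 : ℝ) := by rw [real_inner_self_eq_norm_sq, hn, one_pow]
  simp only [mem_ofPred_eq, inner_add_right, inner_sub_right, inner_smul_right, hnn, mem_Icc] at h1 h2
  linarith [h1.2, h2.1]

namespace Triangulation

variable {U : Set Plane} (T : Triangulation U) {κ : ℝ} {K K' : Finset Plane}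

theorem mem_elements : K ∈ T.elements ↔ K ∈ T.complex.faces ∧ K.card = 3 := by
  simp [elements]

variable {T}

theorem hull_inter (hK : K ∈ T.elements) (hK' : K' ∈ T.elements) :
    hull K ∩ hull K' = hull (K ∩ K') := by
  rw [hull, hull, hull, Finset.coe_inter]
  exact T.complex.convexHull_inter_convexHull (T.mem_elements.1 hK).1 (T.mem_elements.1 hK').1

theorem card_inter_le (hK : K ∈ T.elements) (hK' : K' ∈ T.elements) (hne : K ≠ K') :
    (K ∩ K').card ≤ 2 := by
  have h3 := (T.mem_elements.1 hK).2
  have h3' := (T.mem_elements.1 hK').2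
  by_contra! h
  have h1 : K ∩ K' = K := Finset.eq_of_subset_of_card_le Finset.inter_subset_left (by omega)
  have h2 : K ∩ K' = K' := Finset.eq_of_subset_of_card_le Finset.inter_subset_right (by omega)
  exact hne (h1.symm.trans h2)

theorem exists_mem_hull {x : Plane} (hx : x ∈ closure U) : ∃ K ∈ T.elements, x ∈ hull K := by
  rw [← T.covers] at hx
  simp only [mem_iUnion] at hx
  obtain ⟨K, hK, hxK⟩ := hx
  exact ⟨K, T.mem_elements.2 hK, hxK⟩

theorem hull_subset_closure (hK : K ∈ T.elements) : hull K ⊆ closure U := by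
  rw [← T.covers]
  exact subset_biUnion_of_mem (u := fun K => hull K)
    (show K ∈ {K ∈ T.complex.faces | K.card = 3} from T.mem_elements.1 hK)

theorem isBounded_closure (T : Triangulation U) : Bornology.IsBounded (closure U) := by
  have : closure U = ⋃ K ∈ T.elements, hull K := by
    rw [← T.covers]
    ext x
    simp [mem_elements]
  rw [this]
  exact (T.elements.finite_toSet.isCompact_biUnion fun K _ => isCompact_hull K).isBounded

theorem diam_hull_le_meshSize (hK : K ∈ T.elements) : Metric.diam (hull K) ≤ T.meshSize :=
  le_csSup ((T.elements.finite_toSet.image _).bddAbove) ⟨K, hK, rfl⟩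

theorem meshSize_le (hne : T.elements.Nonempty) : T.meshSize ≤ Metric.diam (closure U) := by
  refine csSup_le ?_ ?_
  · obtain ⟨K, hK⟩ := hne
    exact ⟨_, K, hK, rfl⟩
  · rintro _ ⟨K, hK, rfl⟩
    exact Metric.diam_mono (hull_subset_closure hK) T.isBounded_closure

theorem dist_le_meshSize (hK : K ∈ T.elements) {x y : Plane} (hx : x ∈ hull K) (hy : y ∈ hull K) :
    dist x y ≤ T.meshSize :=
  (Metric.dist_le_diam_of_mem (isCompact_hull K).isBounded hx hy).trans (diam_hull_le_meshSize hK)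

theorem meshSize_pos (hT : T.IsQuasiUniform κ) (hne : T.elements.Nonempty) : 0 < T.meshSize := by
  obtain ⟨K, hK⟩ := hne
  obtain ⟨⟨c, ρ, hρ, hball, -⟩, -⟩ := hT K hK
  obtain ⟨n, hn⟩ := exists_norm_eq_one_plane
  have h1 : c + ρ • n ∈ hull K := hball (by simp [norm_smul, hn, abs_of_pos hρ])
  have h2 : c ∈ hull K := hball (Metric.mem_closedBall_self hρ.le)
  refine lt_of_lt_of_le ?_ (dist_le_meshSize hK h1 h2)
  simpa [norm_smul, hn] using hρ.ne'

/-- Shape regularity gives a radius of at least `diam K / κ` and quasi-uniformity gives `diam K ≥ h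
/ κ`; hence `h / κ²` serves all triangles. -/
theorem exists_closedBall_subset (hκ : 0 < κ) (hT : T.IsQuasiUniform κ) (hK : K ∈ T.elements) :
    ∃ c, Metric.closedBall c (T.meshSize / κ ^ 2) ⊆ hull K := by
  obtain ⟨⟨c, ρ, hρ, hball, hdiam⟩, hh⟩ := hT K hK
  refine ⟨c, (Metric.closedBall_subset_closedBall ?_).trans hball⟩
  rw [div_le_iff₀ (by positivity)]
  calc T.meshSize ≤ κ * Metric.diam (hull K) := hh
    _ ≤ κ * (κ * ρ) := by gcongr
    _ = ρ * κ ^ 2 := by ring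

theorem nonempty_interior_hull (hT : T.IsQuasiUniform κ) (hK : K ∈ T.elements) :
    (interior (hull K)).Nonempty := by
  obtain ⟨⟨c, ρ, hρ, hball, -⟩, -⟩ := hT K hK
  exact ⟨c, interior_mono hball (by
    rw [interior_closedBall _ hρ.ne']; exact Metric.mem_ball_self hρ)⟩

/-- The area of the unit disc. -/
noncomputable def unitArea : ℝ := (volume (Metric.ball (0 : Plane) 1)).toReal

theorem unitArea_pos : 0 < unitArea :=
  ENNReal.toReal_pos (Metric.measure_ball_pos volume _ one_pos).ne' measure_ball_lt_top.ne

theorem volume_real_closedBall (x : Plane) {r : ℝ} (hr : 0 ≤ r) :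
    volume.real (Metric.closedBall x r) = r ^ 2 * unitArea := by
  rw [measureReal_def, Measure.addHaar_closedBall _ _ hr, finrank_euclideanSpace_fin,
    ENNReal.toReal_mul, ENNReal.toReal_ofReal (by positivity), unitArea]

theorem le_volume_hull (hκ : 0 < κ) (hT : T.IsQuasiUniform κ) (hK : K ∈ T.elements) :
    (T.meshSize / κ ^ 2) ^ 2 * unitArea ≤ volume.real (hull K) := by
  obtain ⟨c, hc⟩ := exists_closedBall_subset hκ hT hK
  have := meshSize_pos hT ⟨K, hK⟩
  rw [← volume_real_closedBall c (by positivity)]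
  exact measureReal_mono hc (isCompact_hull K).measure_ne_top

theorem aedisjoint_hull (hK : K ∈ T.elements) (hK' : K' ∈ T.elements) (hne : K ≠ K') :
    AEDisjoint volume (hull K) (hull K') := by
  rw [AEDisjoint, hull_inter hK hK']
  exact volume_hull_eq_zero (card_inter_le hK hK' hne)

open Classical in
/-- The triangles that touch `K`. -/
noncomputable def touching (T : Triangulation U) (K : Finset Plane) : Finset (Finset Plane) :=
  T.elements.filter fun K' => (hull K ∩ hull K').Nonempty

theorem mem_touching : K' ∈ T.touching K ↔ K' ∈ T.elements ∧ (hull K ∩ hull K').Nonempty := by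
  simp [touching]

/-- A packing argument: the triangles touching `K` lie in a disc of radius `2h`, overlap in null
sets only, and each has at least the area of a disc of radius `h / κ²`. The quotient of the areas is
`4κ⁴`. -/
theorem card_touching_le (hκ : 0 < κ) (hT : T.IsQuasiUniform κ) (hK : K ∈ T.elements) :
    ((T.touching K).card : ℝ) ≤ 4 * κ ^ 4 := by
  have hh := meshSize_pos hT ⟨K, hK⟩
  obtain ⟨z, hz⟩ := (nonempty_interior_hull hT hK).mono interior_subset
  have hsub : ⋃ K' ∈ T.touching K, hull K' ⊆ Metric.closedBall z (2 * T.meshSize) := by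
    refine iUnion₂_subset fun K' hK' x hx => ?_
    obtain ⟨hK'1, y, hyK, hyK'⟩ := mem_touching.1 hK'
    calc dist x z ≤ dist x y + dist y z := dist_triangle _ _ _
      _ ≤ T.meshSize + T.meshSize :=
        add_le_add (dist_le_meshSize hK'1 hx hyK') (dist_le_meshSize hK hyK hz)
      _ = _ := by ring
  have hvol : volume.real (⋃ K' ∈ T.touching K, hull K') =
      ∑ K' ∈ T.touching K, volume.real (hull K') := by
    rw [measureReal_def, measure_biUnion_finset₀]
    · rw [ENNReal.toReal_sum fun K' _ => (isCompact_hull K').measure_ne_top]; rfl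
    · exact fun K₁ h₁ K₂ h₂ hne =>
        aedisjoint_hull (mem_touching.1 h₁).1 (mem_touching.1 h₂).1 hne
    · exact fun K' _ => (isClosed_hull K').measurableSet.nullMeasurableSet
  have h1 : (T.touching K).card • ((T.meshSize / κ ^ 2) ^ 2 * unitArea) ≤
      (2 * T.meshSize) ^ 2 * unitArea := by
    rw [← volume_real_closedBall z (r := 2 * T.meshSize) (by positivity)]
    refine le_trans ?_ ((hvol.symm.le).trans (measureReal_mono hsub measure_closedBall_lt_top.ne))
    exact Finset.card_nsmul_le_sum _ _ _ fun K' hK' => le_volume_hull hκ hT (mem_touching.1 hK').1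
  rw [nsmul_eq_mul] at h1
  have hA := unitArea_pos
  have h2 : ((T.touching K).card : ℝ) * (T.meshSize / κ ^ 2) ^ 2 ≤ (2 * T.meshSize) ^ 2 := by
    refine le_of_mul_le_mul_right ?_ hA
    linarith
  rw [div_pow, mul_pow, ← mul_div_assoc, div_le_iff₀ (by positivity)] at h2
  have h3 : (0 : ℝ) < T.meshSize ^ 2 := by positivity
  refine le_of_mul_le_mul_right ?_ h3
  calc _ ≤ _ := h2
    _ = _ := by ring

theorem le_dist_of_mem (hκ : 0 < κ) (hT : T.IsQuasiUniform κ) (hK : K ∈ T.elements) {a b : Plane}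
    (ha : a ∈ K) (hb : b ∈ K) (hab : a ≠ b) : T.meshSize / κ ^ 2 ≤ dist a b := by
  obtain ⟨c, hc⟩ := exists_closedBall_subset hκ hT hK
  have := meshSize_pos hT ⟨K, hK⟩
  exact le_dist_of_closedBall_subset (T.mem_elements.1 hK).2 (by positivity) hc ha hb hab

end Triangulation

end

/-! ### Walks through the triangles around a point -/

section

/-- A bound by one increment per edge of a walk that ends at a vertex where a bound is known. -/
theorem norm_le_of_walk {V E : Type*} [NormedAddCommGroup E] {S : SimpleGraph V} {g : V → E}
    {good : V → Prop} {J M : ℝ} (hJ : 0 ≤ J) (hgood : ∀ v, good v → ‖g v‖ ≤ M)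
    (hadj : ∀ u v, S.Adj u v → ¬ good u → ‖g u - g v‖ ≤ J) :
    ∀ {u v : V} (w : S.Walk u v), good v → ‖g u‖ ≤ w.length * J + M
  | _, _, .nil, hv => by simpa using hgood _ hv
  | u, _, .cons (v := u') h w, hv => by
    have ih := norm_le_of_walk hJ hgood hadj w hv
    rw [SimpleGraph.Walk.length_cons]
    push_cast
    -- The walk may stop at the first good vertex, so increments are needed only at edges that leave
    -- a bad one. These will be faces of cut triangles, where the ghost penalty acts.
    by_cases hu : good u
    · have := hgood u hu
      have : 0 ≤ ((w.length : ℝ) + 1) * J := by positivity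
      linarith
    · have h1 := hadj u u' h hu
      have h2 := norm_le_norm_add_norm_sub' (g u) (g u')
      nlinarith

theorem rank_plane : 1 < Module.rank ℝ Plane := by
  rw [← Module.finrank_eq_rank, finrank_euclideanSpace_fin]
  norm_num

namespace Triangulation

variable {U : Set Plane} {T : Triangulation U} {κ : ℝ} {K K' : Finset Plane}

/-- A triangle containing `z` meets each sufficiently small circle around `z`. -/
theorem exists_mem_sphere (hκ : 0 < κ) (hT : T.IsQuasiUniform κ) (hK : K ∈ T.elements) {z : Plane}
    (hz : z ∈ hull K) {r : ℝ} (hr : 0 < r) (hr' : r ≤ T.meshSize / κ ^ 2) :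
    ∃ x ∈ hull K, x ∈ Metric.sphere z r := by
  obtain ⟨c, hc⟩ := exists_closedBall_subset hκ hT hK
  set ρ := T.meshSize / κ ^ 2
  have hρ : 0 < ρ := hr.trans_le hr'
  obtain ⟨n, hn⟩ := exists_norm_eq_one_plane
  -- The points `c ± ρ n` are `2ρ` apart, so one has distance at least `ρ ≥ r` from `z`; the segment
  -- from `z` to it crosses the circle.
  obtain ⟨y, hy, hyz⟩ : ∃ y ∈ hull K, r ≤ ‖y - z‖ := by
    have h1 : c + ρ • n ∈ hull K := hc (by simp [norm_smul, hn, abs_of_pos hρ])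
    have h2 : c - ρ • n ∈ hull K := hc (by
      simp [Metric.mem_closedBall, norm_smul, hn, abs_of_pos hρ])
    by_contra! h
    have h3 : ‖(c + ρ • n - z) - (c - ρ • n - z)‖ = 2 * ρ := by
      have : (c + ρ • n - z) - (c - ρ • n - z) = (2 * ρ) • n := by module
      rw [this, norm_smul, hn, mul_one, Real.norm_of_nonneg (by positivity)]
    have h4 := norm_sub_le (c + ρ • n - z) (c - ρ • n - z)
    have h5 := h _ h1
    have h6 := h _ h2
    linarith
  have hpos : 0 < ‖y - z‖ := hr.trans_le hyz
  refine ⟨z + (r / ‖y - z‖) • (y - z), ?_, ?_⟩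
  · exact (convex_hull K).add_smul_sub_mem hz hy ⟨by positivity, (div_le_one hpos).2 hyz⟩
  · simp [norm_smul, abs_of_pos hr, div_mul_cancel₀ _ hpos.ne']

open Classical in
/-- The triangles that contain the point `z`. -/
noncomputable def star (T : Triangulation U) (z : Plane) : Finset (Finset Plane) :=
  T.elements.filter fun K => z ∈ hull K

theorem mem_star {z : Plane} : K ∈ T.star z ↔ K ∈ T.elements ∧ z ∈ hull K := by
  simp [star]

open Classical in
/-- The triangles that contain `z`, adjacent if they have a common edge. -/
def starGraph (T : Triangulation U) (z : Plane) : SimpleGraph (T.star z) where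
  Adj K K' := K ≠ K' ∧ (K.1 ∩ K'.1).card = 2
  symm := ⟨fun K K' h => ⟨h.1.symm, by rw [Finset.inter_comm]; exact h.2⟩⟩
  loopless := ⟨fun K h => h.1 rfl⟩

/-- The triangles around an interior point form an edge-connected fan. -/
theorem preconnected_starGraph (hκ : 0 < κ) (hT : T.IsQuasiUniform κ) {z : Plane}
    (hz : closure U ∈ 𝓝 z) : (T.starGraph z).Preconnected := by
  classical
  intro K₀ K₁
  by_contra hreach
  have hh := meshSize_pos hT ⟨K₀.1, (mem_star.1 K₀.2).1⟩
  -- Close to `z` only triangles containing `z` occur.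
  have hnear : ∀ᶠ x in 𝓝 z, ∀ K ∈ T.elements, x ∈ hull K → z ∈ hull K := by
    rw [eventually_all_finset]
    intro K hK
    by_cases hzK : z ∈ hull K
    · exact Eventually.of_forall fun _ _ => hzK
    · filter_upwards [(isClosed_hull K).isOpen_compl.mem_nhds hzK] with x hx hxK
      exact absurd hxK hx
  obtain ⟨ε, hε, hball⟩ := Metric.eventually_nhds_iff.1 (hnear.and hz)
  set r := min (ε / 2) (T.meshSize / κ ^ 2) with hr
  have hr0 : 0 < r := by positivity
  have hrε : r < ε := (min_le_left _ _).trans_lt (by linarith)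
  have hstar : ∀ x ∈ Metric.sphere z r, ∃ K : T.star z, x ∈ hull K.1 := by
    intro x hx
    have h := hball (y := x) (by rw [Metric.mem_sphere.1 hx]; exact hrε)
    obtain ⟨K, hK, hxK⟩ := T.exists_mem_hull h.2
    exact ⟨⟨K, mem_star.2 ⟨hK, h.1 K hK hxK⟩⟩, hxK⟩
  -- If some triangle were unreachable, a small circle around `z` would be covered by two closed
  -- sets that both meet it. The circle is connected, so a reachable and an unreachable triangle
  -- share a point `x` of it; sharing `x ≠ z` and `z`, they have a common edge.
  set A : Set Plane := ⋃ K ∈ {K : T.star z | (T.starGraph z).Reachable K₀ K}, hull K.1 with hA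
  set B : Set Plane := ⋃ K ∈ {K : T.star z | ¬ (T.starGraph z).Reachable K₀ K}, hull K.1 with hB
  have hAc : IsClosed A := (toFinite _).isClosed_biUnion fun K _ => isClosed_hull K.1
  have hBc : IsClosed B := (toFinite _).isClosed_biUnion fun K _ => isClosed_hull K.1
  have hmeet : ∀ K : T.star z, ∃ x ∈ hull K.1, x ∈ Metric.sphere z r := fun K =>
    exists_mem_sphere hκ hT (mem_star.1 K.2).1 (mem_star.1 K.2).2 hr0 (min_le_right _ _)
  obtain ⟨x, hxs, hxA, hxB⟩ := isPreconnected_closed_iff.1 (isPreconnected_sphere rank_plane z r)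
    A B hAc hBc
    (fun x hx => by
      obtain ⟨K, hK⟩ := hstar x hx
      by_cases h : (T.starGraph z).Reachable K₀ K
      · exact Or.inl (mem_biUnion (show K ∈ {K | _} from h) hK)
      · exact Or.inr (mem_biUnion (show K ∈ {K | _} from h) hK))
    (by
      obtain ⟨x, hx, hxs⟩ := hmeet K₀
      exact ⟨x, hxs, mem_biUnion (show K₀ ∈ {K | _} from SimpleGraph.Reachable.refl _) hx⟩)
    (by
      obtain ⟨x, hx, hxs⟩ := hmeet K₁
      exact ⟨x, hxs, mem_biUnion (show K₁ ∈ {K | _} from hreach) hx⟩)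
  obtain ⟨K, hK, hxK⟩ := mem_iUnion₂.1 hxA
  obtain ⟨K', hK', hxK'⟩ := mem_iUnion₂.1 hxB
  have hK : (T.starGraph z).Reachable K₀ K := hK
  have hK' : ¬ (T.starGraph z).Reachable K₀ K' := hK'
  have hne : K ≠ K' := fun h => hK' (h ▸ hK)
  have hKe := mem_star.1 K.2
  have hKe' := mem_star.1 K'.2
  have hx' : x ∈ hull (K.1 ∩ K'.1) := by
    rw [← hull_inter hKe.1 hKe'.1]; exact ⟨hxK, hxK'⟩
  have hz' : z ∈ hull (K.1 ∩ K'.1) := by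
    rw [← hull_inter hKe.1 hKe'.1]; exact ⟨hKe.2, hKe'.2⟩
  have hxz : x ≠ z := fun h => by
    rw [h] at hxs
    simp only [Metric.mem_sphere, dist_self] at hxs
    exact hr0.ne hxs
  have h2 : ¬ (K.1 ∩ K'.1).card ≤ 1 := fun h => hxz (subsingleton_hull h hx' hz')
  have h3 := card_inter_le hKe.1 hKe'.1 (fun h => hne (Subtype.ext h))
  exact hK' (hK.trans (SimpleGraph.Adj.reachable ⟨hne, by omega⟩))

/-! ### The mesh and the domain -/

variable {G : MixedDomain}

theorem mem_active : K ∈ T.active G ↔ K ∈ T.elements ∧ (hull K ∩ G.domain).Nonempty := by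
  simp [active]

theorem mem_cut : K ∈ T.cut G ↔ K ∈ T.elements ∧ (hull K ∩ frontier G.domain).Nonempty := by
  simp [cut]

open Classical in
theorem mem_ghostPairs {P : Finset Plane × Finset Plane} : P ∈ T.ghostPairs G ↔
    (P.1 ∈ T.active G ∧ P.2 ∈ T.active G) ∧ (P.1 ∩ P.2).card = 2 ∧
      (P.1 ∈ T.cut G ∨ P.2 ∈ T.cut G) := by
  rw [ghostPairs, Finset.mem_filter, Finset.mem_product]

/-- A triangle is connected, so one that meets `D` and misses its boundary stays inside. -/
theorem hull_subset_domain (hK : K ∈ T.active G) (hK' : K ∉ T.cut G) : hull K ⊆ G.domain := by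
  have hKe := mem_active.1 hK
  refine (convex_hull K).isPreconnected.subset_of_closure_inter_subset G.isLipschitz.1 hKe.2 ?_
  rintro x ⟨hx, hxK⟩
  by_contra hxD
  exact hK' (mem_cut.2 ⟨hKe.1, x, hxK, by rw [G.isLipschitz.1.frontier_eq]; exact ⟨hx, hxD⟩⟩)

theorem exists_active {x : Plane} (hU : G.domain ⊆ U) (hx : x ∈ G.domain) :
    ∃ K ∈ T.active G, x ∈ hull K := by
  obtain ⟨K, hK, hxK⟩ := T.exists_mem_hull (subset_closure (hU hx))
  exact ⟨K, mem_active.2 ⟨hK, x, hxK, hx⟩, hxK⟩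

theorem isClosed_extended : IsClosed (T.extended G) :=
  (T.active G).finite_toSet.isClosed_biUnion fun K _ => isClosed_hull K

theorem domain_subset_extended (hU : G.domain ⊆ U) : G.domain ⊆ T.extended G := fun _ hx => by
  obtain ⟨K, hK, hxK⟩ := T.exists_active hU hx
  exact mem_biUnion hK hxK

theorem closure_subset_extended (hU : G.domain ⊆ U) : closure G.domain ⊆ T.extended G :=
  closure_minimal (domain_subset_extended hU) isClosed_extended

theorem elements_nonempty (hU : G.domain ⊆ U) : T.elements.Nonempty := by
  obtain ⟨x, hx⟩ := G.isLipschitz.2.1.nonempty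
  obtain ⟨K, hK, -⟩ := T.exists_active hU hx
  exact ⟨K, (mem_active.1 hK).1⟩

open Classical in
/-- The gradient on a cut triangle is controlled by the gradients on the uncut triangles that
touch it and the gradient jumps across nearby faces. -/
theorem norm_le_of_mem_cut (hκ : 0 < κ) (hT : T.IsQuasiUniform κ) (hU : G.domain ⊆ U)
    (hN : T.HasUncutNeighbours G) {g : Finset Plane → Plane} {J M : ℝ} (hJ : 0 ≤ J)
    (hK : K ∈ T.cut G)
    (hgood : ∀ K' ∈ T.active G, K' ∉ T.cut G → K' ∈ T.touching K → ‖g K'‖ ≤ M)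
    (hjump : ∀ P ∈ T.ghostPairs G, P.1 ∈ T.touching K → ‖g P.1 - g P.2‖ ≤ J) :
    ‖g K‖ ≤ 4 * κ ^ 4 * J + M := by
  obtain ⟨K', hK', hK'c, z, hzK, hzK'⟩ := hN K hK
  have hKe := (mem_cut.1 hK).1
  -- The contact point lies in the open set `D`, because the uncut triangle does. Hence the mesh
  -- covers a neighbourhood of it and all triangles around it are active.
  have hzD : z ∈ G.domain := hull_subset_domain hK' hK'c hzK'
  have hzn : closure U ∈ 𝓝 z :=
    mem_of_superset (G.isLipschitz.1.mem_nhds hzD) (hU.trans subset_closure)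
  have hact : ∀ K₁ : T.star z, K₁.1 ∈ T.active G := fun K₁ =>
    mem_active.2 ⟨(mem_star.1 K₁.2).1, z, (mem_star.1 K₁.2).2, hzD⟩
  have htouch : ∀ K₁ : T.star z, K₁.1 ∈ T.touching K := fun K₁ =>
    mem_touching.2 ⟨(mem_star.1 K₁.2).1, z, hzK, (mem_star.1 K₁.2).2⟩
  obtain ⟨w⟩ := preconnected_starGraph hκ hT hzn ⟨K, mem_star.2 ⟨hKe, hzK⟩⟩
    ⟨K', mem_star.2 ⟨(mem_active.1 hK').1, hzK'⟩⟩
  -- A path repeats no triangle, so its length is less than the number of triangles around `z`, all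
  -- of which touch `K`.
  have hlen := w.toPath.2.length_lt
  have hb := norm_le_of_walk (S := T.starGraph z) (g := fun K₁ => g K₁.1)
    (good := fun K₁ => K₁.1 ∉ T.cut G) hJ
    (fun K₁ h => hgood K₁.1 (hact K₁) h (htouch K₁))
    (fun K₁ K₂ hadj hc => hjump (K₁.1, K₂.1)
      (mem_ghostPairs.2 ⟨⟨hact K₁, hact K₂⟩, by convert hadj.2, Or.inl (not_not.1 hc)⟩)
      (htouch K₁))
    w.toPath.1 hK'c
  refine hb.trans ?_
  gcongr
  refine le_trans ?_ (card_touching_le hκ hT hKe)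
  rw [Fintype.card_coe] at hlen
  exact_mod_cast hlen.le.trans (Finset.card_le_card fun K₁ h => htouch ⟨K₁, h⟩)

/-! ### Almost every point lies inside a triangle -/

theorem ae_mem_interior (hU : G.domain ⊆ U) :
    ∀ᵐ x ∂G.vol, ∃ K ∈ T.active G, x ∈ interior (hull K) := by
  have h1 : ∀ᵐ x ∂G.vol, ∀ K ∈ T.active G, x ∉ frontier (hull K) := by
    rw [eventually_all_finset]
    intro K _
    exact ae_restrict_of_ae (measure_eq_zero_iff_ae_notMem.1 ((convex_hull K).addHaar_frontier volume))
  filter_upwards [h1, ae_restrict_mem G.isLipschitz.1.measurableSet] with x hx hxD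
  obtain ⟨K, hK, hxK⟩ := T.exists_active hU hxD
  exact ⟨K, hK, by_contra fun h => hx K hK ⟨subset_closure hxK, h⟩⟩

/-- `Γ` meets the boundary of each cut triangle in two points, which have no length. Therefore the
pointwise gradient of a discrete function is meaningful almost everywhere on `Γ`. -/
theorem ae_arcLength_mem_interior (hU : frontier G.domain ⊆ U) (hB : T.BoundaryResolved G) :
    ∀ᵐ x ∂(arcLength.restrict (frontier G.domain)),
      ∃ K ∈ T.active G, K ∈ T.cut G ∧ x ∈ interior (hull K) := by
  have := Measure.nullSingletonClass_hausdorff Plane (d := 1) one_pos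
  have h1 : ∀ᵐ x ∂(arcLength.restrict (frontier G.domain)),
      ∀ K ∈ T.cut G, x ∉ frontier (hull K) ∩ frontier G.domain := by
    rw [eventually_all_finset]
    intro K hK
    refine ae_restrict_of_ae (measure_eq_zero_iff_ae_notMem.1 ?_)
    have h2 := (hB K hK).1
    -- Infinite sets have `ncard` zero, so the value two includes finiteness.
    exact (finite_of_ncard_ne_zero (by rw [h2]; norm_num)).measure_zero _
  filter_upwards [h1, ae_restrict_mem isClosed_frontier.measurableSet] with x hx hxf
  obtain ⟨K, hK, hxK⟩ := T.exists_mem_hull (subset_closure (hU hxf))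
  have hKc : K ∈ T.cut G := mem_cut.2 ⟨hK, x, hxK, hxf⟩
  have hxi : x ∈ interior (hull K) :=
    by_contra fun h => hx K hKc ⟨⟨subset_closure hxK, h⟩, hxf⟩
  obtain ⟨y, hy, hyD⟩ := mem_closure_iff.1 (frontier_subset_closure hxf) _ isOpen_interior hxi
  exact ⟨K, mem_active.2 ⟨hK, y, interior_subset hy, hyD⟩, hKc, hxi⟩

end Triangulation

end

section

/-! ### Gradients of piecewise affine functions -/

/-- On the triangle `K` the function `v` is affine with gradient `g`. -/
def IsCellGrad (v : Plane → ℝ) (K : Finset Plane) (g : Plane) : Prop :=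
  ∀ x ∈ hull K, ∀ y ∈ hull K, v x - v y = ⟪g, x - y⟫

theorem exists_isCellGrad {v : Plane → ℝ} {K : Finset Plane}
    (h : ∃ a : Plane →ᵃ[ℝ] ℝ, EqOn v a (hull K)) : ∃ g, IsCellGrad v K g := by
  obtain ⟨a, ha⟩ := h
  refine ⟨(InnerProductSpace.toDual ℝ Plane).symm (LinearMap.toContinuousLinearMap a.linear),
    fun x hx y hy => ?_⟩
  rw [InnerProductSpace.toDual_symm_apply, ha hx, ha hy]
  have := a.linearMap_vsub x y
  simpa using this.symm

section CellGrad

variable {v w : Plane → ℝ} {K : Finset Plane} {g g' x : Plane}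

theorem IsCellGrad.sub (hv : IsCellGrad v K g) (hw : IsCellGrad w K g') :
    IsCellGrad (fun x => v x - w x) K (g - g') := fun x hx y hy => by
  rw [inner_sub_left, ← hv x hx y hy, ← hw x hx y hy]; ring

theorem IsCellGrad.hasFDerivWithinAt (h : IsCellGrad v K g) (hx : x ∈ hull K) :
    HasFDerivWithinAt v (InnerProductSpace.toDual ℝ Plane g) (hull K) x := by
  have h1 : HasFDerivWithinAt (fun y => v x + InnerProductSpace.toDual ℝ Plane g (y - x))
      (InnerProductSpace.toDual ℝ Plane g) (hull K) x := by
    have := ((InnerProductSpace.toDual ℝ Plane g).hasFDerivAt.comp x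
      ((hasFDerivAt_id x).sub_const x)).const_add (v x)
    exact this.hasFDerivWithinAt
  refine h1.congr (fun y hy => ?_) (by simp)
  simp only [InnerProductSpace.toDual_apply_apply]
  rw [← h y hy x hx]; ring

theorem IsCellGrad.hasGradientAt (h : IsCellGrad v K g) (hx : x ∈ interior (hull K)) :
    HasGradientAt v g x :=
  (h.hasFDerivWithinAt (interior_subset hx)).hasFDerivAt (mem_interior_iff_mem_nhds.1 hx)

theorem IsCellGrad.gradient_eq (h : IsCellGrad v K g) (hx : x ∈ interior (hull K)) :
    gradient v x = g := (h.hasGradientAt hx).gradient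

theorem IsCellGrad.fderivWithin_apply (h : IsCellGrad v K g) (hK : (interior (hull K)).Nonempty)
    (hx : x ∈ hull K) (n : Plane) : fderivWithin ℝ v (hull K) x n = ⟪g, n⟫ := by
  rw [(h.hasFDerivWithinAt hx).fderivWithin
    (uniqueDiffWithinAt_convex (convex_hull K) hK (subset_closure hx)),
    InnerProductSpace.toDual_apply_apply]

end CellGrad

theorem measurable_gradient (v : Plane → ℝ) : Measurable (gradient v) := by
  unfold gradient
  exact (InnerProductSpace.toDual ℝ Plane).symm.continuous.measurable.comp (measurable_fderiv ℝ v)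

theorem faceNormal_spec {F : Finset Plane} (hF : F.card = 2) :
    ‖faceNormal F‖ = 1 ∧ ∀ a ∈ F, ∀ b ∈ F, ⟪a - b, faceNormal F⟫ = 0 := by
  classical
  refine Classical.epsilon_spec
    (p := fun n : Plane => ‖n‖ = 1 ∧ ∀ a ∈ F, ∀ b ∈ F, ⟪a - b, n⟫ = 0) ?_
  obtain ⟨a, b, -, rfl⟩ := Finset.card_eq_two.1 hF
  obtain ⟨n, hn, h⟩ := exists_unit_orthogonal (a - b)
  refine ⟨n, hn, ?_⟩
  have h' : ⟪b - a, n⟫ = 0 := by rw [← neg_sub, inner_neg_left, h, neg_zero]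
  simp [h, h']

theorem arcLength_hull_pair (a b : Plane) : arcLength (hull {a, b}) = edist a b := by
  rw [hull_pair, hausdorffMeasure_segment]

section Jump

open Classical in
/-- The `L²` product of the gradient jumps of two piecewise affine functions across a face. -/
theorem l2Inner_gradJump {v w : Plane → ℝ} {K K' : Finset Plane} {g₁ g₂ k₁ k₂ : Plane}
    (hK : (interior (hull K)).Nonempty) (hK' : (interior (hull K')).Nonempty)
    (hw : IsCellGrad w K g₁) (hw' : IsCellGrad w K' g₂)
    (hv : IsCellGrad v K k₁) (hv' : IsCellGrad v K' k₂) :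
    l2Inner (arcLength.restrict (hull (K ∩ K'))) (gradJump K K' w) (gradJump K K' v) =
      arcLength.real (hull (K ∩ K')) *
        (⟪g₁ - g₂, faceNormal (K ∩ K')⟫ * ⟪k₁ - k₂, faceNormal (K ∩ K')⟫) := by
  rw [l2Inner, setIntegral_congr_fun (isClosed_hull _).measurableSet
    (g := fun _ => ⟪g₁ - g₂, faceNormal (K ∩ K')⟫ * ⟪k₁ - k₂, faceNormal (K ∩ K')⟫)]
  · simp
  · intro x hx
    have h1 : x ∈ hull K := hull_mono Finset.inter_subset_left hx
    have h2 : x ∈ hull K' := hull_mono Finset.inter_subset_right hx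
    simp only [gradJump]
    rw [hw.fderivWithin_apply hK h1, hw'.fderivWithin_apply hK' h2, hv.fderivWithin_apply hK h1,
      hv'.fderivWithin_apply hK' h2, inner_sub_left, inner_sub_left]

open Classical in
-- The two affine pieces agree on the common edge, so the tangential derivative does not jump. Thus
-- the ghost penalty, which sees normal components only, controls the full jump.
theorem norm_sub_eq_abs_inner_faceNormal {v : Plane → ℝ} {K K' : Finset Plane} {g₁ g₂ : Plane}
    (hF : (K ∩ K').card = 2) (hv : IsCellGrad v K g₁) (hv' : IsCellGrad v K' g₂) :
    ‖g₁ - g₂‖ = |⟪g₁ - g₂, faceNormal (K ∩ K')⟫| := by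
  obtain ⟨hn, horth⟩ := faceNormal_spec hF
  obtain ⟨a, b, hab, hFab⟩ := Finset.card_eq_two.1 hF
  have ha : a ∈ K ∩ K' := by rw [hFab]; simp
  have hb : b ∈ K ∩ K' := by rw [hFab]; simp
  refine norm_eq_abs_inner_of_orthogonal (sub_ne_zero.2 hab) hn (horth a ha b hb) ?_
  rw [real_inner_comm, inner_sub_left,
    ← hv a (subset_hull K (Finset.mem_inter.1 ha).1) b (subset_hull K (Finset.mem_inter.1 hb).1),
    ← hv' a (subset_hull K' (Finset.mem_inter.1 ha).2) b
      (subset_hull K' (Finset.mem_inter.1 hb).2), sub_self]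

end Jump

/-! ### Discrete functions -/

namespace Triangulation

variable {U : Set Plane} {T : Triangulation U} {G : MixedDomain} {v w : Plane → ℝ} {κ : ℝ}

theorem IsDiscrete.sub (hv : T.IsDiscrete G v) (hw : T.IsDiscrete G w) :
    T.IsDiscrete G (fun x => v x - w x) := by
  refine ⟨hv.1.sub hw.1, fun K hK => ?_⟩
  obtain ⟨a, ha⟩ := hv.2 K hK
  obtain ⟨b, hb⟩ := hw.2 K hK
  exact ⟨a - b, fun x hx => by simp [ha hx, hb hx]⟩

theorem IsDiscrete.exists_cellGrad (hv : T.IsDiscrete G v) :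
    ∃ g : Finset Plane → Plane, ∀ K ∈ T.active G, IsCellGrad v K (g K) := by
  classical
  refine ⟨fun K => if h : ∃ g, IsCellGrad v K g then h.choose else 0, fun K hK => ?_⟩
  have h := exists_isCellGrad (hv.2 K hK)
  simp only [dif_pos h]
  exact h.choose_spec

theorem IsDiscrete.exists_norm_gradient_le (hv : T.IsDiscrete G v) :
    ∃ M, ∀ K ∈ T.active G, ∀ x ∈ interior (hull K), ‖gradient v x‖ ≤ M := by
  obtain ⟨g, hg⟩ := hv.exists_cellGrad
  refine ⟨∑ K ∈ T.active G, ‖g K‖, fun K hK x hx => ?_⟩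
  rw [(hg K hK).gradient_eq hx]
  exact Finset.single_le_sum (f := fun K => ‖g K‖) (fun _ _ => norm_nonneg _) hK

theorem isCompact_extended : IsCompact (T.extended G) :=
  (T.active G).finite_toSet.isCompact_biUnion fun K _ => isCompact_hull K

section Measures

variable {μ : Measure Plane} [IsFiniteMeasure μ]

theorem IsDiscrete.memLp_gradient (hv : T.IsDiscrete G v)
    (hμ : ∀ᵐ x ∂μ, ∃ K ∈ T.active G, x ∈ interior (hull K)) : MemLp (gradient v) 2 μ := by
  obtain ⟨M, hM⟩ := hv.exists_norm_gradient_le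
  refine MemLp.of_bound (measurable_gradient v).aestronglyMeasurable M ?_
  filter_upwards [hμ] with x ⟨K, hK, hx⟩
  exact hM K hK x hx

theorem IsDiscrete.memLp (hv : T.IsDiscrete G v)
    (hμ : ∀ᵐ x ∂μ, ∃ K ∈ T.active G, x ∈ interior (hull K)) : MemLp v 2 μ := by
  have hext : ∀ᵐ x ∂μ, x ∈ T.extended G := by
    filter_upwards [hμ] with x ⟨K, hK, hx⟩
    exact mem_biUnion hK (interior_subset hx)
  obtain ⟨M, hM⟩ := (isCompact_extended.exists_bound_of_continuousOn hv.1)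
  refine MemLp.of_bound ?_ M (hext.mono hM)
  rw [← Measure.restrict_eq_self_of_ae_mem hext]
  exact hv.1.aestronglyMeasurable isClosed_extended.measurableSet

end Measures

/-- The fundamental theorem of calculus along almost every line. Extension by zero makes the
function measurable on the plane and changes nothing on the closed set where it is used. -/
theorem IsDiscrete.lineControl (hv : T.IsDiscrete G v) (hU : G.domain ⊆ U) :
    LineControl G.domain ((T.extended G).indicator v) (fun x => ‖gradient v x‖ₑ) := by
  classical
  have hclosed : IsClosed (T.extended G) := isClosed_extended
  refine ⟨?_, (measurable_gradient v).enorm, fun e => ?_⟩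
  · rw [← piecewise_eq_indicator]
    exact hv.1.measurable_piecewise continuousOn_const hclosed.measurableSet
  obtain ⟨g, hg⟩ := hv.exists_cellGrad
  obtain ⟨M, hM⟩ := hv.exists_norm_gradient_le
  -- Lines through mesh vertices are discarded. Any other line contains no edge and meets each edge
  -- at most once.
  set Z : Finset ℝ := (T.active G).biUnion fun K => K.image fun a => e a 0 with hZ
  have hZae : ∀ᵐ s : ℝ, s ∉ Z := by
    have := measure_eq_zero_iff_ae_notMem.1 (Z.finite_toSet.measure_zero volume)
    simpa using this
  filter_upwards [hZae] with s hs t t' htt' hseg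
  set line : ℝ → Plane := fun τ => placed e (s, τ) with hline
  have hlinec : Continuous line := (continuous_placed e).comp (Continuous.prodMk_right s)
  set u : Plane := e.symm.linearIsometryEquiv !₂[0, 1] with hu
  have hu1 : ‖u‖ = 1 := by
    rw [hu, LinearIsometryEquiv.norm_map, EuclideanSpace.norm_eq]
    simp
  have hderiv : ∀ τ, HasDerivAt line u τ := by
    intro τ
    have hl : ∀ τ', line τ' = line 0 + τ' • u := by
      intro τ'
      have h1 := e.symm.map_vadd !₂[s, 0] (τ' • !₂[0, 1])
      have h2 : (τ' • !₂[0, 1] : Plane) +ᵥ (!₂[s, 0] : Plane) = !₂[s, τ'] := by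
        ext i; fin_cases i <;> simp
      rw [h2] at h1
      rw [hline]
      simp only [placed]
      rw [h1, vadd_eq_add, map_smul, add_comm]
    rw [funext hl]
    simpa using ((hasDerivAt_id τ).smul_const u).const_add (line 0)
  -- The end points may lie on the boundary of `D`; continuity up to them holds because the extended
  -- domain is closed.
  have hIcc : ∀ τ ∈ Icc t t', line τ ∈ T.extended G := by
    have h1 : Icc t t' ⊆ line ⁻¹' T.extended G := by
      rw [← closure_Ioo htt'.ne]
      exact closure_minimal (fun τ hτ => domain_subset_extended hU (hseg τ hτ))
        (hclosed.preimage hlinec)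
    exact fun τ hτ => h1 hτ
  set S : Set ℝ := ⋃ K ∈ T.active G, ⋃ F ∈ K.powersetCard 2, line ⁻¹' hull F with hS
  have hScount : S.Countable := by
    refine (T.active G).countable_toSet.biUnion fun K hK =>
      (K.powersetCard 2).countable_toSet.biUnion fun F hF => ?_
    obtain ⟨hFK, hF2⟩ := Finset.mem_powersetCard.1 hF
    obtain ⟨a, b, -, rfl⟩ := Finset.card_eq_two.1 hF2
    have hnot : ∀ z ∈ K, e z 0 ≠ s := fun z hz h => hs (by
      rw [hZ, Finset.mem_biUnion]
      exact ⟨K, hK, Finset.mem_image.2 ⟨z, hz, h⟩⟩)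
    have ha := hnot a (hFK (by simp))
    refine Subsingleton.countable fun τ hτ τ' hτ' => ?_
    have key : ∀ τ ∈ line ⁻¹' hull {a, b}, ∃ l : ℝ, s = e a 0 + l * (e b 0 - e a 0) ∧
        τ = e a 1 + l * (e b 1 - e a 1) := by
      intro τ hτ
      rw [mem_preimage, hull_pair, segment_eq_image_lineMap] at hτ
      obtain ⟨l, -, hl⟩ := hτ
      have h1 : e (line τ) = AffineMap.lineMap (e a) (e b) l := by
        rw [← hl]
        exact e.toAffineEquiv.toAffineMap.apply_lineMap a b l
      have h2 := congrArg (fun z : Plane => z 0) h1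
      have h3 := congrArg (fun z : Plane => z 1) h1
      simp only [hline, apply_placed_zero, apply_placed_one, AffineMap.lineMap_apply,
        vsub_eq_sub, vadd_eq_add, PiLp.add_apply, PiLp.smul_apply, PiLp.sub_apply,
        smul_eq_mul] at h2 h3
      exact ⟨l, by linarith, by linarith⟩
    obtain ⟨l, hl, rfl⟩ := key τ hτ
    obtain ⟨l', hl', rfl⟩ := key τ' hτ'
    have hne : e b 0 - e a 0 ≠ 0 := fun h => ha (by rw [h] at hl; linarith)
    have : l = l' := mul_right_cancel₀ hne (by linarith)
    rw [this]
  have hint : ∀ τ ∈ Ioo t t' \ S, ∃ K ∈ T.active G, line τ ∈ interior (hull K) := by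
    rintro τ ⟨hτ, hτS⟩
    obtain ⟨K, hK, hx⟩ := T.exists_active hU (hseg τ hτ)
    refine ⟨K, hK, by_contra fun hxi => hτS ?_⟩
    have hKf := T.mem_elements.1 (mem_active.1 hK).1
    obtain ⟨F, hFK, hF2, hxF⟩ :=
      exists_edge_of_notMem_interior (T.complex.indep hKf.1) hKf.2 hx hxi
    exact mem_biUnion hK (mem_biUnion (Finset.mem_powersetCard.2 ⟨hFK, hF2⟩) hxF)
  set f' : ℝ → ℝ := fun τ => ⟪gradient v (line τ), u⟫ with hf'
  have hf'm : Measurable f' :=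
    ((measurable_gradient v).comp hlinec.measurable).inner_const
  have hae : ∀ᵐ τ ∂(volume.restrict (Ioc t t')), ‖f' τ‖ ≤ M := by
    rw [← Measure.restrict_congr_set Ioo_ae_eq_Ioc]
    filter_upwards [ae_restrict_mem measurableSet_Ioo,
      ae_restrict_of_ae (measure_eq_zero_iff_ae_notMem.1 (hScount.measure_zero volume))]
      with τ hτ hτS
    obtain ⟨K, hK, hx⟩ := hint τ ⟨hτ, hτS⟩
    refine (norm_inner_le_norm _ _).trans ?_
    rw [hu1, mul_one]
    exact hM K hK _ hx
  have hfint : IntervalIntegrable f' volume t t' := by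
    rw [intervalIntegrable_iff_integrableOn_Ioc_of_le htt'.le]
    exact Integrable.of_bound hf'm.aestronglyMeasurable M hae
  have hftc := integral_eq_of_hasDerivAt_off_countable_of_le (fun τ => v (line τ)) f' htt'.le
    hScount (hv.1.comp hlinec.continuousOn hIcc) (fun τ hτ => by
      obtain ⟨K, hK, hx⟩ := hint τ hτ
      have h1 := (hg K hK).hasGradientAt hx
      have h2 := (h1.hasFDerivAt).comp_hasDerivAt τ (hderiv τ)
      rw [InnerProductSpace.toDual_apply_apply, ← h1.gradient] at h2
      exact h2) hfint
  rw [indicator_of_mem (hIcc t (left_mem_Icc.2 htt'.le)),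
    indicator_of_mem (hIcc t' (right_mem_Icc.2 htt'.le)), enorm_sub_rev, ← hftc,
    intervalIntegral.integral_of_le htt'.le, integral_Ioc_eq_integral_Ioo]
  refine (enorm_integral_le_lintegral_enorm _).trans (lintegral_mono fun τ => ?_)
  rw [← ofReal_norm, ← ofReal_norm]
  refine ENNReal.ofReal_le_ofReal ((norm_inner_le_norm _ _).trans ?_)
  rw [hu1, mul_one]

end Triangulation

end

section

/-! ### `L²` products -/

section L2

variable {μ ν : Measure Plane} {f g k : Plane → ℝ}

theorem l2Inner_comm (f g : Plane → ℝ) : l2Inner μ f g = l2Inner μ g f := by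
  simp only [l2Inner, mul_comm]

theorem l2Inner_sub_left (hf : MemLp f 2 μ) (hg : MemLp g 2 μ) (hk : MemLp k 2 μ) :
    l2Inner μ (fun x => f x - g x) k = l2Inner μ f k - l2Inner μ g k := by
  simp only [l2Inner, sub_mul]
  exact integral_sub (hf.integrable_mul hk) (hg.integrable_mul hk)

theorem l2Inner_sub_right (hf : MemLp f 2 μ) (hg : MemLp g 2 μ) (hk : MemLp k 2 μ) :
    l2Inner μ k (fun x => f x - g x) = l2Inner μ k f - l2Inner μ k g := by
  rw [l2Inner_comm, l2Inner_sub_left hf hg hk, l2Inner_comm, l2Inner_comm g]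

theorem l2Inner_const_mul_left (c : ℝ) (f g : Plane → ℝ) :
    l2Inner μ (fun x => c * f x) g = c * l2Inner μ f g := by
  simp only [l2Inner, mul_assoc]
  exact integral_const_mul c _

theorem l2Inner_congr_left {f' : Plane → ℝ} (h : f =ᵐ[μ] f') (g : Plane → ℝ) :
    l2Inner μ f g = l2Inner μ f' g :=
  integral_congr_ae (h.mono fun x hx => by simp only [hx])

theorem l2Inner_self_nonneg (f : Plane → ℝ) : 0 ≤ l2Inner μ f f :=
  integral_nonneg fun x => mul_self_nonneg (f x)

theorem l2Norm_nonneg (f : Plane → ℝ) : 0 ≤ l2Norm μ f := Real.sqrt_nonneg _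

theorem l2Norm_sq (f : Plane → ℝ) : l2Norm μ f ^ 2 = l2Inner μ f f :=
  Real.sq_sqrt (l2Inner_self_nonneg f)

theorem integrable_mul_of_memLp (hf : MemLp f 2 μ) (hg : MemLp g 2 μ) :
    Integrable (fun x => f x * g x) μ := hf.integrable_mul hg

/-- Weighted Young inequality: the difference of the two sides is the integral of `c⁻¹ (c f - g)²`.
-/
theorem two_mul_l2Inner_le (hf : MemLp f 2 μ) (hg : MemLp g 2 μ) {c : ℝ} (hc : 0 < c) :
    2 * l2Inner μ f g ≤ c * l2Inner μ f f + c⁻¹ * l2Inner μ g g := by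
  simp only [l2Inner]
  rw [← integral_const_mul, ← integral_const_mul, ← integral_const_mul, ← integral_add
    ((integrable_mul_of_memLp hf hf).const_mul _) ((integrable_mul_of_memLp hg hg).const_mul _)]
  refine integral_mono ((integrable_mul_of_memLp hf hg).const_mul _)
    (((integrable_mul_of_memLp hf hf).const_mul _).add ((integrable_mul_of_memLp hg hg).const_mul _)) fun x => ?_
  have h1 : 0 ≤ c⁻¹ * (c * f x - g x) ^ 2 := by positivity
  have h2 : c⁻¹ * (c * f x - g x) ^ 2 =
      c * (f x * f x) + c⁻¹ * (g x * g x) - 2 * (f x * g x) := by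
    field_simp; ring
  simp only
  linarith

/-- The discriminant of this nonnegative polynomial in `t` gives Cauchy–Schwarz; its value at `t =
1` gives the triangle inequality. -/
theorem l2Inner_self_mul_add (hf : MemLp f 2 μ) (hg : MemLp g 2 μ) (t : ℝ) :
    l2Inner μ (fun x => t * f x + g x) (fun x => t * f x + g x) =
      l2Inner μ f f * (t * t) + (2 * l2Inner μ f g) * t + l2Inner μ g g := by
  have h1 := (integrable_mul_of_memLp hf hf).const_mul (t * t)
  have h2 := (integrable_mul_of_memLp hf hg).const_mul (2 * t)
  have h12 : Integrable (fun x => t * t * (f x * f x) + 2 * t * (f x * g x)) μ := h1.add h2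
  have h3 : ∫ x, (t * f x + g x) * (t * f x + g x) ∂μ =
      ∫ x, (t * t * (f x * f x) + 2 * t * (f x * g x)) + g x * g x ∂μ := by
    congr 1; ext x; ring
  simp only [l2Inner]
  rw [h3, integral_add h12 (integrable_mul_of_memLp hg hg), integral_add h1 h2,
    integral_const_mul, integral_const_mul]
  ring

theorem abs_l2Inner_le (hf : MemLp f 2 μ) (hg : MemLp g 2 μ) :
    |l2Inner μ f g| ≤ l2Norm μ f * l2Norm μ g := by
  have h : ∀ t : ℝ, 0 ≤ l2Inner μ f f * (t * t) + (2 * l2Inner μ f g) * t + l2Inner μ g g :=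
    fun t => by rw [← l2Inner_self_mul_add hf hg]; exact l2Inner_self_nonneg _
  have hd := discrim_le_zero h
  rw [discrim] at hd
  rw [l2Norm, l2Norm, ← Real.sqrt_mul (l2Inner_self_nonneg f)]
  refine Real.abs_le_sqrt ?_
  linarith

theorem l2Norm_le_add (hf : MemLp f 2 μ) (hg : MemLp g 2 μ) (hk : MemLp k 2 μ) :
    l2Norm μ (fun x => f x - k x) ≤
      l2Norm μ (fun x => f x - g x) + l2Norm μ (fun x => g x - k x) := by
  have h1 : MemLp (fun x => f x - g x) 2 μ := hf.sub hg
  have h2 : MemLp (fun x => g x - k x) 2 μ := hg.sub hk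
  refine abs_le_of_sq_le_sq' ?_ (add_nonneg (l2Norm_nonneg _) (l2Norm_nonneg _)) |>.2
  have h3 := l2Inner_self_mul_add h1 h2 1
  simp only [one_mul, mul_one, sub_add_sub_cancel] at h3
  have h4 := (abs_le.1 (abs_l2Inner_le h1 h2)).2
  rw [add_sq, l2Norm_sq, l2Norm_sq, l2Norm_sq, h3]
  linarith

theorem l2Inner_self_mono (hμν : μ ≤ ν) (hf : MemLp f 2 ν) : l2Inner μ f f ≤ l2Inner ν f f :=
  integral_mono_measure hμν (Eventually.of_forall fun x => mul_self_nonneg (f x))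
    (hf.integrable_mul hf)

theorem lintegral_enorm_sq {E : Type*} [NormedAddCommGroup E] {F : Plane → E}
    (hF : MemLp F 2 μ) : ∫⁻ x, ‖F x‖ₑ ^ 2 ∂μ = ENNReal.ofReal (∫ x, ‖F x‖ ^ 2 ∂μ) := by
  rw [ofReal_integral_eq_lintegral_ofReal ((memLp_two_iff_integrable_sq_norm hF.1).1 hF)
    (Eventually.of_forall fun x => by positivity)]
  refine lintegral_congr fun x => ?_
  rw [ENNReal.ofReal_pow (norm_nonneg _), ofReal_norm]

theorem l2Inner_self_eq_integral_norm_sq (f : Plane → ℝ) :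
    l2Inner μ f f = ∫ x, ‖f x‖ ^ 2 ∂μ := by
  simp only [l2Inner, Real.norm_eq_abs, sq_abs, ← sq]

theorem integrable_inner_of_memLp {F H : Plane → Plane} (hF : MemLp F 2 μ) (hH : MemLp H 2 μ) :
    Integrable (fun x => ⟪F x, H x⟫) μ := by
  refine (hF.norm.integrable_mul hH.norm).mono (hF.1.inner hH.1) (Eventually.of_forall fun x => ?_)
  rw [Pi.mul_apply, norm_mul, norm_norm, norm_norm]
  exact norm_inner_le_norm _ _

end L2

/-! ### The boundary measures and the normal -/

namespace MixedDomain

variable (G : MixedDomain)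

instance isFiniteMeasure_vol : IsFiniteMeasure G.vol :=
  ⟨by rw [vol, Measure.restrict_apply_univ]; exact G.isLipschitz.2.2.1.measure_lt_top⟩

/-- Arc length on the boundary. -/
noncomputable def lenB : Measure Plane := arcLength.restrict (frontier G.domain)

instance isFiniteMeasure_lenB : IsFiniteMeasure G.lenB :=
  ⟨by rw [lenB, Measure.restrict_apply_univ]; exact G.isLipschitz.arcLength_frontier_lt_top⟩

theorem lenD_le : G.lenD ≤ G.lenB :=
  Measure.restrict_mono (G.union_eq ▸ subset_union_left) le_rfl

theorem lenN_le : G.lenN ≤ G.lenB :=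
  Measure.restrict_mono (G.union_eq ▸ subset_union_right) le_rfl

instance isFiniteMeasure_lenD : IsFiniteMeasure G.lenD := isFiniteMeasure_of_le _ G.lenD_le

instance isFiniteMeasure_lenN : IsFiniteMeasure G.lenN := isFiniteMeasure_of_le _ G.lenN_le

theorem measurable_normal : Measurable G.normal := by
  rw [normal, outwardNormal]
  split_ifs with h
  · exact h.choose_spec.1
  · exact measurable_const

/-- Only an upper bound is claimed, so the default value zero of `outwardNormal` is covered and the
existence of a normal field is never needed. -/
theorem ae_norm_normal_le : ∀ᵐ x ∂G.lenB, ‖G.normal x‖ ≤ 1 := by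
  rw [normal, outwardNormal]
  split_ifs with h
  · exact h.choose_spec.2.mono fun x hx => hx.1.le
  · simp

variable {G}

theorem memLp_inner_normal {μ : Measure Plane} (hμ : μ ≤ G.lenB) {F : Plane → Plane}
    (hF : MemLp F 2 μ) : MemLp (fun x => ⟪G.normal x, F x⟫) 2 μ := by
  refine hF.of_le (G.measurable_normal.aestronglyMeasurable.inner hF.1) ?_
  filter_upwards [ae_mono hμ G.ae_norm_normal_le] with x hx
  refine (norm_inner_le_norm _ _).trans ?_
  exact mul_le_of_le_one_left (norm_nonneg _) hx

end MixedDomain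

/-! ### Discrete functions on the domain and on its boundary -/

namespace Triangulation

variable {U : Set Plane} {T : Triangulation U} {G : MixedDomain} {v w z : Plane → ℝ} {κ : ℝ}
  {γ : Penalty}

/-- The mesh is quasi-uniform and resolves the geometry. -/
structure IsFitted (T : Triangulation U) (G : MixedDomain) (κ : ℝ) : Prop where
  pos : 0 < κ
  quasiUniform : T.IsQuasiUniform κ
  resolved : T.BoundaryResolved G
  neighbours : T.HasUncutNeighbours G
  domain_subset : G.domain ⊆ U
  frontier_subset : frontier G.domain ⊆ U

/-- The measure `μ` does not charge the edges of the active mesh. -/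
def IsRegularMeasure (T : Triangulation U) (G : MixedDomain) (μ : Measure Plane) : Prop :=
  ∀ᵐ x ∂μ, ∃ K ∈ T.active G, x ∈ interior (hull K)

theorem IsFitted.vol (h : T.IsFitted G κ) : T.IsRegularMeasure G G.vol :=
  ae_mem_interior h.domain_subset

theorem IsFitted.lenB (h : T.IsFitted G κ) : T.IsRegularMeasure G G.lenB :=
  (ae_arcLength_mem_interior h.frontier_subset h.resolved).mono fun _ ⟨K, hK, _, hx⟩ => ⟨K, hK, hx⟩

theorem IsFitted.lenD (h : T.IsFitted G κ) : T.IsRegularMeasure G G.lenD :=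
  ae_mono G.lenD_le h.lenB

theorem IsFitted.lenN (h : T.IsFitted G κ) : T.IsRegularMeasure G G.lenN :=
  ae_mono G.lenN_le h.lenB

theorem IsFitted.meshSize_pos (h : T.IsFitted G κ) : 0 < T.meshSize :=
  Triangulation.meshSize_pos h.quasiUniform (elements_nonempty h.domain_subset)

theorem IsDiscrete.memLp_normalDeriv (hv : T.IsDiscrete G v) {μ : Measure Plane} (hμ : μ ≤ G.lenB)
    (hT : T.IsRegularMeasure G μ) : MemLp (normalDeriv G v) 2 μ := by
  have := isFiniteMeasure_of_le _ hμ
  exact MixedDomain.memLp_inner_normal hμ (hv.memLp_gradient hT)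

theorem IsDiscrete.gradient_sub (hv : T.IsDiscrete G v) (hw : T.IsDiscrete G w) {μ : Measure Plane}
    (hμ : T.IsRegularMeasure G μ) :
    gradient (fun x => v x - w x) =ᵐ[μ] fun x => gradient v x - gradient w x := by
  obtain ⟨g, hg⟩ := hv.exists_cellGrad
  obtain ⟨k, hk⟩ := hw.exists_cellGrad
  refine hμ.mono fun x ⟨K, hK, hx⟩ => ?_
  simp only
  rw [((hg K hK).sub (hk K hK)).gradient_eq hx, (hg K hK).gradient_eq hx, (hk K hK).gradient_eq hx]

theorem IsDiscrete.normalDeriv_sub (hv : T.IsDiscrete G v) (hw : T.IsDiscrete G w)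
    {μ : Measure Plane} (hμ : T.IsRegularMeasure G μ) :
    normalDeriv G (fun x => v x - w x) =ᵐ[μ] fun x => normalDeriv G v x - normalDeriv G w x := by
  refine (hv.gradient_sub hw hμ).mono fun x hx => ?_
  simp only [normalDeriv, hx, inner_sub_right]

open Classical in
theorem nonempty_interior_of_mem_ghostPairs (hT : T.IsQuasiUniform κ)
    {P : Finset Plane × Finset Plane} (hP : P ∈ T.ghostPairs G) :
    (interior (hull P.1)).Nonempty ∧ (interior (hull P.2)).Nonempty := by
  have h := (mem_ghostPairs.1 hP).1
  exact ⟨nonempty_interior_hull hT (mem_active.1 h.1).1,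
    nonempty_interior_hull hT (mem_active.1 h.2).1⟩

/-! ### Bilinearity of the discrete form -/

theorem discreteForm_comm : discreteForm G T γ v w = discreteForm G T γ w v := by
  have h1 : (∫ x, ⟪gradient v x, gradient w x⟫ ∂G.vol) = ∫ x, ⟪gradient w x, gradient v x⟫ ∂G.vol :=
    integral_congr_ae (Eventually.of_forall fun x => real_inner_comm _ _)
  have h2 : ghostForm G T γ v w = ghostForm G T γ w v := by
    simp only [ghostForm]
    congr 1
    exact Finset.sum_congr rfl fun P _ => by rw [l2Inner_comm]
  rw [discreteForm, discreteForm, nitscheForm, nitscheForm, h1, h2, l2Inner_comm v w,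
    l2Inner_comm (normalDeriv G v) (normalDeriv G w)]
  ring

theorem IsFitted.ghostForm_sub_left (hT : T.IsFitted G κ) (hv : T.IsDiscrete G v)
    (hw : T.IsDiscrete G w) (hz : T.IsDiscrete G z) :
    ghostForm G T γ (fun x => v x - w x) z = ghostForm G T γ v z - ghostForm G T γ w z := by
  classical
  obtain ⟨g, hg⟩ := hv.exists_cellGrad
  obtain ⟨k, hk⟩ := hw.exists_cellGrad
  obtain ⟨l, hl⟩ := hz.exists_cellGrad
  simp only [ghostForm]
  rw [← mul_sub, ← Finset.sum_sub_distrib]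
  congr 1
  refine Finset.sum_congr rfl fun P hP => ?_
  obtain ⟨h1, h2⟩ := nonempty_interior_of_mem_ghostPairs hT.quasiUniform hP
  obtain ⟨ha, hb⟩ := (mem_ghostPairs.1 hP).1
  have e1 := l2Inner_gradJump h1 h2 ((hg _ ha).sub (hk _ ha)) ((hg _ hb).sub (hk _ hb))
    (hl _ ha) (hl _ hb)
  have e2 := l2Inner_gradJump h1 h2 (hg _ ha) (hg _ hb) (hl _ ha) (hl _ hb)
  have e3 := l2Inner_gradJump h1 h2 (hk _ ha) (hk _ hb) (hl _ ha) (hl _ hb)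
  have e4 : g P.1 - k P.1 - (g P.2 - k P.2) = (g P.1 - g P.2) - (k P.1 - k P.2) := by abel
  rw [e4, inner_sub_left] at e1
  convert_to γ.ghost * T.meshSize * l2Inner (arcLength.restrict (hull (P.1 ∩ P.2)))
    (gradJump P.1 P.2 fun x => v x - w x) (gradJump P.1 P.2 z) =
    γ.ghost * T.meshSize * l2Inner (arcLength.restrict (hull (P.1 ∩ P.2)))
      (gradJump P.1 P.2 v) (gradJump P.1 P.2 z) -
    γ.ghost * T.meshSize * l2Inner (arcLength.restrict (hull (P.1 ∩ P.2)))
      (gradJump P.1 P.2 w) (gradJump P.1 P.2 z) using 3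
  rw [e1, e2, e3]
  ring

theorem IsFitted.discreteForm_sub_left (hT : T.IsFitted G κ) (hv : T.IsDiscrete G v)
    (hw : T.IsDiscrete G w) (hz : T.IsDiscrete G z) :
    discreteForm G T γ (fun x => v x - w x) z = discreteForm G T γ v z - discreteForm G T γ w z := by
  have h1 : (∫ x, ⟪gradient (fun x => v x - w x) x, gradient z x⟫ ∂G.vol) =
      (∫ x, ⟪gradient v x, gradient z x⟫ ∂G.vol) - ∫ x, ⟪gradient w x, gradient z x⟫ ∂G.vol := by
    rw [← integral_sub (integrable_inner_of_memLp (hv.memLp_gradient hT.vol)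
      (hz.memLp_gradient hT.vol)) (integrable_inner_of_memLp (hw.memLp_gradient hT.vol)
      (hz.memLp_gradient hT.vol))]
    refine integral_congr_ae ((hv.gradient_sub hw hT.vol).mono fun x hx => ?_)
    simp only [hx, inner_sub_left]
  have mD := fun {f} (hf : T.IsDiscrete G f) => hf.memLp hT.lenD
  have nD := fun {f} (hf : T.IsDiscrete G f) => hf.memLp_normalDeriv G.lenD_le hT.lenD
  have nN := fun {f} (hf : T.IsDiscrete G f) => hf.memLp_normalDeriv G.lenN_le hT.lenN
  have h2 : l2Inner G.lenD (normalDeriv G fun x => v x - w x) z =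
      l2Inner G.lenD (normalDeriv G v) z - l2Inner G.lenD (normalDeriv G w) z := by
    rw [l2Inner_congr_left (hv.normalDeriv_sub hw hT.lenD), l2Inner_sub_left (nD hv) (nD hw) (mD hz)]
  have h3 := l2Inner_sub_right (mD hv) (mD hw) (nD hz)
  have h4 := l2Inner_sub_left (mD hv) (mD hw) (mD hz)
  have h5 : l2Inner G.lenN (normalDeriv G fun x => v x - w x) (normalDeriv G z) =
      l2Inner G.lenN (normalDeriv G v) (normalDeriv G z) -
        l2Inner G.lenN (normalDeriv G w) (normalDeriv G z) := by
    rw [l2Inner_congr_left (hv.normalDeriv_sub hw hT.lenN), l2Inner_sub_left (nN hv) (nN hw) (nN hz)]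
  simp only [discreteForm, nitscheForm]
  rw [h1, h2, h3, h4, h5, hT.ghostForm_sub_left hv hw hz]
  ring

theorem IsFitted.discreteForm_sub_right (hT : T.IsFitted G κ) (hv : T.IsDiscrete G v)
    (hw : T.IsDiscrete G w) (hz : T.IsDiscrete G z) :
    discreteForm G T γ z (fun x => v x - w x) = discreteForm G T γ z v - discreteForm G T γ z w := by
  rw [discreteForm_comm, hT.discreteForm_sub_left hv hw hz, discreteForm_comm,
    discreteForm_comm (v := w)]

end Triangulation

end

section

namespace Triangulation

variable {U : Set Plane} {T : Triangulation U} {G : MixedDomain} {v : Plane → ℝ} {κ : ℝ}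
  {γ : Penalty} {K K' : Finset Plane} {g : Finset Plane → Plane}

/-! ### Inverse inequality on the boundary -/

theorem disjoint_interior_hull (hK : K ∈ T.elements) (hK' : K' ∈ T.elements) (hne : K ≠ K') :
    Disjoint (interior (hull K)) (interior (hull K')) := by
  rw [disjoint_iff_inter_eq_empty, ← (isOpen_interior.inter isOpen_interior).measure_eq_zero_iff
    volume]
  exact measure_mono_null (inter_subset_inter interior_subset interior_subset)
    (aedisjoint_hull hK hK' hne)

theorem mem_touching_comm (hK : K ∈ T.elements) (h : K' ∈ T.touching K) : K ∈ T.touching K' :=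
  mem_touching.2 ⟨hK, by rw [inter_comm]; exact (mem_touching.1 h).2⟩

/-- After exchanging the sums, each index is counted once per triangle of `t` that touches its own;
touching is symmetric, so the packing bound applies. -/
theorem sum_touching_le (hκ : 0 < κ) (hT : T.IsQuasiUniform κ) {ι : Type*} (s : Finset ι)
    (t : Finset (Finset Plane)) (ht : t ⊆ T.elements) (φ : ι → Finset Plane)
    (hφ : ∀ i ∈ s, φ i ∈ T.elements) {c : ι → ℝ} (hc : ∀ i, 0 ≤ c i) [DecidableEq (Finset Plane)] :
    ∑ K ∈ t, ∑ i ∈ s with φ i ∈ T.touching K, c i ≤ 4 * κ ^ 4 * ∑ i ∈ s, c i := by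
  simp only [Finset.sum_filter]
  rw [Finset.sum_comm, Finset.mul_sum]
  refine Finset.sum_le_sum fun i hi => ?_
  rw [← Finset.sum_filter, Finset.sum_const, nsmul_eq_mul]
  refine mul_le_mul_of_nonneg_right (le_trans ?_ (card_touching_le hκ hT (hφ i hi))) (hc i)
  exact_mod_cast Finset.card_le_card fun K hK => by
    rw [Finset.mem_filter] at hK
    exact mem_touching_comm (ht hK.1) hK.2

open Classical in
/-- The uncut active triangles. -/
noncomputable def uncut (T : Triangulation U) (G : MixedDomain) : Finset (Finset Plane) :=
  (T.active G).filter fun K => K ∉ T.cut G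

theorem mem_uncut : K ∈ T.uncut G ↔ K ∈ T.active G ∧ K ∉ T.cut G := by
  simp [uncut]

/-- `‖∇v‖²` on `D`. -/
noncomputable def gradEnergy (G : MixedDomain) (v : Plane → ℝ) : ℝ :=
  ∫ x, ‖gradient v x‖ ^ 2 ∂G.vol

theorem gradEnergy_nonneg : 0 ≤ gradEnergy G v := integral_nonneg fun x => by positivity

/-- Uncut triangles lie wholly in `D`, have disjoint interiors and area at least of order `h²`, so
the energy in `D` sees their constant gradients in full. For cut triangles this fails. -/
theorem IsFitted.sum_uncut_le (hT : T.IsFitted G κ) (hv : T.IsDiscrete G v)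
    (hg : ∀ K ∈ T.active G, IsCellGrad v K (g K)) :
    (T.meshSize / κ ^ 2) ^ 2 * unitArea * ∑ K ∈ T.uncut G, ‖g K‖ ^ 2 ≤ gradEnergy G v := by
  have hint : Integrable (fun x => ‖gradient v x‖ ^ 2) G.vol :=
    (memLp_two_iff_integrable_sq_norm (hv.memLp_gradient hT.vol).1).1 (hv.memLp_gradient hT.vol)
  have hsub : ∀ K ∈ T.uncut G, interior (hull K) ⊆ G.domain := fun K hK =>
    interior_subset.trans (hull_subset_domain (mem_uncut.1 hK).1 (mem_uncut.1 hK).2)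
  have hel : ∀ K ∈ T.uncut G, K ∈ T.elements := fun K hK =>
    (mem_active.1 (mem_uncut.1 hK).1).1
  calc (T.meshSize / κ ^ 2) ^ 2 * unitArea * ∑ K ∈ T.uncut G, ‖g K‖ ^ 2
      ≤ ∑ K ∈ T.uncut G, ∫ x in interior (hull K), ‖gradient v x‖ ^ 2 := by
        rw [Finset.mul_sum]
        refine Finset.sum_le_sum fun K hK => ?_
        rw [setIntegral_congr_fun isOpen_interior.measurableSet (g := fun _ => ‖g K‖ ^ 2)
          fun x hx => by simp only [(hg K (mem_uncut.1 hK).1).gradient_eq hx],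
          setIntegral_const, smul_eq_mul]
        refine mul_le_mul_of_nonneg_right ?_ (by positivity)
        have h1 := le_volume_hull hT.pos hT.quasiUniform (hel K hK)
        rwa [← measureReal_congr
          (interior_ae_eq_of_null_frontier ((convex_hull K).addHaar_frontier volume))] at h1
    _ = ∫ x in ⋃ K ∈ T.uncut G, interior (hull K), ‖gradient v x‖ ^ 2 := by
        rw [integral_biUnion_finset _ (fun K _ => isOpen_interior.measurableSet)]
        · exact fun K hK K' hK' hne => disjoint_interior_hull (hel K hK) (hel K' hK') hne
        · exact fun K hK => IntegrableOn.mono_set (t := G.domain) hint (hsub K hK)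
    _ ≤ gradEnergy G v :=
        setIntegral_mono_set (t := G.domain) hint
          (Eventually.of_forall fun x => by positivity)
          (LE.le.eventuallyLE (iUnion₂_subset hsub))

open Classical in
-- One factor `h` is the weight of the penalty; the other, with `κ⁻²`, is the least length of a
-- face. The factor `1/2` stems from counting ordered pairs.
theorem IsFitted.sum_jump_le (hT : T.IsFitted G κ) (hγ : 0 ≤ γ.ghost)
    (hg : ∀ K ∈ T.active G, IsCellGrad v K (g K)) :
    γ.ghost * T.meshSize ^ 2 / (2 * κ ^ 2) * ∑ P ∈ T.ghostPairs G, ‖g P.1 - g P.2‖ ^ 2 ≤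
      ghostForm G T γ v v := by
  have hh := hT.meshSize_pos
  rw [ghostForm, Finset.mul_sum, Finset.mul_sum]
  refine Finset.sum_le_sum fun P hP => ?_
  obtain ⟨h1, h2⟩ := nonempty_interior_of_mem_ghostPairs hT.quasiUniform hP
  obtain ⟨⟨ha, hb⟩, hcard, -⟩ := mem_ghostPairs.1 hP
  have e := l2Inner_gradJump h1 h2 (hg _ ha) (hg _ hb) (hg _ ha) (hg _ hb)
  have hn := norm_sub_eq_abs_inner_faceNormal hcard (hg _ ha) (hg _ hb)
  have hlen : T.meshSize / κ ^ 2 ≤ arcLength.real (hull (P.1 ∩ P.2)) := by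
    obtain ⟨a, b, hab, hF⟩ := Finset.card_eq_two.1 hcard
    have haF : a ∈ P.1 ∩ P.2 := by rw [hF]; simp
    have hbF : b ∈ P.1 ∩ P.2 := by rw [hF]; simp
    have hh2 : hull (P.1 ∩ P.2) = hull {a, b} := by rw [hF]
    rw [hh2, measureReal_def, arcLength_hull_pair, edist_dist, ENNReal.toReal_ofReal dist_nonneg]
    exact le_dist_of_mem hT.pos hT.quasiUniform (mem_active.1 ha).1 (Finset.mem_inter.1 haF).1
      (Finset.mem_inter.1 hbF).1 hab
  rw [← sq, ← sq_abs, ← hn] at e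
  calc γ.ghost * T.meshSize ^ 2 / (2 * κ ^ 2) * ‖g P.1 - g P.2‖ ^ 2
      = 1 / 2 * (γ.ghost * T.meshSize * (T.meshSize / κ ^ 2 * ‖g P.1 - g P.2‖ ^ 2)) := by
        have := hT.pos.ne'
        field_simp
    _ ≤ 1 / 2 * (γ.ghost * T.meshSize *
        (arcLength.real (hull (P.1 ∩ P.2)) * ‖g P.1 - g P.2‖ ^ 2)) := by gcongr
    _ = _ := by
        rw [← e]

open Classical in
-- The walk bound is squared and summed, with `ℓ²` sums over touching triangles in place of maxima.
-- In `N³`, two factors come from the length of the walk and one from the overlap of the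
-- neighbourhoods.
theorem IsFitted.sum_cut_le (hT : T.IsFitted G κ) :
    ∑ K ∈ T.cut G, ‖g K‖ ^ 2 ≤
      2 * (4 * κ ^ 4) ^ 3 * ∑ P ∈ T.ghostPairs G, ‖g P.1 - g P.2‖ ^ 2 +
        2 * (4 * κ ^ 4) * ∑ K ∈ T.uncut G, ‖g K‖ ^ 2 := by
  set N : ℝ := 4 * κ ^ 4 with hN
  have hN0 : 0 ≤ N := by positivity
  have hpt : ∀ K ∈ T.cut G, ‖g K‖ ^ 2 ≤
      2 * N ^ 2 * (∑ P ∈ T.ghostPairs G with P.1 ∈ T.touching K, ‖g P.1 - g P.2‖ ^ 2) +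
        2 * ∑ K' ∈ T.uncut G with K' ∈ T.touching K, ‖g K'‖ ^ 2 := by
    intro K hK
    set SJ := ∑ P ∈ T.ghostPairs G with P.1 ∈ T.touching K, ‖g P.1 - g P.2‖ ^ 2 with hSJ
    set SM := ∑ K' ∈ T.uncut G with K' ∈ T.touching K, ‖g K'‖ ^ 2 with hSM
    have hSJ0 : 0 ≤ SJ := Finset.sum_nonneg fun _ _ => by positivity
    have hSM0 : 0 ≤ SM := Finset.sum_nonneg fun _ _ => by positivity
    have h1 := norm_le_of_mem_cut hT.pos hT.quasiUniform hT.domain_subset hT.neighbours (g := g)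
      (Real.sqrt_nonneg SJ) (M := Real.sqrt SM) hK
      (fun K' h1 h2 h3 => Real.le_sqrt_of_sq_le
        (Finset.single_le_sum (f := fun K => ‖g K‖ ^ 2) (fun _ _ => by positivity)
          (Finset.mem_filter.2 ⟨mem_uncut.2 ⟨h1, h2⟩, h3⟩)))
      (fun P h1 h2 => Real.le_sqrt_of_sq_le
        (Finset.single_le_sum (f := fun P : Finset Plane × Finset Plane => ‖g P.1 - g P.2‖ ^ 2)
          (fun _ _ => by positivity) (Finset.mem_filter.2 ⟨h1, h2⟩)))
    calc ‖g K‖ ^ 2 ≤ (N * √SJ + √SM) ^ 2 := by gcongr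
      _ ≤ 2 * (N * √SJ) ^ 2 + 2 * √SM ^ 2 := by nlinarith [sq_nonneg (N * √SJ - √SM)]
      _ = _ := by rw [mul_pow, Real.sq_sqrt hSJ0, Real.sq_sqrt hSM0]; ring
  have hcut : T.cut G ⊆ T.elements := fun K hK => (mem_cut.1 hK).1
  have hs1 := sum_touching_le hT.pos hT.quasiUniform (T.ghostPairs G) (T.cut G) hcut
    (fun P => P.1) (fun P hP => (mem_active.1 (mem_ghostPairs.1 hP).1.1).1)
    (c := fun P => ‖g P.1 - g P.2‖ ^ 2) (fun _ => by positivity)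
  have hs2 := sum_touching_le hT.pos hT.quasiUniform (T.uncut G) (T.cut G) hcut
    (fun K => K) (fun K hK => (mem_active.1 (mem_uncut.1 hK).1).1)
    (c := fun K => ‖g K‖ ^ 2) (fun _ => by positivity)
  rw [← hN] at hs1 hs2
  refine (Finset.sum_le_sum hpt).trans ?_
  rw [Finset.sum_add_distrib, ← Finset.mul_sum, ← Finset.mul_sum]
  calc _ ≤ 2 * N ^ 2 * (N * ∑ P ∈ T.ghostPairs G, ‖g P.1 - g P.2‖ ^ 2) +
        2 * (N * ∑ K ∈ T.uncut G, ‖g K‖ ^ 2) := by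
        gcongr
    _ = _ := by ring

/-- On the part of `Γ` in `K` the normal derivative is at most `‖g K‖`, and this part has length at
most `C h` by Ahlfors regularity. -/
theorem IsFitted.boundary_le_sum_cut (hT : T.IsFitted G κ) (hv : T.IsDiscrete G v)
    (hg : ∀ K ∈ T.active G, IsCellGrad v K (g K)) {C : ℝ≥0}
    (hC : ∀ A, arcLength (frontier G.domain ∩ A) ≤ C * Metric.ediam A) :
    l2Inner G.lenB (normalDeriv G v) (normalDeriv G v) ≤
      C * T.meshSize * ∑ K ∈ T.cut G, ‖g K‖ ^ 2 := by
  have hn := hv.memLp_normalDeriv le_rfl hT.lenB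
  have hlen : ∀ K ∈ T.cut G, G.lenB.real (hull K) ≤ C * T.meshSize := by
    intro K hK
    have h1 := hC (hull K)
    rw [inter_comm] at h1
    have h2 := ENNReal.toReal_mono (ENNReal.mul_ne_top ENNReal.coe_ne_top
      (Bornology.IsBounded.ediam_ne_top (isCompact_hull K).isBounded)) h1
    rw [ENNReal.toReal_mul] at h2
    rw [measureReal_def, MixedDomain.lenB, Measure.restrict_apply (isClosed_hull K).measurableSet]
    refine h2.trans ?_
    exact mul_le_mul_of_nonneg_left (diam_hull_le_meshSize (mem_cut.1 hK).1) C.2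
  have hi : ∀ K ∈ T.cut G,
      Integrable ((hull K).indicator fun _ => ‖g K‖ ^ 2) G.lenB := fun K _ =>
    (integrable_const _).indicator (isClosed_hull K).measurableSet
  calc l2Inner G.lenB (normalDeriv G v) (normalDeriv G v)
      ≤ ∫ x, ∑ K ∈ T.cut G, (hull K).indicator (fun _ => ‖g K‖ ^ 2) x ∂G.lenB := by
        refine integral_mono_ae (integrable_mul_of_memLp hn hn) (integrable_finsetSum _ hi) ?_
        filter_upwards [ae_arcLength_mem_interior hT.frontier_subset hT.resolved,
          G.ae_norm_normal_le] with x ⟨K, hK, hKc, hx⟩ hnx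
        have h1 : |normalDeriv G v x| ≤ ‖g K‖ := by
          rw [normalDeriv, (hg K hK).gradient_eq hx]
          exact (abs_real_inner_le_norm _ _).trans (mul_le_of_le_one_left (norm_nonneg _) hnx)
        calc normalDeriv G v x * normalDeriv G v x = |normalDeriv G v x| ^ 2 := by
              rw [sq_abs, sq]
          _ ≤ ‖g K‖ ^ 2 := by gcongr
          _ = (hull K).indicator (fun _ => ‖g K‖ ^ 2) x :=
              (indicator_of_mem (interior_subset hx) (fun _ => ‖g K‖ ^ 2)).symm
          _ ≤ _ := Finset.single_le_sum
              (f := fun K => (hull K).indicator (fun _ => ‖g K‖ ^ 2) x)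
              (fun K _ => indicator_nonneg (fun _ _ => by positivity) _) hKc
    _ = ∑ K ∈ T.cut G, G.lenB.real (hull K) * ‖g K‖ ^ 2 := by
        rw [integral_finsetSum _ hi]
        refine Finset.sum_congr rfl fun K _ => ?_
        rw [integral_indicator (isClosed_hull K).measurableSet, setIntegral_const, smul_eq_mul]
    _ ≤ ∑ K ∈ T.cut G, C * T.meshSize * ‖g K‖ ^ 2 :=
        Finset.sum_le_sum fun K hK => mul_le_mul_of_nonneg_right (hlen K hK) (by positivity)
    _ = _ := by rw [Finset.mul_sum]

theorem IsFitted.ghostForm_nonneg (hT : T.IsFitted G κ) (hγ : 0 ≤ γ.ghost)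
    (hv : T.IsDiscrete G v) : 0 ≤ ghostForm G T γ v v := by
  classical
  obtain ⟨g, hg⟩ := hv.exists_cellGrad
  refine le_trans ?_ (hT.sum_jump_le hγ hg)
  exact mul_nonneg (by positivity) (Finset.sum_nonneg fun _ _ => by positivity)

/-- The normal derivative of discrete functions on the whole boundary is controlled by the energy
and the ghost penalty, independently of the position of the boundary in the mesh. -/
theorem exists_boundary_le (G : MixedDomain) (hκ : 0 < κ) {γ₁ : ℝ} (hγ₁ : 0 < γ₁) :
    ∃ C : ℝ, 0 < C ∧ ∀ (U : Set Plane) (T : Triangulation U), T.IsFitted G κ →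
      ∀ γ : Penalty, γ.ghost = γ₁ → ∀ v, T.IsDiscrete G v →
        T.meshSize * l2Inner G.lenB (normalDeriv G v) (normalDeriv G v) ≤
          C * (gradEnergy G v + ghostForm G T γ v v) := by
  classical
  obtain ⟨C₀, hC₀⟩ := G.isLipschitz.exists_arcLength_inter_le
  have hω := unitArea_pos
  set a : ℝ := 2 * (4 * κ ^ 4) ^ 3 * (2 * κ ^ 2 / γ₁) with ha
  set b : ℝ := 2 * (4 * κ ^ 4) * (κ ^ 4 / unitArea) with hb
  have ha0 : 0 < a := by positivity
  have hb0 : 0 < b := by positivity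
  -- `a` and `b` collect the factors of the jump part and of the uncut part; `C₀` may be zero, hence
  -- `C₀ + 1`.
  refine ⟨(C₀ + 1) * (a + b), by positivity, fun U T hT γ hγ v hv => ?_⟩
  subst hγ
  obtain ⟨g, hg⟩ := hv.exists_cellGrad
  have hh := hT.meshSize_pos
  have h1 := hT.boundary_le_sum_cut hv hg hC₀
  have h2 := hT.sum_cut_le (g := g)
  have h3 := hT.sum_jump_le hγ₁.le hg
  have h4 := hT.sum_uncut_le hv hg
  have hE : 0 ≤ gradEnergy G v := gradEnergy_nonneg
  have hJ := hT.ghostForm_nonneg hγ₁.le hv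
  set SP := ∑ P ∈ T.ghostPairs G, ‖g P.1 - g P.2‖ ^ 2
  set SU := ∑ K ∈ T.uncut G, ‖g K‖ ^ 2
  set SC := ∑ K ∈ T.cut G, ‖g K‖ ^ 2
  have h5 : T.meshSize ^ 2 * SP ≤ 2 * κ ^ 2 / γ.ghost * ghostForm G T γ v v := by
    calc T.meshSize ^ 2 * SP =
        2 * κ ^ 2 / γ.ghost * (γ.ghost * T.meshSize ^ 2 / (2 * κ ^ 2) * SP) := by
          have := hκ.ne'; have := hγ₁.ne'
          field_simp
      _ ≤ _ := by gcongr
  have h6 : T.meshSize ^ 2 * SU ≤ κ ^ 4 / unitArea * gradEnergy G v := by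
    calc T.meshSize ^ 2 * SU =
        κ ^ 4 / unitArea * ((T.meshSize / κ ^ 2) ^ 2 * unitArea * SU) := by
          have := hκ.ne'; have := hω.ne'
          field_simp
      _ ≤ _ := by gcongr
  calc T.meshSize * l2Inner G.lenB (normalDeriv G v) (normalDeriv G v)
      ≤ T.meshSize * (C₀ * T.meshSize * SC) := by gcongr
    _ = C₀ * (T.meshSize ^ 2 * SC) := by ring
    _ ≤ C₀ * (T.meshSize ^ 2 * (2 * (4 * κ ^ 4) ^ 3 * SP + 2 * (4 * κ ^ 4) * SU)) := by gcongr
    _ = C₀ * (2 * (4 * κ ^ 4) ^ 3 * (T.meshSize ^ 2 * SP) +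
          2 * (4 * κ ^ 4) * (T.meshSize ^ 2 * SU)) := by ring
    _ ≤ C₀ * (2 * (4 * κ ^ 4) ^ 3 * (2 * κ ^ 2 / γ.ghost * ghostForm G T γ v v) +
          2 * (4 * κ ^ 4) * (κ ^ 4 / unitArea * gradEnergy G v)) := by gcongr
    _ = C₀ * (a * ghostForm G T γ v v + b * gradEnergy G v) := by rw [ha, hb]; ring
    _ ≤ (C₀ + 1) * ((a + b) * ghostForm G T γ v v + (a + b) * gradEnergy G v) := by
        gcongr
        · linarith
        · linarith
        · linarith
    _ = _ := by ring

end Triangulation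

end

section

namespace Triangulation

variable {U : Set Plane} {T : Triangulation U} {G : MixedDomain} {v : Plane → ℝ} {κ : ℝ}
  {γ : Penalty}

/-! ### Coercivity -/

/-- The square of `|||v|||_*` for a discrete function `v`. -/
noncomputable def starSq (G : MixedDomain) (T : Triangulation U) (γ : Penalty) (v : Plane → ℝ) :
    ℝ :=
  gradEnergy G v + T.meshSize * l2Inner G.lenN (normalDeriv G v) (normalDeriv G v) +
    γ.dir * T.meshSize⁻¹ * l2Inner G.lenD v v

/-- The constant is that of `IsLipschitzDomain.isControlled`, fixed before any mesh is chosen;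
discrete functions enter only through `IsDiscrete.lineControl`. -/
theorem exists_friedrichs (G : MixedDomain) (κ : ℝ) :
    ∃ C : ℝ, 0 ≤ C ∧ ∀ (U : Set Plane) (T : Triangulation U), T.IsFitted G κ →
      ∀ v, T.IsDiscrete G v →
        l2Inner G.vol v v ≤ C * (gradEnergy G v + l2Inner G.lenD v v) := by
  obtain ⟨C, hC⟩ := G.isLipschitz.isControlled G.measurable_dirichlet
    (G.union_eq ▸ subset_union_left) G.dirichlet_pos.ne'
  refine ⟨C, C.2, fun U T hT v hv => ?_⟩
  have h := hC _ _ (hv.lineControl hT.domain_subset)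
  have hcl : ∀ x ∈ closure G.domain, (T.extended G).indicator v x = v x := fun x hx =>
    indicator_of_mem (closure_subset_extended hT.domain_subset hx) v
  have e1 : ∫⁻ x in G.domain, ‖(T.extended G).indicator v x‖ₑ ^ 2 = ∫⁻ x, ‖v x‖ₑ ^ 2 ∂G.vol :=
    setLIntegral_congr_fun G.isLipschitz.1.measurableSet fun x hx => by
      simp only [hcl x (subset_closure hx)]
  have hsub : G.dirichlet ⊆ closure G.domain :=
    (G.union_eq ▸ subset_union_left : G.dirichlet ⊆ frontier G.domain).trans frontier_subset_closure
  have e2 : ∫⁻ x in G.dirichlet, ‖(T.extended G).indicator v x‖ₑ ^ 2 ∂arcLength =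
      ∫⁻ x, ‖v x‖ₑ ^ 2 ∂G.lenD :=
    setLIntegral_congr_fun G.measurable_dirichlet fun x hx => by simp only [hcl x (hsub hx)]
  have e3 : ∫⁻ x in G.domain, ‖gradient v x‖ₑ ^ 2 = ENNReal.ofReal (gradEnergy G v) :=
    lintegral_enorm_sq (μ := G.vol) (hv.memLp_gradient hT.vol)
  rw [e1, e2, e3, lintegral_enorm_sq (hv.memLp hT.vol), lintegral_enorm_sq (hv.memLp hT.lenD),
    ← l2Inner_self_eq_integral_norm_sq, ← l2Inner_self_eq_integral_norm_sq,
    ← ENNReal.ofReal_add gradEnergy_nonneg (l2Inner_self_nonneg _), ← ENNReal.ofReal_coe_nnreal,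
    ← ENNReal.ofReal_mul C.coe_nonneg] at h
  exact (ENNReal.ofReal_le_ofReal_iff (mul_nonneg C.coe_nonneg
    (add_nonneg gradEnergy_nonneg (l2Inner_self_nonneg _)))).1 h

/-- Coercivity. The inverse inequality is used twice: on `Γ_D` to absorb the cross term, and on
`Γ_N` to recover the Neumann part of the norm, so that `γ_N = 0` is allowed. -/
theorem IsFitted.starSq_le (hT : T.IsFitted G κ) (hγ₁ : 0 ≤ γ.ghost) (hγN : 0 ≤ γ.neu)
    {C : ℝ} (hC : 0 < C) (hv : T.IsDiscrete G v)
    (hinv : T.meshSize * l2Inner G.lenB (normalDeriv G v) (normalDeriv G v) ≤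
      C * (gradEnergy G v + ghostForm G T γ v v)) (hγD : 4 * C ≤ γ.dir) :
    starSq G T γ v ≤ 2 * (1 + C) * discreteForm G T γ v v := by
  have hh := hT.meshSize_pos
  have hE : 0 ≤ gradEnergy G v := gradEnergy_nonneg
  have hJ := hT.ghostForm_nonneg hγ₁ hv
  have hnB := hv.memLp_normalDeriv le_rfl hT.lenB
  have hD := l2Inner_self_mono G.lenD_le hnB
  have hN := l2Inner_self_mono G.lenN_le hnB
  have hND : 0 ≤ l2Inner G.lenD (normalDeriv G v) (normalDeriv G v) := l2Inner_self_nonneg _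
  have hNN : 0 ≤ l2Inner G.lenN (normalDeriv G v) (normalDeriv G v) := l2Inner_self_nonneg _
  have hV : 0 ≤ l2Inner G.lenD v v := l2Inner_self_nonneg _
  -- With the weight `h / (2C)` one part is half of energy plus ghost penalty; the other, `2C h⁻¹
  -- ‖v‖²` on `Γ_D`, is at most half of the penalty term because `γ_D ≥ 4C`.
  have hcross := two_mul_l2Inner_le (hv.memLp_normalDeriv G.lenD_le hT.lenD) (hv.memLp hT.lenD)
    (c := T.meshSize / (2 * C)) (by positivity)
  have hgrad : (∫ x, ⟪gradient v x, gradient v x⟫ ∂G.vol) = gradEnergy G v := by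
    simp only [gradEnergy, real_inner_self_eq_norm_sq]
  have hA : discreteForm G T γ v v = gradEnergy G v -
      2 * l2Inner G.lenD (normalDeriv G v) v + γ.dir * T.meshSize⁻¹ * l2Inner G.lenD v v +
      γ.neu * T.meshSize * l2Inner G.lenN (normalDeriv G v) (normalDeriv G v) +
      ghostForm G T γ v v := by
    rw [discreteForm, nitscheForm, hgrad]; ring
  have h1 : T.meshSize / (2 * C) * l2Inner G.lenD (normalDeriv G v) (normalDeriv G v) ≤
      1 / 2 * (gradEnergy G v + ghostForm G T γ v v) := by
    calc _ = 1 / (2 * C) *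
          (T.meshSize * l2Inner G.lenD (normalDeriv G v) (normalDeriv G v)) := by ring
      _ ≤ 1 / (2 * C) * (C * (gradEnergy G v + ghostForm G T γ v v)) := by
        refine mul_le_mul_of_nonneg_left (le_trans ?_ hinv) (by positivity)
        gcongr
      _ = _ := by field_simp
  have h2 : T.meshSize * l2Inner G.lenN (normalDeriv G v) (normalDeriv G v) ≤
      C * (gradEnergy G v + ghostForm G T γ v v) :=
    le_trans (by gcongr) hinv
  have h3 : (T.meshSize / (2 * C))⁻¹ * l2Inner G.lenD v v ≤
      1 / 2 * (γ.dir * T.meshSize⁻¹ * l2Inner G.lenD v v) := by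
    have : (T.meshSize / (2 * C))⁻¹ = 1 / 2 * (4 * C * T.meshSize⁻¹) := by
      field_simp; norm_num
    rw [this, mul_assoc]
    gcongr
  have h4 : 0 ≤ γ.neu * T.meshSize * l2Inner G.lenN (normalDeriv G v) (normalDeriv G v) := by
    positivity
  have h5 : 0 ≤ γ.dir * T.meshSize⁻¹ * l2Inner G.lenD v v := by
    have : 0 ≤ γ.dir := le_trans (by positivity) hγD
    positivity
  have h6 : gradEnergy G v + ghostForm G T γ v v + γ.dir * T.meshSize⁻¹ * l2Inner G.lenD v v ≤
      2 * discreteForm G T γ v v := by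
    rw [hA]; linarith
  rw [starSq]
  calc _ ≤ (1 + C) * (gradEnergy G v + ghostForm G T γ v v +
        γ.dir * T.meshSize⁻¹ * l2Inner G.lenD v v) := by nlinarith
    _ ≤ (1 + C) * (2 * discreteForm G T γ v v) := by gcongr
    _ = _ := by ring

theorem starSq_nonneg (hh : 0 ≤ T.meshSize) (hγD : 0 ≤ γ.dir) : 0 ≤ starSq G T γ v := by
  have hE : 0 ≤ gradEnergy G v := gradEnergy_nonneg
  have hNN : 0 ≤ l2Inner G.lenN (normalDeriv G v) (normalDeriv G v) := l2Inner_self_nonneg _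
  have hV : 0 ≤ l2Inner G.lenD v v := l2Inner_self_nonneg _
  rw [starSq]
  positivity

/-- Stability of the discrete problem: the solution for a right hand side `r ∈ L²(D)` is bounded
by `‖r‖`, uniformly in the mesh. -/
theorem exists_stability (G : MixedDomain) (U : Set Plane) (hκ : 0 < κ) {γ₁ : ℝ} (hγ₁ : 0 < γ₁) :
    ∃ γ₀ : ℝ, 0 < γ₀ ∧ ∀ γD γN : ℝ, γ₀ ≤ γD → 0 ≤ γN →
      ∃ C : ℝ, 0 < C ∧ ∀ T : Triangulation U, T.IsFitted G κ →
        ∀ v r, T.IsDiscrete G v → MemLp r 2 G.vol →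
          discreteForm G T ⟨γD, γN, γ₁⟩ v v = l2Inner G.vol r v →
          l2Norm G.vol v ≤ C * l2Norm G.vol r ∧
            √(starSq G T ⟨γD, γN, γ₁⟩ v) ≤ C * l2Norm G.vol r := by
  obtain ⟨CI, hCI, hinv⟩ := exists_boundary_le G hκ hγ₁
  obtain ⟨CP, hCP, hfr⟩ := exists_friedrichs G κ
  refine ⟨4 * CI, by positivity, fun γD γN hγD hγN => ?_⟩
  have hγD0 : 0 < γD := lt_of_lt_of_le (by positivity) hγD
  -- Since `h ≤ H`, the weighted norm `γ_D h⁻¹ ‖v‖²` controls `‖v‖²` on `Γ_D` with a constant free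
  -- of `h`.
  set H := Metric.diam (closure U) with hH
  have hH0 : 0 ≤ H := Metric.diam_nonneg
  set C₁ : ℝ := 2 * (1 + CI) with hC₁
  set C₂ : ℝ := CP * (1 + H / γD) with hC₂
  have hC₁0 : 0 < C₁ := by positivity
  have hC₂0 : 0 ≤ C₂ := by positivity
  -- This dominates both `C₁ C₂`, for the `L²` norm, and the square root of `C₁² C₂`, for the star
  -- norm.
  refine ⟨C₁ * (C₂ + 1), by positivity, fun T hT v r hv hr hvr => ?_⟩
  set γ : Penalty := ⟨γD, γN, γ₁⟩ with hγ
  have hh := hT.meshSize_pos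
  have hS0 : 0 ≤ starSq G T γ v := starSq_nonneg hh.le hγD0.le
  have hS := hT.starSq_le (γ := γ) hγ₁.le hγN hCI hv (hinv U T hT γ rfl v hv) hγD
  have hV := hv.memLp hT.vol
  have hA : discreteForm G T γ v v ≤ l2Norm G.vol r * l2Norm G.vol v := by
    rw [hvr]; exact (abs_le.1 (abs_l2Inner_le hr hV)).2
  have hS2 : starSq G T γ v ≤ C₁ * (l2Norm G.vol r * l2Norm G.vol v) :=
    hS.trans (by gcongr)
  have hE : 0 ≤ gradEnergy G v := gradEnergy_nonneg
  have hNN : 0 ≤ l2Inner G.lenN (normalDeriv G v) (normalDeriv G v) := l2Inner_self_nonneg _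
  have hVD : 0 ≤ l2Inner G.lenD v v := l2Inner_self_nonneg _
  have hle : gradEnergy G v + l2Inner G.lenD v v ≤ (1 + H / γD) * starSq G T γ v := by
    have hhH : T.meshSize ≤ H := meshSize_le (elements_nonempty hT.domain_subset)
    have h1 : gradEnergy G v ≤ starSq G T γ v := by
      rw [starSq]
      have : 0 ≤ γ.dir * T.meshSize⁻¹ * l2Inner G.lenD v v := by positivity
      have : 0 ≤ T.meshSize * l2Inner G.lenN (normalDeriv G v) (normalDeriv G v) := by positivity
      linarith
    have h2 : γD * T.meshSize⁻¹ * l2Inner G.lenD v v ≤ starSq G T γ v := by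
      rw [starSq]
      have : 0 ≤ T.meshSize * l2Inner G.lenN (normalDeriv G v) (normalDeriv G v) := by positivity
      linarith
    have h3 : l2Inner G.lenD v v ≤ H / γD * starSq G T γ v := by
      calc l2Inner G.lenD v v
          = T.meshSize / γD * (γD * T.meshSize⁻¹ * l2Inner G.lenD v v) := by
            have := hh.ne'; have := hγD0.ne'
            field_simp
        _ ≤ H / γD * starSq G T γ v := by gcongr
    linarith
  have hV2 : l2Norm G.vol v ^ 2 ≤ C₂ * starSq G T γ v := by
    rw [l2Norm_sq, hC₂, mul_assoc]
    exact (hfr U T hT v hv).trans (by gcongr)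
  have hr0 : 0 ≤ l2Norm G.vol r := l2Norm_nonneg _
  have hv0 : 0 ≤ l2Norm G.vol v := l2Norm_nonneg _
  have hvle : l2Norm G.vol v ≤ C₂ * C₁ * l2Norm G.vol r := by
    rcases hv0.eq_or_lt with h0 | hpos
    · rw [← h0]; positivity
    · refine le_of_mul_le_mul_right ?_ hpos
      calc l2Norm G.vol v * l2Norm G.vol v = l2Norm G.vol v ^ 2 := (sq _).symm
        _ ≤ C₂ * (C₁ * (l2Norm G.vol r * l2Norm G.vol v)) := hV2.trans (by gcongr)
        _ = _ := by ring
  refine ⟨hvle.trans ?_, ?_⟩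
  · refine mul_le_mul_of_nonneg_right ?_ hr0
    nlinarith
  · refine Real.sqrt_le_iff.2 ⟨by positivity, hS2.trans ?_⟩
    calc C₁ * (l2Norm G.vol r * l2Norm G.vol v)
        ≤ C₁ * (l2Norm G.vol r * (C₂ * C₁ * l2Norm G.vol r)) := by gcongr
      _ = C₁ ^ 2 * C₂ * l2Norm G.vol r ^ 2 := by ring
      _ ≤ C₁ ^ 2 * (C₂ + 1) ^ 2 * l2Norm G.vol r ^ 2 := by
        gcongr
        nlinarith
      _ = _ := by ring

/-! ### The error in the star norm -/

/-- The chosen gradient is square integrable by definition and the default value is zero. The same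
applies to traces, so no trace theorem enters. -/
theorem memLp_weakGrad (D : Set Plane) (y : Plane → ℝ) :
    MemLp (weakGrad D y) 2 (volume.restrict D) := by
  rw [weakGrad]
  split_ifs with h
  · exact h.choose_spec.2.1
  · exact MemLp.zero

theorem memLp_trace (D : Set Plane) (y : Plane → ℝ) :
    MemLp (trace D y) 2 (arcLength.restrict (frontier D)) := by
  rw [trace]
  split_ifs with h
  · exact h.choose_spec.2.1
  · exact MemLp.zero

theorem memLp_gradTrace (D : Set Plane) (y : Plane → ℝ) :
    MemLp (gradTrace D y) 2 (arcLength.restrict (frontier D)) := by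
  refine MemLp.of_eval_piLp fun i => ?_
  exact memLp_trace D _

theorem integral_norm_sq_sub_le {E : Type*} [NormedAddCommGroup E] {μ : Measure Plane}
    {a b c : Plane → E} (h1 : MemLp (fun x => a x - b x) 2 μ) (h2 : MemLp (fun x => b x - c x) 2 μ) :
    ∫ x, ‖a x - c x‖ ^ 2 ∂μ ≤
      2 * (∫ x, ‖a x - b x‖ ^ 2 ∂μ) + 2 * ∫ x, ‖b x - c x‖ ^ 2 ∂μ := by
  have i1 := (memLp_two_iff_integrable_sq_norm h1.1).1 h1
  have i2 := (memLp_two_iff_integrable_sq_norm h2.1).1 h2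
  rw [← integral_const_mul, ← integral_const_mul,
    ← integral_add (i1.const_mul 2) (i2.const_mul 2)]
  -- In this form the left integrand need not be shown integrable.
  refine integral_mono_of_nonneg (Eventually.of_forall fun x => by positivity)
    ((i1.const_mul 2).add (i2.const_mul 2)) (Eventually.of_forall fun x => ?_)
  have h := norm_sub_le_norm_sub_add_norm_sub (a x) (b x) (c x)
  have h3 : ‖a x - c x‖ ^ 2 ≤ (‖a x - b x‖ + ‖b x - c x‖) ^ 2 := by gcongr
  simp only
  nlinarith [sq_nonneg (‖a x - b x‖ - ‖b x - c x‖)]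

/-- A triangle inequality with a crude constant: each of the three squared terms is split with a
factor two, and `√(2X + 2S) ≤ 2 (√X + √S)`. -/
theorem IsFitted.starError_le (hT : T.IsFitted G κ) (hγD : 0 ≤ γ.dir) {y v w : Plane → ℝ}
    (hv : T.IsDiscrete G v) (hw : T.IsDiscrete G w) :
    starError G T γ y w ≤ 2 * (starError G T γ y v + √(starSq G T γ fun x => v x - w x)) := by
  have hh := hT.meshSize_pos
  have gV := hv.memLp_gradient hT.vol
  have gW := hw.memLp_gradient hT.vol
  have a1 : ∫ x, ‖weakGrad G.domain y x - gradient w x‖ ^ 2 ∂G.vol ≤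
      2 * (∫ x, ‖weakGrad G.domain y x - gradient v x‖ ^ 2 ∂G.vol) +
        2 * gradEnergy G fun x => v x - w x := by
    refine (integral_norm_sq_sub_le (b := gradient v) ((memLp_weakGrad G.domain y).sub gV)
      (gV.sub gW)).trans (le_of_eq ?_)
    congr 2
    exact integral_congr_ae ((hv.gradient_sub hw hT.vol).mono fun x hx => by simp only [hx])
  have gT : MemLp (gradTrace G.domain y) 2 G.lenN :=
    (memLp_gradTrace G.domain y).mono_measure G.lenN_le
  have hNv := MixedDomain.memLp_inner_normal G.lenN_le (gT.sub (hv.memLp_gradient hT.lenN))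
  have a2 : l2Inner G.lenN (fun x => ⟪G.normal x, gradTrace G.domain y x - gradient w x⟫)
      (fun x => ⟪G.normal x, gradTrace G.domain y x - gradient w x⟫) ≤
      2 * l2Inner G.lenN (fun x => ⟪G.normal x, gradTrace G.domain y x - gradient v x⟫)
        (fun x => ⟪G.normal x, gradTrace G.domain y x - gradient v x⟫) +
      2 * l2Inner G.lenN (normalDeriv G fun x => v x - w x)
        (normalDeriv G fun x => v x - w x) := by
    have nT := MixedDomain.memLp_inner_normal G.lenN_le gT
    have nV := hv.memLp_normalDeriv G.lenN_le hT.lenN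
    have nW := hw.memLp_normalDeriv G.lenN_le hT.lenN
    have h := integral_norm_sq_sub_le (b := normalDeriv G v) (nT.sub nV) (nV.sub nW)
    have e1 : l2Inner G.lenN (normalDeriv G fun x => v x - w x)
        (normalDeriv G fun x => v x - w x) =
        ∫ x, ‖normalDeriv G v x - normalDeriv G w x‖ ^ 2 ∂G.lenN := by
      rw [l2Inner_self_eq_integral_norm_sq]
      exact integral_congr_ae ((hv.normalDeriv_sub hw hT.lenN).mono fun x hx => by simp only [hx])
    rw [e1, l2Inner_self_eq_integral_norm_sq, l2Inner_self_eq_integral_norm_sq]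
    simp only [inner_sub_right]
    exact h
  have tT : MemLp (trace G.domain y) 2 G.lenD :=
    (memLp_trace G.domain y).mono_measure G.lenD_le
  have a3 : l2Inner G.lenD (fun x => trace G.domain y x - w x)
      (fun x => trace G.domain y x - w x) ≤
      2 * l2Inner G.lenD (fun x => trace G.domain y x - v x)
        (fun x => trace G.domain y x - v x) +
      2 * l2Inner G.lenD (fun x => v x - w x) (fun x => v x - w x) := by
    simp only [l2Inner_self_eq_integral_norm_sq]
    exact integral_norm_sq_sub_le (tT.sub (hv.memLp hT.lenD))
      ((hv.memLp hT.lenD).sub (hw.memLp hT.lenD))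
  have hS0 : 0 ≤ starSq G T γ fun x => v x - w x := starSq_nonneg hh.le hγD
  rw [starError, starError]
  simp only [l2Norm_sq]
  set X := (∫ x, ‖weakGrad G.domain y x - gradient v x‖ ^ 2 ∂G.vol) +
    T.meshSize * l2Inner G.lenN (fun x => ⟪G.normal x, gradTrace G.domain y x - gradient v x⟫)
      (fun x => ⟪G.normal x, gradTrace G.domain y x - gradient v x⟫) +
    γ.dir * T.meshSize⁻¹ * l2Inner G.lenD (fun x => trace G.domain y x - v x)
      (fun x => trace G.domain y x - v x) with hX
  set S := starSq G T γ fun x => v x - w x with hS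
  have hX0 : 0 ≤ X := by
    have h1 : 0 ≤ ∫ x, ‖weakGrad G.domain y x - gradient v x‖ ^ 2 ∂G.vol :=
      integral_nonneg fun x => by positivity
    have h2 := l2Inner_self_nonneg (μ := G.lenN)
      (fun x => ⟪G.normal x, gradTrace G.domain y x - gradient v x⟫)
    have h3 := l2Inner_self_nonneg (μ := G.lenD) (fun x => trace G.domain y x - v x)
    rw [hX]
    positivity
  refine Real.sqrt_le_iff.2 ⟨by positivity, ?_⟩
  have hb : (∫ x, ‖weakGrad G.domain y x - gradient w x‖ ^ 2 ∂G.vol) +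
      T.meshSize * l2Inner G.lenN (fun x => ⟪G.normal x, gradTrace G.domain y x - gradient w x⟫)
        (fun x => ⟪G.normal x, gradTrace G.domain y x - gradient w x⟫) +
      γ.dir * T.meshSize⁻¹ * l2Inner G.lenD (fun x => trace G.domain y x - w x)
        (fun x => trace G.domain y x - w x) ≤ 2 * X + 2 * S := by
    have b2 := mul_le_mul_of_nonneg_left a2 hh.le
    have b3 := mul_le_mul_of_nonneg_left a3 (mul_nonneg hγD (inv_nonneg.2 hh.le))
    rw [hX, hS, starSq]
    linarith
  have s1 := Real.sq_sqrt hX0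
  have s2 := Real.sq_sqrt hS0
  nlinarith [mul_nonneg (Real.sqrt_nonneg X) (Real.sqrt_nonneg S)]

end Triangulation

/-! ### The optimality systems -/

section Optimality

open Triangulation

variable {U : Set Plane} {T : Triangulation U} {G : MixedDomain} {κ α : ℝ} {γ : Penalty}
  {f gD gN yd y p u yh ph uh ya pa v : Plane → ℝ}

/-- The load `L_h` is common to both problems and cancels; in the adjoint version below, `y_d` does.
-/
theorem IsAuxiliary.state_sub (hT : T.IsFitted G κ) (ha : IsAuxiliary G T γ f gD gN yd y u ya pa)
    (hd : IsDiscreteOptimal G T γ α f gD gN yd yh ph uh) (hu : MemLp u 2 G.vol)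
    (hv : T.IsDiscrete G v) :
    discreteForm G T γ (fun x => ya x - yh x) v = l2Inner G.vol (fun x => u x - uh x) v := by
  rw [hT.discreteForm_sub_left ha.state_mem hd.state_mem hv, ha.state_eq v hv, hd.state_eq v hv,
    l2Inner_sub_left hu hd.control_mem (hv.memLp hT.vol)]
  ring

theorem IsAuxiliary.adjoint_sub (hT : T.IsFitted G κ)
    (ha : IsAuxiliary G T γ f gD gN yd y u ya pa)
    (hd : IsDiscreteOptimal G T γ α f gD gN yd yh ph uh) (hy : MemLp y 2 G.vol)
    (hyd : MemLp yd 2 G.vol) (hv : T.IsDiscrete G v) :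
    discreteForm G T γ v (fun x => pa x - ph x) = l2Inner G.vol (fun x => y x - yh x) v := by
  have hyh := hd.state_mem.memLp hT.vol
  have hvm := hv.memLp hT.vol
  rw [hT.discreteForm_sub_right ha.adjoint_mem hd.adjoint_mem hv, ha.adjoint_eq v hv,
    hd.adjoint_eq v hv, l2Inner_sub_left hy hyd hvm, l2Inner_sub_left hyh hyd hvm,
    l2Inner_sub_left hy hyh hvm]
  ring

theorem IsOptimal.memLp_state (h : IsOptimal G α f gD gN yd y p u) : MemLp y 2 G.vol := by
  obtain ⟨F, hF⟩ := h.state_mem.1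
  exact hF.1

theorem IsOptimal.memLp_adjoint (h : IsOptimal G α f gD gN yd y p u) : MemLp p 2 G.vol := by
  obtain ⟨F, hF⟩ := h.adjoint_mem.1
  exact hF.1

/-- The two error equations, tested crosswise, have the same left side `A_h(y^h - y_h, p^h - p_h)`;
equating their right sides replaces the adjoint difference in the control identity by state errors.
-/
theorem control_error_le (hT : T.IsFitted G κ) (hα : 0 < α) (hyd : MemLp yd 2 G.vol)
    (hc : IsOptimal G α f gD gN yd y p u)
    (hd : IsDiscreteOptimal G T γ α f gD gN yd yh ph uh)
    (ha : IsAuxiliary G T γ f gD gN yd y u ya pa) :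
    α * l2Norm G.vol (fun x => u x - uh x) ^ 2 + l2Norm G.vol (fun x => y x - yh x) ^ 2 ≤
      1 / α * l2Norm G.vol (fun x => p x - pa x) ^ 2 + l2Norm G.vol (fun x => y x - ya x) ^ 2 := by
  have hy := hc.memLp_state
  have hp := hc.memLp_adjoint
  have hu := hc.control_mem
  have huh := hd.control_mem
  have hyh := hd.state_mem.memLp hT.vol
  have hph := hd.adjoint_mem.memLp hT.vol
  have hya := ha.state_mem.memLp hT.vol
  have hpa := ha.adjoint_mem.memLp hT.vol
  have hdu : MemLp (fun x => u x - uh x) 2 G.vol := hu.sub huh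
  have hdy : MemLp (fun x => y x - yh x) 2 G.vol := hy.sub hyh
  have hdya : MemLp (fun x => y x - ya x) 2 G.vol := hy.sub hya
  have hdpa : MemLp (fun x => p x - pa x) 2 G.vol := hp.sub hpa
  have hdp : MemLp (fun x => pa x - ph x) 2 G.vol := hpa.sub hph
  have e1 := ha.state_sub hT hd hu (ha.adjoint_mem.sub hd.adjoint_mem)
  have e2 := ha.adjoint_sub hT hd hy hyd (ha.state_mem.sub hd.state_mem)
  have e3 : l2Inner G.vol (fun x => y x - yh x) (fun x => ya x - yh x) =
      l2Inner G.vol (fun x => y x - yh x) (fun x => y x - yh x) -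
        l2Inner G.vol (fun x => y x - yh x) (fun x => y x - ya x) := by
    rw [← l2Inner_sub_right hdy hdya hdy]
    simp only [sub_sub_sub_cancel_left]
  have e4 : α * l2Inner G.vol (fun x => u x - uh x) (fun x => u x - uh x) =
      - l2Inner G.vol (fun x => p x - pa x) (fun x => u x - uh x) -
        l2Inner G.vol (fun x => u x - uh x) (fun x => pa x - ph x) := by
    -- Difference of the two control equations, with `p^h` inserted.
    have hneg : (fun x => α * (u x - uh x)) =ᵐ[G.vol]
        fun x => (-1 : ℝ) * (p x - pa x) - (pa x - ph x) := by
      filter_upwards [hc.control_eq, hd.control_eq] with x h1 h2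
      linear_combination h1 - h2
    rw [← l2Inner_const_mul_left, l2Inner_congr_left hneg,
      l2Inner_sub_left (hdpa.const_mul (-1)) hdp hdu, l2Inner_const_mul_left,
      l2Inner_comm (fun x => pa x - ph x)]
    ring
  have e5 := two_mul_l2Inner_le hdya hdy one_pos
  rw [l2Inner_comm (fun x => y x - ya x)] at e5
  have hdpn : MemLp (fun x => (-1 : ℝ) * (p x - pa x)) 2 G.vol := hdpa.const_mul (-1)
  -- The weights `α⁻¹` here and one in `e5` put exactly half of the left side on the right;
  -- absorbing it leaves the constant one.
  have e6 := two_mul_l2Inner_le hdpn hdu (inv_pos.2 hα)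
  rw [l2Inner_const_mul_left, l2Inner_const_mul_left, l2Inner_comm (fun x => p x - pa x) (fun x =>
    (-1 : ℝ) * (p x - pa x)), l2Inner_const_mul_left, inv_inv] at e6
  rw [l2Norm_sq, l2Norm_sq, l2Norm_sq, l2Norm_sq, one_div]
  linarith

end Optimality

end

end CutFEM

theorem mainTheorem2 {Ω : Type*} (R : RandomGeometry Ω) (ω : Ω)
    (κ γ₁ : ℝ) (hκ : 0 < κ) (hγ₁ : 0 < γ₁) :
    ∃ γ₀ : ℝ, 0 < γ₀ ∧ ∀ γD γN : ℝ, 0 < γD → 0 ≤ γN →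
      ∃ C : ℝ, 0 < C ∧
        ∀ T : Triangulation R.holdAll, T.IsQuasiUniform κ →
          T.BoundaryResolved (R.real ω) → T.HasUncutNeighbours (R.real ω) →
        ∀ α : ℝ, 0 < α →
        ∀ f gD gN yd : Plane → ℝ,
          MemLp f 2 (R.real ω).vol → MemLp gD 2 (R.real ω).lenD →
          MemLp gN 2 (R.real ω).lenN → MemLp yd 2 (R.real ω).vol →
        ∀ y p u yh ph uh ya pa : Plane → ℝ,
          IsOptimal (R.real ω) α f gD gN yd y p u →
          IsDiscreteOptimal (R.real ω) T ⟨γD, γN, γ₁⟩ α f gD gN yd yh ph uh →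
          IsAuxiliary (R.real ω) T ⟨γD, γN, γ₁⟩ f gD gN yd y u ya pa →
          α * l2Norm (R.real ω).vol (fun x => u x - uh x) ^ 2 +
              l2Norm (R.real ω).vol (fun x => y x - yh x) ^ 2 ≤
            1 / α * l2Norm (R.real ω).vol (fun x => p x - pa x) ^ 2 +
              l2Norm (R.real ω).vol (fun x => y x - ya x) ^ 2 ∧
          (γ₀ ≤ γD →
            l2Norm (R.real ω).vol (fun x => p x - ph x) ≤
              C * (l2Norm (R.real ω).vol (fun x => p x - pa x) +
                l2Norm (R.real ω).vol (fun x => y x - yh x)) ∧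
            starError (R.real ω) T ⟨γD, γN, γ₁⟩ y yh ≤
              C * (starError (R.real ω) T ⟨γD, γN, γ₁⟩ y ya +
                l2Norm (R.real ω).vol (fun x => u x - uh x)) ∧
            starError (R.real ω) T ⟨γD, γN, γ₁⟩ p ph ≤
              C * (starError (R.real ω) T ⟨γD, γN, γ₁⟩ p pa +
                l2Norm (R.real ω).vol (fun x => y x - yh x))) := by
  obtain ⟨γ₀, hγ₀, hstab⟩ := Triangulation.exists_stability (R.real ω) R.holdAll hκ hγ₁
  have hdom : (R.real ω).domain ⊆ R.holdAll := by
    rw [R.domain_eq ω]; exact fun x hx => hx.1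
  have hfr : frontier (R.real ω).domain ⊆ R.holdAll := by
    rw [R.boundary_eq ω]; exact fun x hx => hx.1
  refine ⟨γ₀, hγ₀, fun γD γN hγD hγN => ?_⟩
  by_cases hle : γ₀ ≤ γD
  swap
  -- Below the threshold only the first estimate is claimed and `C` is arbitrary.
  · refine ⟨1, one_pos, fun T hT hB hN α hα f gD gN yd hf hgD hgN hyd y p u yh ph uh ya pa
      hc hd ha => ⟨?_, fun h => absurd h hle⟩⟩
    exact control_error_le ⟨hκ, hT, hB, hN, hdom, hfr⟩ hα hyd hc hd ha
  obtain ⟨C, hC, hst⟩ := hstab γD γN hle hγN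
  -- The factor two is that of `IsFitted.starError_le`, and `C` is the stability constant.
  refine ⟨2 * (C + 1), by positivity, fun T hT hB hN α hα f gD gN yd hf hgD hgN hyd
    y p u yh ph uh ya pa hc hd ha => ?_⟩
  have hfit : T.IsFitted (R.real ω) κ := ⟨hκ, hT, hB, hN, hdom, hfr⟩
  refine ⟨control_error_le hfit hα hyd hc hd ha, fun _ => ?_⟩
  have hy := hc.memLp_state
  have hyh := hd.state_mem.memLp hfit.vol
  have hdu : MemLp (fun x => u x - uh x) 2 (R.real ω).vol := hc.control_mem.sub hd.control_mem
  have hdy : MemLp (fun x => y x - yh x) 2 (R.real ω).vol := hy.sub hyh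
  have hsa := ha.state_mem.sub hd.state_mem
  have hsp := ha.adjoint_mem.sub hd.adjoint_mem
  -- Stability is applied to the error equations tested with the discrete differences themselves.
  obtain ⟨-, hY⟩ := hst T hfit _ _ hsa hdu (ha.state_sub hfit hd hc.control_mem hsa)
  obtain ⟨hP, hP'⟩ := hst T hfit _ _ hsp hdy (ha.adjoint_sub hfit hd hy hyd hsp)
  have hn1 : 0 ≤ l2Norm (R.real ω).vol fun x => u x - uh x := l2Norm_nonneg _
  have hn2 : 0 ≤ l2Norm (R.real ω).vol fun x => y x - yh x := l2Norm_nonneg _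
  have hn3 : 0 ≤ l2Norm (R.real ω).vol fun x => p x - pa x := l2Norm_nonneg _
  have hs1 : 0 ≤ starError (R.real ω) T ⟨γD, γN, γ₁⟩ y ya := Real.sqrt_nonneg _
  have hs2 : 0 ≤ starError (R.real ω) T ⟨γD, γN, γ₁⟩ p pa := Real.sqrt_nonneg _
  refine ⟨?_, ?_, ?_⟩
  · have h := l2Norm_le_add hc.memLp_adjoint (ha.adjoint_mem.memLp hfit.vol)
      (hd.adjoint_mem.memLp hfit.vol)
    nlinarith [mul_nonneg hC.le hn2, mul_nonneg hC.le hn3]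
  · have h := hfit.starError_le (γ := ⟨γD, γN, γ₁⟩) (y := y) hγD.le ha.state_mem hd.state_mem
    nlinarith [mul_nonneg hC.le hn1, mul_nonneg hC.le hs1]
  · have h := hfit.starError_le (γ := ⟨γD, γN, γ₁⟩) (y := p) hγD.le ha.adjoint_mem hd.adjoint_mem
    nlinarith [mul_nonneg hC.le hn2, mul_nonneg hC.le hs2]
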